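/- **Conventions.** All vector spaces are over $\mathbb{C}$; $D_R(z)\subset\mathbb{C}$ is the open disc of radius $R>0$ with centre $z$. The group $S^1\ltimes\mathbb{C}$ acts on $\mathbb{C}$ by $(q,z)w=qw+z$. A *vertex algebra* is $(V,|0\rangle,T,Y)$ with $Y(a,z)=\sum_n z^{-n-1}a_{(n)}$ satisfying the vacuum, translation and locality axioms; it is *commutative* if $[Y(a,z),Y(b,w)]=0$ for all $a,b$, and *$\mathbb{Z}$-graded* if $V=\bigoplus_{\Delta\in\mathbb{Z}} V_\Delta$ with $|0\rangle\in V_0$ and $a_{(n)}b\in V_{\Delta+\Delta'-n-1}$ for $a\in V_\Delta$, $b\in V_{\Delta'}$. Morphisms of $\mathbb{Z}$-graded vertex algebras are linear maps that preserve $|0\rangle$, $T$, all $n$-th products and the weight spaces. Let $\mathcal{C}$ be the category of commutative $\mathbb{Z}$-graded vertex algebras with $V_\Delta=0$ for $\Delta\ll0$ and $\dim V_\Delta<\infty$ for all $\Delta$. **Prefactorization algebras.** An $S^1\ltimes\mathbb{C}$-equivariant prefactorization algebra $\mathcal{F}$ on $\mathbb{C}$ with values in locally convex spaces consists of locally convex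 spaces $\mathcal{F}(U)$ for $U\subset\mathbb{C}$ open, continuous linear maps $\mathcal{F}^U_V$ for $U\subset V$ (functorial), separately continuous bilinear multiplications $\mathcal{F}^{U,V}_W:\mathcal{F}(U)\times\mathcal{F}(V)\to\mathcal{F}(W)$ for $U\cap V=\varnothing$, $U\cup V\subset W$ (compatible with the maps $\mathcal F^U_V$, commutative, associative), a unit $1\in\mathcal{F}(\varnothing)$, and continuous linear maps $\sigma_{g,U}:\mathcal{F}(U)\to\mathcal{F}(gU)$, $g\in S^1\ltimes\mathbb{C}$, compatible with all this structure and with $\sigma_{gh}=\sigma_g\sigma_h$, $\sigma_1=\mathrm{id}$. Let $\mathcal{F}^0$ be the space of families $(a_R)_{R>0}$ with $a_R\in\mathcal{F}(D_R(0))$ and $\mathcal{F}^{D_r(0)}_{D_R(0)}(a_r)=a_R$ for $r<R$; let $\mathcal{F}(D_R(0))_\Delta=\{a:\sigma_{(q,0)}a=q^\Delta a\ \forall q\in S^1\}$, and let $\mathcal{F}^0_\Delta\subset\mathcal F^0$ be the families with all $a_R\in\mathcal{F}(D_R(0))_\Delta$. For distinct $z_1,\dots,z_l\in D_R(0)$ and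 $a_1,\dots,a_l\in\mathcal{F}^0$ let $\mu^R_{z_1,\dots,z_l}(a_1\otimes\cdots\otimes a_l)\in\mathcal{F}(D_R(0))$ be the product of the elements $\sigma_{(1,z_i)}(a_i)_r\in\mathcal{F}(D_r(z_i))$, where $r>0$ is any number for which the discs $D_r(z_i)$ are disjoint and contained in $D_R(0)$. $\mathcal{F}$ is *holomorphic* if: (i) $\mathcal{F}^{D_r(0)}_{D_R(0)}$ maps $\mathcal{F}(D_r(0))_\Delta$ bijectively onto $\mathcal{F}(D_R(0))_\Delta$ for $r<R$; (ii) $\mathcal{F}(D_R(0))_\Delta=0$ for $\Delta\ll0$; (iii) $\mathcal{F}(D_R(0))$ is Hausdorff and quasi-complete; (iv) for homogeneous $a_i$ the function $(z_1,\dots,z_l)\mapsto\mu^R_{z_1,\dots,z_l}(a_1\otimes\cdots\otimes a_l)$ is complex differentiable at each point of the configuration space of $D_R(0)$. In that case $\mathbf{V}(\mathcal{F})=\bigoplus_\Delta\mathcal{F}^0_\Delta$ carries a $\mathbb{Z}$-graded vertex algebra structure, determined for all $R>0$ by $|0\rangle_R=\mathcal{F}^{\varnothing}_{D_R(0)}(1)$,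 $(Ta)_R=\partial_z\mu^R_z(a)|_{z=0}$, and $\mu^R_{z,0}(a\otimes b)=\sum_{n\in\mathbb{Z}}z^{-n-1}(a_{(n)}b)_R$ for $0<|z|<R$. **The prefactorization algebra of $V$.** Let $V\in\mathcal{C}$. Let $\overline V=\prod_\Delta V_\Delta$ with the product topology, the commutative multiplication extending $ab=a_{(-1)}b$, and the action of $(q,z)$ by $e^{zT}q^{L_0}$, where $q^{L_0}=q^\Delta$ on $V_\Delta$. For a finite disjoint union $L=D_{r_1}(z_1)\sqcup\dots\sqcup D_{r_l}(z_l)$ put $F(L)=\overline V^{\otimes l}$ (one factor for each disc; $F(\varnothing)=\mathbb{C}$), with the projective tensor product topology. For $L\subset M=D_{R_1}(w_1)\sqcup\dots\sqcup D_{R_m}(w_m)$ the map $F(L)\to F(M)$ is $\otimes_i a_i\mapsto\otimes_j\prod_{i:\,D_{r_i}(z_i)\subset D_{R_j}(w_j)}a_i$; the multiplication $F(L)\times F(M)\to F(N)$ for $L\sqcup M\subset N$ is the composition of $F(L)\otimes F(M)=F(L\sqcup M)$ with $F(L\sqcup M)\to F(N)$; and $\sigma_{(q,z)}:F(L)\to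 F((q,z)L)$ applies $e^{zT}q^{L_0}$ to each factor. For $U\subset\mathbb{C}$ open put $\mathbf{F}^{\mathrm{loc}}_{\overline V}(U)=\varinjlim_{L\subset U}F(L)$ with the locally convex inductive limit topology; with the induced structure this is an $S^1\ltimes\mathbb{C}$-equivariant prefactorization algebra, and a morphism $f:V\to W$ in $\mathcal{C}$ induces a morphism $\mathbf{F}^{\mathrm{loc}}_{\overline f}:\mathbf{F}^{\mathrm{loc}}_{\overline V}\to\mathbf{F}^{\mathrm{loc}}_{\overline W}$ by applying $\overline f:\overline V\to\overline W$ to each factor. Let $\eta_V:V\to\mathbf{V}(\mathbf{F}^{\mathrm{loc}}_{\overline V})$ be the linear map sending $a\in V_\Delta$ to the family, indexed by $R>0$, of its images under the canonical maps $V_\Delta\subset\overline V=F(D_R(0))\to\mathbf{F}^{\mathrm{loc}}_{\overline V}(D_R(0))$. **Proposition.** For every $V\in\mathcal{C}$: 1. $\mathbf{F}^{\mathrm{loc}}_{\overline V}$ is a holomorphic prefactorization algebra, and there is exactly one $\mathbb{Z}$-graded vertex algebra structure on $\mathbf{V}(\mathbf{F}^{\mathrm{loc}}_{\overline V})$ given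 by the formulas above for $|0\rangle$, $T$ and $Y$; 2. with this structure $\mathbf{V}(\mathbf{F}^{\mathrm{loc}}_{\overline V})$ is an object of $\mathcal{C}$, and $\eta_V:V\to\mathbf{V}(\mathbf{F}^{\mathrm{loc}}_{\overline V})$ is an isomorphism of $\mathbb{Z}$-graded vertex algebras; 3. $\eta$ is natural: for every morphism $f:V\to W$ in $\mathcal{C}$, $\mathbf{V}(\mathbf{F}^{\mathrm{loc}}_{\overline f})\circ\eta_V=\eta_W\circ f$, where $\mathbf{V}(\varphi)$ denotes the map induced componentwise by a morphism $\varphi$. -/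

import Mathlib

open TopologicalSpace
open scoped DirectSum TensorProduct Pointwise Topology

universe u

/-- A vertex algebra over `ℂ`. The field `Y a` is a Mathlib `VertexOperator`, i.e. a linear map
from `V` to Laurent series with coefficients in `V`, and `VertexOperator.ncoeff (Y a) n` is the
coefficient `a_(n)` of `z ^ (-n - 1)`. -/
structure VertexAlgebra (V : Type u) [AddCommGroup V] [Module ℂ V] where
  /-- the vacuum -/
  vac : V
  /-- the translation operator -/
  T : V →ₗ[ℂ] V
  /-- the state-field correspondence -/
  Y : V →ₗ[ℂ] VertexOperator ℂ V
  /-- `Y(vac, z) = id` -/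
  vac_left : ∀ (n : ℤ) (a : V), VertexOperator.ncoeff (Y vac) n a = if n = -1 then a else 0
  /-- `Y(a, z) vac` is a power series -/
  vac_right : ∀ (a : V) (n : ℕ), VertexOperator.ncoeff (Y a) n vac = 0
  /-- the constant term of `Y(a, z) vac` is `a` -/
  vac_right_neg_one : ∀ a : V, VertexOperator.ncoeff (Y a) (-1) vac = a
  T_vac : T vac = 0
  /-- `[T, Y(a, z)] = ∂_z Y(a, z)`, coefficientwise -/
  translation : ∀ (a b : V) (n : ℤ),
    T (VertexOperator.ncoeff (Y a) n b) - VertexOperator.ncoeff (Y a) n (T b) =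
      (-n : ℂ) • VertexOperator.ncoeff (Y a) (n - 1) b
  /-- `(z - w) ^ N [Y(a, z), Y(b, w)] = 0`, coefficientwise: the left-hand side below is the
  coefficient of `z ^ (-m - 1) w ^ (-n - 1)`, applied to `c` -/
  locality : ∀ a b : V, ∃ N : ℕ, ∀ (m n : ℤ) (c : V),
    ∑ k ∈ Finset.range (N + 1), ((-1 : ℂ) ^ k * (N.choose k : ℂ)) •
      (VertexOperator.ncoeff (Y a) (m + N - k) (VertexOperator.ncoeff (Y b) (n + k) c) -
        VertexOperator.ncoeff (Y b) (n + k) (VertexOperator.ncoeff (Y a) (m + N - k) c)) = 0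

namespace VertexAlgebra

variable {V : Type u} [AddCommGroup V] [Module ℂ V] (S : VertexAlgebra V)

/-- The `n`-th product `a_(n) b`. -/
noncomputable def nprod (n : ℤ) : V →ₗ[ℂ] V →ₗ[ℂ] V :=
  (LinearMap.proj n).comp ((VertexOperator.ncoeff (R := ℂ) (V := V)).comp S.Y)

theorem nprod_apply (n : ℤ) (a b : V) : S.nprod n a b = VertexOperator.ncoeff (S.Y a) n b := rfl

/-- A vertex algebra is commutative if `[Y(a, z), Y(b, w)] = 0` for all `a` and `b`. -/
def IsCommutative : Prop :=
  ∀ (a b : V) (m n : ℤ) (c : V), S.nprod m a (S.nprod n b c) = S.nprod n b (S.nprod m a c)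

end VertexAlgebra

/-- A `ℤ`-graded vertex algebra with weight spaces `V Δ`; its state space is `⨁ Δ, V Δ`. -/
structure GradedVertexAlgebra (V : ℤ → Type u) [∀ Δ, AddCommGroup (V Δ)] [∀ Δ, Module ℂ (V Δ)]
    extends VertexAlgebra (⨁ Δ, V Δ) where
  vac_mem : vac ∈ LinearMap.range (DirectSum.lof ℂ ℤ V 0)
  nprod_mem : ∀ (Δ Δ' n : ℤ) (a : V Δ) (b : V Δ'),
    VertexOperator.ncoeff (Y (DirectSum.lof ℂ ℤ V Δ a)) n (DirectSum.lof ℂ ℤ V Δ' b) ∈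
      LinearMap.range (DirectSum.lof ℂ ℤ V (Δ + Δ' - n - 1))

/-- Morphisms of `ℤ`-graded vertex algebras. -/
structure GradedVertexAlgebra.IsHom {V W : ℤ → Type u}
    [∀ Δ, AddCommGroup (V Δ)] [∀ Δ, Module ℂ (V Δ)]
    [∀ Δ, AddCommGroup (W Δ)] [∀ Δ, Module ℂ (W Δ)]
    (S : GradedVertexAlgebra V) (S' : GradedVertexAlgebra W)
    (f : (⨁ Δ, V Δ) →ₗ[ℂ] (⨁ Δ, W Δ)) : Prop where
  map_vac : f S.vac = S'.vac
  map_T : ∀ a, f (S.T a) = S'.T (f a)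
  map_nprod : ∀ (n : ℤ) (a b), f (S.nprod n a b) = S'.nprod n (f a) (f b)
  map_weight : ∀ (Δ : ℤ) (a : V Δ),
    f (DirectSum.lof ℂ ℤ V Δ a) ∈ LinearMap.range (DirectSum.lof ℂ ℤ W Δ)

/-- Isomorphisms of `ℤ`-graded vertex algebras: morphisms with an inverse morphism. -/
def GradedVertexAlgebra.IsIso {V W : ℤ → Type u}
    [∀ Δ, AddCommGroup (V Δ)] [∀ Δ, Module ℂ (V Δ)]
    [∀ Δ, AddCommGroup (W Δ)] [∀ Δ, Module ℂ (W Δ)]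
    (S : GradedVertexAlgebra V) (S' : GradedVertexAlgebra W)
    (f : (⨁ Δ, V Δ) →ₗ[ℂ] (⨁ Δ, W Δ)) : Prop :=
  GradedVertexAlgebra.IsHom S S' f ∧ ∃ g : (⨁ Δ, W Δ) →ₗ[ℂ] (⨁ Δ, V Δ),
    GradedVertexAlgebra.IsHom S' S g ∧ g ∘ₗ f = LinearMap.id ∧ f ∘ₗ g = LinearMap.id

/-- The objects of the category of commutative `ℤ`-graded vertex algebras whose weight spaces are
finite-dimensional and vanish in sufficiently negative weight. -/
structure GrComVA where
  /-- the weight spaces -/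
  wt : ℤ → Type u
  [addCommGroup : ∀ Δ, AddCommGroup (wt Δ)]
  [module : ∀ Δ, Module ℂ (wt Δ)]
  /-- the vertex algebra structure on the direct sum of the weight spaces -/
  va : GradedVertexAlgebra wt
  comm : va.IsCommutative
  bdd : ∃ N : ℤ, ∀ Δ < N, Subsingleton (wt Δ)
  [fin : ∀ Δ, FiniteDimensional ℂ (wt Δ)]

attribute [instance] GrComVA.addCommGroup GrComVA.module GrComVA.fin

namespace GrComVA

variable (V : GrComVA.{u})

/-- The inclusion of a weight space. -/
noncomputable abbrev inc (Δ : ℤ) : V.wt Δ →ₗ[ℂ] ⨁ Δ, V.wt Δ := DirectSum.lof ℂ ℤ V.wt Δ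

/-- The projection to a weight space. -/
noncomputable abbrev prj (Δ : ℤ) : (⨁ Δ, V.wt Δ) →ₗ[ℂ] V.wt Δ := DirectSum.component ℂ ℤ V.wt Δ

/-- The product `a b = a_(-1) b`. -/
noncomputable abbrev mulV : (⨁ Δ, V.wt Δ) →ₗ[ℂ] (⨁ Δ, V.wt Δ) →ₗ[ℂ] ⨁ Δ, V.wt Δ :=
  V.va.nprod (-1)

theorem mulV_vac (a) : V.mulV a V.va.vac = a := V.va.vac_right_neg_one a

theorem vac_mulV (a) : V.mulV V.va.vac a = a := by
  simp [mulV, VertexAlgebra.nprod_apply, V.va.vac_left]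

theorem mulV_comm (a b) : V.mulV a b = V.mulV b a := by
  have h := V.comm a b (-1) (-1) V.va.vac
  rwa [V.mulV_vac, V.mulV_vac] at h

theorem mulV_assoc (a b c) : V.mulV (V.mulV a b) c = V.mulV a (V.mulV b c) := by
  rw [V.mulV_comm _ c, V.mulV_comm b c]
  exact V.comm c a (-1) (-1) b

theorem T_eq (a) : V.va.nprod (-2) a V.va.vac = V.va.T a := by
  have h := V.va.translation a V.va.vac (-1)
  rw [V.va.T_vac, map_zero, sub_zero, V.va.vac_right_neg_one] at h
  simp at h
  rw [h]; rfl

theorem T_mulV (a b) : V.va.T (V.mulV a b) = V.mulV (V.va.T a) b + V.mulV a (V.va.T b) := by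
  have h := V.va.translation a b (-1)
  have h2 : V.va.nprod (-2) a b = V.mulV (V.va.T a) b := by
    have h3 := V.comm a b (-2) (-1) V.va.vac
    rw [V.mulV_vac, V.T_eq] at h3
    rw [h3, V.mulV_comm]
  rw [← h2]
  simp at h
  rw [sub_eq_iff_eq_add] at h
  exact h

theorem T_mem (Δ : ℤ) (a : V.wt Δ) :
    V.va.T (V.inc Δ a) ∈ LinearMap.range (V.inc (Δ + 1)) := by
  rw [← V.T_eq]
  obtain ⟨v, hv⟩ := V.va.vac_mem
  have := V.va.nprod_mem Δ 0 (-2) a v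
  rw [hv] at this
  have e : Δ + 0 - (-2) - 1 = Δ + 1 := by ring
  rw [e] at this
  exact this

theorem mulV_mem (p q : ℤ) (a : V.wt p) (b : V.wt q) :
    V.mulV (V.inc p a) (V.inc q b) ∈ LinearMap.range (V.inc (p + q)) := by
  have := V.va.nprod_mem p q (-1) a b
  have e : p + q - (-1) - 1 = p + q := by ring
  rw [e] at this
  exact this

theorem inc_prj {Δ : ℤ} {x} (h : x ∈ LinearMap.range (V.inc Δ)) : V.inc Δ (V.prj Δ x) = x := by
  obtain ⟨y, rfl⟩ := h
  simp [inc, prj, DirectSum.component.lof_self]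

theorem prj_ne {Δ Δ' : ℤ} (hn : Δ ≠ Δ') {x} (h : x ∈ LinearMap.range (V.inc Δ)) :
    V.prj Δ' x = 0 := by
  obtain ⟨y, rfl⟩ := h
  exact DirectSum.of_eq_of_ne _ _ _ hn.symm

end GrComVA

namespace GrComVA

variable (V : GrComVA.{u})

/-- The product `V_p × V_q → V_Δ`, i.e. `(a, b) ↦ a_(-1) b` followed by the projection to `V_Δ`. -/
noncomputable def prodComp (p q Δ : ℤ) : V.wt p →ₗ[ℂ] V.wt q →ₗ[ℂ] V.wt Δ :=
  (V.mulV.compl₁₂ (V.inc p) (V.inc q)).compr₂ (V.prj Δ)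

/-- The completion `∏ Δ, V_Δ`. -/
def Completion : Type u := ∀ Δ, V.wt Δ

noncomputable instance : AddCommGroup V.Completion := inferInstanceAs (AddCommGroup (∀ Δ, V.wt Δ))

noncomputable instance : Module ℂ V.Completion := inferInstanceAs (Module ℂ (∀ Δ, V.wt Δ))

/-- The canonical topology of a finite-dimensional weight space. -/
noncomputable instance (Δ : ℤ) : TopologicalSpace (V.wt Δ) := moduleTopology ℂ (V.wt Δ)

instance (Δ : ℤ) : IsModuleTopology ℂ (V.wt Δ) := ⟨rfl⟩

/-- The product topology. -/
noncomputable instance : TopologicalSpace V.Completion :=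
  inferInstanceAs (TopologicalSpace (∀ Δ, V.wt Δ))

instance (Δ : ℤ) : IsTopologicalAddGroup (V.wt Δ) := IsModuleTopology.topologicalAddGroup ℂ _

instance (Δ : ℤ) : ContinuousSMul ℂ (V.wt Δ) := IsModuleTopology.toContinuousSMul ℂ _

instance (Δ : ℤ) : T2Space (V.wt Δ) :=
  T2Space.of_injective_continuous (f := Module.finBasis ℂ (V.wt Δ) |>.equivFun)
    (LinearEquiv.injective _)
    (IsModuleTopology.continuous_of_linearMap (Module.finBasis ℂ (V.wt Δ)).equivFun.toLinearMap)

instance : IsTopologicalAddGroup V.Completion :=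
  inferInstanceAs (IsTopologicalAddGroup (∀ Δ, V.wt Δ))

instance : ContinuousSMul ℂ V.Completion := inferInstanceAs (ContinuousSMul ℂ (∀ Δ, V.wt Δ))

instance : T2Space V.Completion := inferInstanceAs (T2Space (∀ Δ, V.wt Δ))

namespace Completion

variable {V}

/-- The projection of the completion to `V_Δ`. -/
def coord (a : V.Completion) (Δ : ℤ) : V.wt Δ := a Δ

/-- The element of the completion with given components. -/
def mk (f : ∀ Δ, V.wt Δ) : V.Completion := f

@[simp] theorem coord_mk (f : ∀ Δ, V.wt Δ) (Δ : ℤ) : (mk f).coord Δ = f Δ := rfl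

theorem ext {a b : V.Completion} (h : ∀ Δ, a.coord Δ = b.coord Δ) : a = b := funext h

theorem coord_add (a b : V.Completion) (Δ : ℤ) : (a + b).coord Δ = a.coord Δ + b.coord Δ := rfl

theorem coord_smul (c : ℂ) (b : V.Completion) (Δ : ℤ) : (c • b).coord Δ = c • b.coord Δ := rfl

variable (V) in
/-- The inclusion of a weight space. -/
noncomputable def single (Δ : ℤ) : V.wt Δ →ₗ[ℂ] V.Completion :=
  LinearMap.single (R := ℂ) (φ := V.wt) Δ

theorem single_same (p : ℤ) (x : V.wt p) : (single V p x).coord p = x :=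
  Pi.single_eq_same (M := V.wt) p x

theorem single_ne {p Δ : ℤ} (h : Δ ≠ p) (x : V.wt p) : (single V p x).coord Δ = 0 :=
  Pi.single_eq_of_ne (M := V.wt) h x

theorem single_coord (p Δ : ℤ) (x : V.wt p) :
    (single V p x).coord Δ = V.prj Δ (V.inc p x) := by
  by_cases h : p = Δ
  · subst h
    rw [single_same]; exact (DirectSum.component.lof_self ℂ p x).symm
  · rw [V.prj_ne h ⟨x, rfl⟩, single_ne (Ne.symm h)]

theorem continuous_coord (Δ : ℤ) : Continuous fun a : V.Completion => a.coord Δ :=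
  _root_.continuous_apply (A := V.wt) Δ

theorem continuous_of_coord {X : Type*} [TopologicalSpace X] {f : X → V.Completion}
    (h : ∀ Δ, Continuous fun x => (f x).coord Δ) : Continuous f :=
  _root_.continuous_pi (A := V.wt) h

/-- Continuous linear maps on the completion are determined by homogeneous elements. -/
theorem linearMap_ext {E : Type*} [AddCommGroup E] [Module ℂ E] [TopologicalSpace E] [T2Space E]
    {f g : V.Completion →ₗ[ℂ] E} (hf : Continuous f) (hg : Continuous g)
    (h : ∀ p x, f (single V p x) = g (single V p x)) : f = g := by
  ext a
  have key : HasSum (fun p => single V p (a.coord p)) a := by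
    refine (Pi.hasSum (X := V.wt) (f := fun p => single V p (a.coord p)) (g := a)).2 fun Δ => ?_
    have := hasSum_single (f := fun p => (single V p (a.coord p)).coord Δ) Δ
      (fun p hp => single_ne (Ne.symm hp) _)
    rwa [single_same] at this
  have h1 := key.map f hf
  have h2 := key.map g hg
  have e : (f ∘ fun p => single V p (a.coord p)) = (g ∘ fun p => single V p (a.coord p)) := by
    funext p; exact h p _
  rw [e] at h1
  exact h1.unique h2

/-- The product of the completion: `(a b)_Δ = ∑ p, a_p b_(Δ - p)`, a finite sum. -/
noncomputable instance : Mul V.Completion :=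
  ⟨fun a b => mk fun Δ => ∑ᶠ p, V.prodComp p (Δ - p) Δ (a.coord p) (b.coord (Δ - p))⟩

theorem coord_mul (a b : V.Completion) (Δ : ℤ) :
    (a * b).coord Δ = ∑ᶠ p, V.prodComp p (Δ - p) Δ (a.coord p) (b.coord (Δ - p)) := rfl

theorem coord_mul_sum {N : ℤ} (hN : ∀ Δ < N, Subsingleton (V.wt Δ)) (a b : V.Completion) (Δ : ℤ) :
    (a * b).coord Δ =
      ∑ p ∈ Finset.Icc N (Δ - N), V.prodComp p (Δ - p) Δ (a.coord p) (b.coord (Δ - p)) := by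
  rw [coord_mul]
  refine finsum_eq_sum_of_support_subset _ fun p hp => ?_
  simp only [Finset.coe_Icc, Set.mem_Icc]
  by_contra hcon
  apply hp
  beta_reduce
  by_cases h : p < N
  · have := hN p h
    rw [Subsingleton.elim (a.coord p) 0]; simp
  · have := hN (Δ - p) (by lia)
    rw [Subsingleton.elim (b.coord (Δ - p)) 0]; simp

theorem single_mul_single (p q : ℤ) (x : V.wt p) (y : V.wt q) :
    single V p x * single V q y = single V (p + q) (V.prodComp p q (p + q) x y) := by
  refine ext fun Δ => ?_
  rw [coord_mul, finsum_eq_single _ p (fun r hr => by rw [single_ne hr]; simp), single_same]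
  by_cases h : Δ = p + q
  · subst h
    rw [single_same]
    have h1 : ∀ r, r = q → V.prodComp p r (p + q) x ((single V q y).coord r) =
        V.prodComp p q (p + q) x y := by
      rintro r rfl; rw [single_same]
    exact h1 _ (by ring)
  · rw [single_ne h, single_ne (by lia), map_zero]

protected theorem add_mul (a b c : V.Completion) : (a + b) * c = a * c + b * c := by
  obtain ⟨N, hN⟩ := V.bdd
  refine ext fun Δ => ?_
  simp only [coord_add, coord_mul_sum hN, map_add, LinearMap.add_apply, Finset.sum_add_distrib]

protected theorem mul_add (a b c : V.Completion) : a * (b + c) = a * b + a * c := by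
  obtain ⟨N, hN⟩ := V.bdd
  refine ext fun Δ => ?_
  simp only [coord_add, coord_mul_sum hN, map_add, Finset.sum_add_distrib]

protected theorem smul_mul (r : ℂ) (a b : V.Completion) : (r • a) * b = r • (a * b) := by
  obtain ⟨N, hN⟩ := V.bdd
  refine ext fun Δ => ?_
  simp only [coord_smul, coord_mul_sum hN, Finset.smul_sum, map_smul, LinearMap.smul_apply]

protected theorem mul_smul (r : ℂ) (a b : V.Completion) : a * (r • b) = r • (a * b) := by
  obtain ⟨N, hN⟩ := V.bdd
  refine ext fun Δ => ?_
  simp only [coord_smul, coord_mul_sum hN, Finset.smul_sum, map_smul]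

theorem continuous_prodComp (p q Δ : ℤ) :
    Continuous fun x : V.wt p × V.wt q => V.prodComp p q Δ x.1 x.2 :=
  IsModuleTopology.continuous_bilinear_of_finite_left (V.prodComp p q Δ)

theorem continuous_coord_mul (Δ : ℤ) :
    Continuous fun x : V.Completion × V.Completion => (x.1 * x.2).coord Δ := by
  obtain ⟨N, hN⟩ := V.bdd
  have h : ∀ p, Continuous fun x : V.Completion × V.Completion =>
      V.prodComp p (Δ - p) Δ (x.1.coord p) (x.2.coord (Δ - p)) := fun p => by
    have h1 := continuous_prodComp (V := V) p (Δ - p) Δ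
    generalize V.prodComp p (Δ - p) Δ = B at h1 ⊢
    have h2 : Continuous fun x : V.Completion × V.Completion => x.1.coord p :=
      (continuous_coord p).comp continuous_fst
    have h3 : Continuous fun x : V.Completion × V.Completion => x.2.coord (Δ - p) :=
      (continuous_coord (Δ - p)).comp continuous_snd
    exact h1.comp (h2.prodMk h3)
  have e : (fun x : V.Completion × V.Completion => (x.1 * x.2).coord Δ) = fun x =>
      ∑ p ∈ Finset.Icc N (Δ - N), V.prodComp p (Δ - p) Δ (x.1.coord p) (x.2.coord (Δ - p)) :=
    funext fun x => coord_mul_sum hN x.1 x.2 Δ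
  rw [e]
  exact continuous_finsetSum _ fun p _ => h p

instance : ContinuousMul V.Completion := ⟨continuous_of_coord continuous_coord_mul⟩

/-- Multiplication as a bilinear map. -/
noncomputable def mulHom : V.Completion →ₗ[ℂ] V.Completion →ₗ[ℂ] V.Completion :=
  LinearMap.mk₂ ℂ (· * ·) Completion.add_mul Completion.smul_mul Completion.mul_add
    Completion.mul_smul

/-- The unit of the completion is the vacuum. -/
noncomputable instance : One V.Completion := ⟨mk fun Δ => V.prj Δ V.va.vac⟩

theorem one_eq : (1 : V.Completion) = single V 0 (V.prj 0 V.va.vac) := by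
  refine ext fun Δ => ?_
  rw [single_coord, V.inc_prj V.va.vac_mem]
  rfl

theorem inc_prodComp (p q : ℤ) (x : V.wt p) (y : V.wt q) :
    V.inc (p + q) (V.prodComp p q (p + q) x y) = V.mulV (V.inc p x) (V.inc q y) :=
  V.inc_prj (V.mulV_mem p q x y)

theorem single_eq_of_inc_eq {p q : ℤ} {x : V.wt p} {y : V.wt q} (h : V.inc p x = V.inc q y) :
    single V p x = single V q y := by
  refine ext fun Δ => ?_
  rw [single_coord, single_coord, h]

theorem continuous_mul_left' (a : V.Completion) : Continuous fun b => a * b :=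
  continuous_const.mul continuous_id

theorem continuous_mul_right' (a : V.Completion) : Continuous fun b => b * a :=
  continuous_id.mul continuous_const

protected theorem mul_comm (a b : V.Completion) : a * b = b * a := by
  have h1 : ∀ q y, mulHom.flip (single V q y) = mulHom (single V q y) := fun q y =>
    linearMap_ext (continuous_mul_right' _) (continuous_mul_left' _) fun p x => by
      change single V p x * single V q y = single V q y * single V p x
      rw [single_mul_single, single_mul_single]
      refine single_eq_of_inc_eq ?_
      rw [inc_prodComp, inc_prodComp, V.mulV_comm]
  have h2 : mulHom a = mulHom.flip a :=
    linearMap_ext (continuous_mul_left' _) (continuous_mul_right' _) fun q y =>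
      LinearMap.congr_fun (h1 q y) a
  exact LinearMap.congr_fun h2 b

protected theorem one_mul (a : V.Completion) : 1 * a = a := by
  have h : mulHom (1 : V.Completion) = LinearMap.id :=
    linearMap_ext (continuous_mul_left' _) continuous_id fun q y => by
      change 1 * single V q y = single V q y
      rw [one_eq, single_mul_single]
      refine single_eq_of_inc_eq ?_
      rw [inc_prodComp, V.inc_prj V.va.vac_mem, V.vac_mulV]
  exact LinearMap.congr_fun h a

protected theorem mul_assoc (a b c : V.Completion) : a * b * c = a * (b * c) := by
  have h1 : ∀ p x q y r z, single V p x * single V q y * single V r z =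
      single V p x * (single V q y * single V r z) := by
    intro p x q y r z
    simp only [single_mul_single]
    refine single_eq_of_inc_eq ?_
    simp only [inc_prodComp, V.mulV_assoc]
  have h2 : ∀ p x q y c, single V p x * single V q y * c = single V p x * (single V q y * c) := by
    intro p x q y c
    have : mulHom (single V p x * single V q y) =
        mulHom (single V p x) ∘ₗ mulHom (single V q y) :=
      linearMap_ext (continuous_mul_left' _)
        ((continuous_mul_left' _).comp (continuous_mul_left' _)) fun r z => h1 p x q y r z
    exact LinearMap.congr_fun this c
  have h3 : ∀ p x b c, single V p x * b * c = single V p x * (b * c) := by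
    intro p x b c
    have : mulHom.flip c ∘ₗ mulHom (single V p x) = mulHom (single V p x) ∘ₗ mulHom.flip c :=
      linearMap_ext ((continuous_mul_right' _).comp (continuous_mul_left' _))
        ((continuous_mul_left' _).comp (continuous_mul_right' _)) fun q y => h2 p x q y c
    exact LinearMap.congr_fun this b
  have : mulHom.flip c ∘ₗ mulHom.flip b = mulHom.flip (b * c) :=
    linearMap_ext ((continuous_mul_right' _).comp (continuous_mul_right' _))
      (continuous_mul_right' _) fun p x => h3 p x b c
  exact LinearMap.congr_fun this a

noncomputable instance : CommRing V.Completion where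
  __ := (inferInstance : AddCommGroup V.Completion)
  mul := (· * ·)
  one := 1
  mul_assoc := Completion.mul_assoc
  mul_comm := Completion.mul_comm
  one_mul := Completion.one_mul
  mul_one a := by rw [Completion.mul_comm, Completion.one_mul]
  left_distrib := Completion.mul_add
  right_distrib := Completion.add_mul
  zero_mul a := LinearMap.map_zero₂ mulHom a
  mul_zero a := (mulHom a).map_zero

noncomputable instance : Algebra ℂ V.Completion :=
  Algebra.ofModule Completion.smul_mul Completion.mul_smul

/-- The operator `T ^ n : V_p → V_Δ` followed by the projection. -/
noncomputable def powT (n : ℕ) (p Δ : ℤ) : V.wt p →ₗ[ℂ] V.wt Δ :=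
  V.prj Δ ∘ₗ (V.va.T ^ n) ∘ₗ V.inc p

/-- The operator `e ^ (zT)` on the completion: `(e ^ (zT) a)_Δ = ∑ n, (z ^ n / n!) T ^ n a_(Δ - n)`,
a finite sum. -/
noncomputable def expT (z : ℂ) (a : V.Completion) : V.Completion := mk fun Δ =>
  ∑ᶠ n : ℕ, (z ^ n / (n.factorial : ℂ)) • powT n (Δ - n) Δ (a.coord (Δ - n))

theorem coord_expT_sum {N : ℤ} (hN : ∀ Δ < N, Subsingleton (V.wt Δ)) (z : ℂ)
    (a : V.Completion) (Δ : ℤ) : (expT z a).coord Δ =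
      ∑ n ∈ Finset.range (Δ - N + 1).toNat,
        (z ^ n / (n.factorial : ℂ)) • powT n (Δ - n) Δ (a.coord (Δ - n)) := by
  refine finsum_eq_sum_of_support_subset _ fun n hn => ?_
  simp only [Finset.coe_range, Set.mem_Iio]
  by_contra hcon
  apply hn
  beta_reduce
  have := hN (Δ - n) (by lia)
  rw [Subsingleton.elim (a.coord (Δ - n)) 0]; simp

/-- `e ^ (zT)` as a linear map. -/
noncomputable def expTLin (z : ℂ) : V.Completion →ₗ[ℂ] V.Completion where
  toFun := expT z
  map_add' a b := by
    obtain ⟨N, hN⟩ := V.bdd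
    refine ext fun Δ => ?_
    simp only [coord_add, coord_expT_sum hN, map_add, smul_add, Finset.sum_add_distrib]
  map_smul' c a := by
    obtain ⟨N, hN⟩ := V.bdd
    refine ext fun Δ => ?_
    simp only [coord_smul, coord_expT_sum hN, map_smul, RingHom.id_apply, Finset.smul_sum]
    exact Finset.sum_congr rfl fun n _ => smul_comm _ _ _

theorem continuous_expT (z : ℂ) : Continuous (expT (V := V) z) := by
  obtain ⟨N, hN⟩ := V.bdd
  refine continuous_of_coord fun Δ => ?_
  simp only [coord_expT_sum hN]
  refine continuous_finsetSum _ fun n _ => ?_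
  exact ((IsModuleTopology.continuous_of_linearMap (R := ℂ) (powT (V := V) n (Δ - n) Δ)).comp
    (continuous_coord (Δ - n))).const_smul _

theorem pow_T_mem (n : ℕ) (p : ℤ) (x : V.wt p) :
    (V.va.T ^ n) (V.inc p x) ∈ LinearMap.range (V.inc (p + n)) := by
  induction n with
  | zero => rw [Nat.cast_zero, add_zero]; exact ⟨x, rfl⟩
  | succ n ih =>
    obtain ⟨y, hy⟩ := ih
    rw [pow_succ', Module.End.mul_apply, ← hy]
    have := V.T_mem _ y
    rwa [show p + (n : ℤ) + 1 = p + ((n + 1 : ℕ) : ℤ) by push_cast; ring] at this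

/-- The embedding of the state space in the completion. -/
noncomputable def incl (v : ⨁ Δ, V.wt Δ) : V.Completion := mk fun Δ => V.prj Δ v

theorem coord_expT_single (z : ℂ) (p : ℤ) (x : V.wt p) (k : ℕ) :
    (expT z (single V p x)).coord (p + k) =
      (z ^ k / (k.factorial : ℂ)) • V.prj (p + k) ((V.va.T ^ k) (V.inc p x)) := by
  change (∑ᶠ n : ℕ, _) = _
  rw [finsum_eq_single _ k]
  · congr 1
    have h1 : ∀ r, r = p → powT k r (p + k) ((single V p x).coord r) =
        V.prj (p + k) ((V.va.T ^ k) (V.inc p x)) := by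
      rintro r rfl; rw [single_same]; rfl
    exact h1 _ (by ring)
  · intro n hn
    rw [single_ne (by lia)]; simp

theorem coord_expT_single_lt (z : ℂ) (p : ℤ) (x : V.wt p) {Δ : ℤ} (h : Δ < p) :
    (expT z (single V p x)).coord Δ = 0 := by
  change (∑ᶠ n : ℕ, _) = _
  refine finsum_eq_zero_of_forall_eq_zero fun n => ?_
  rw [single_ne (by lia)]; simp

theorem T_pow_mulV (n : ℕ) (a b) : (V.va.T ^ n) (V.mulV a b) =
    ∑ ij ∈ Finset.HasAntidiagonal.antidiagonal n,
      n.choose ij.1 • V.mulV ((V.va.T ^ ij.1) a) ((V.va.T ^ ij.2) b) := by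
  induction n with
  | zero => simp
  | succ n ih =>
    rw [Finset.sum_antidiagonal_choose_succ_nsmul
      (M := ⨁ Δ, V.wt Δ) (fun i j => V.mulV ((V.va.T ^ i) a) ((V.va.T ^ j) b)) n,
      pow_succ', Module.End.mul_apply, ih, map_sum, ← Finset.sum_add_distrib]
    refine Finset.sum_congr rfl fun ij hij => ?_
    rw [map_nsmul, V.T_mulV, nsmul_add, add_comm, pow_succ' V.va.T ij.2, pow_succ' V.va.T ij.1,
      n.choose_symm_of_eq_add (Finset.HasAntidiagonal.mem_antidiagonal.1 hij).symm]
    rfl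

theorem eq_of_coord_add {p : ℤ} {a b : V.Completion} (ha : ∀ Δ < p, a.coord Δ = 0)
    (hb : ∀ Δ < p, b.coord Δ = 0) (h : ∀ k : ℕ, a.coord (p + k) = b.coord (p + k)) : a = b := by
  refine ext fun Δ => ?_
  by_cases hlt : Δ < p
  · rw [ha Δ hlt, hb Δ hlt]
  · obtain ⟨k, hk⟩ := Int.le.dest (not_lt.1 hlt)
    rw [← hk]; exact h k

theorem inc_coord_expT_single (z : ℂ) (p : ℤ) (x : V.wt p) (k : ℕ) {Δ : ℤ} (h : Δ = p + k) :
    V.inc Δ ((expT z (single V p x)).coord Δ) =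
      (z ^ k / (k.factorial : ℂ)) • (V.va.T ^ k) (V.inc p x) := by
  subst h
  rw [coord_expT_single, map_smul, V.inc_prj (pow_T_mem k p x)]

theorem prodComp_eq (p q Δ : ℤ) (x : V.wt p) (y : V.wt q) :
    V.prodComp p q Δ x y = V.prj Δ (V.mulV (V.inc p x) (V.inc q y)) := rfl

theorem coord_mul_antidiagonal {p q : ℤ} {a b : V.Completion} (ha : ∀ Δ < p, a.coord Δ = 0)
    (hb : ∀ Δ < q, b.coord Δ = 0) (k : ℕ) : (a * b).coord (p + q + k) =
      ∑ ij ∈ Finset.HasAntidiagonal.antidiagonal k, V.prj (p + q + k)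
        (V.mulV (V.inc (p + ij.1) (a.coord (p + ij.1))) (V.inc (q + ij.2) (b.coord (q + ij.2)))) := by
  rw [coord_mul, finsum_eq_sum_of_support_subset (s :=
    (Finset.HasAntidiagonal.antidiagonal k).image fun ij : ℕ × ℕ => p + (ij.1 : ℤ)),
    Finset.sum_image]
  · refine Finset.sum_congr rfl fun ij hij => ?_
    have h1 : ∀ r, r = q + (ij.2 : ℤ) → V.prodComp (p + ij.1) r (p + q + k) (a.coord (p + ij.1))
        (b.coord r) = V.prj (p + q + k) (V.mulV (V.inc (p + ij.1) (a.coord (p + ij.1)))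
          (V.inc (q + ij.2) (b.coord (q + ij.2)))) := by
      rintro r rfl; rfl
    refine h1 _ ?_
    have := Finset.HasAntidiagonal.mem_antidiagonal.1 hij
    lia
  · intro ij hij ij' hij' h
    have h1 := Finset.HasAntidiagonal.mem_antidiagonal.1 (Finset.mem_coe.1 hij)
    have h2 := Finset.HasAntidiagonal.mem_antidiagonal.1 (Finset.mem_coe.1 hij')
    ext <;> simp at h <;> lia
  · intro r hr
    have h1 : p ≤ r := by
      by_contra hlt
      exact hr (by beta_reduce; rw [ha r (by lia)]; simp)
    have h2 : r ≤ p + k := by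
      by_contra hlt
      exact hr (by beta_reduce; rw [hb _ (by lia)]; simp)
    obtain ⟨i, hi⟩ := Int.le.dest h1
    simp only [Finset.coe_image, Set.mem_image, Finset.mem_coe]
    exact ⟨(i, k - i), Finset.HasAntidiagonal.mem_antidiagonal.2 (by simp; lia), hi⟩

theorem coord_mul_lt {p q : ℤ} {a b : V.Completion} (ha : ∀ Δ < p, a.coord Δ = 0)
    (hb : ∀ Δ < q, b.coord Δ = 0) {Δ : ℤ} (h : Δ < p + q) : (a * b).coord Δ = 0 := by
  rw [coord_mul]
  refine finsum_eq_zero_of_forall_eq_zero fun r => ?_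
  by_cases hr : r < p
  · rw [ha r hr]; simp
  · rw [hb (Δ - r) (by lia)]; simp

theorem expT_single_mul (z : ℂ) (p q : ℤ) (x : V.wt p) (y : V.wt q) :
    expT z (single V p x * single V q y) = expT z (single V p x) * expT z (single V q y) := by
  have hx := fun Δ (h : Δ < p) => coord_expT_single_lt z p x h
  have hy := fun Δ (h : Δ < q) => coord_expT_single_lt z q y h
  rw [single_mul_single]
  refine eq_of_coord_add (p := p + q) (fun Δ h => coord_expT_single_lt z _ _ h)
    (fun Δ h => coord_mul_lt hx hy h) fun k => ?_
  rw [coord_mul_antidiagonal hx hy, coord_expT_single, inc_prodComp, T_pow_mulV, map_sum,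
    Finset.smul_sum]
  refine Finset.sum_congr rfl fun ij hij => ?_
  rw [inc_coord_expT_single z p x ij.1 rfl, inc_coord_expT_single z q y ij.2 rfl]
  simp only [map_smul, LinearMap.smul_apply, smul_smul, ← Nat.cast_smul_eq_nsmul ℂ]
  congr 1
  obtain ⟨i, j⟩ := ij
  obtain rfl := Finset.HasAntidiagonal.mem_antidiagonal.1 hij
  have hc : (((i + j).choose i : ℕ) : ℂ) * i.factorial * j.factorial = (i + j).factorial := by
    rw [Nat.choose_symm_add]
    exact_mod_cast Nat.add_choose_mul_factorial_mul_factorial i j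
  have h1 : ((i + j).factorial : ℂ) ≠ 0 := by exact_mod_cast Nat.factorial_ne_zero _
  have h2 : (i.factorial : ℂ) ≠ 0 := by exact_mod_cast Nat.factorial_ne_zero _
  have h3 : (j.factorial : ℂ) ≠ 0 := by exact_mod_cast Nat.factorial_ne_zero _
  change z ^ (i + j) / ((i + j).factorial : ℂ) * ((i + j).choose i : ℂ) =
    z ^ j / (j.factorial : ℂ) * (z ^ i / (i.factorial : ℂ))
  rw [div_mul_div_comm, div_mul_eq_mul_div, div_eq_div_iff h1 (mul_ne_zero h3 h2), ← hc]
  ring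

theorem expT_mul (z : ℂ) (a b : V.Completion) : expT z (a * b) = expT z a * expT z b := by
  have h1 : ∀ p x b, expT z (single V p x * b) = expT z (single V p x) * expT z b := by
    intro p x b
    have : expTLin z ∘ₗ mulHom (single V p x) = mulHom (expT z (single V p x)) ∘ₗ expTLin z :=
      linearMap_ext ((continuous_expT z).comp (continuous_mul_left' _))
        ((continuous_mul_left' _).comp (continuous_expT z)) fun q y => expT_single_mul z p q x y
    exact LinearMap.congr_fun this b
  have : expTLin z ∘ₗ mulHom.flip b = mulHom.flip (expT z b) ∘ₗ expTLin z :=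
    linearMap_ext ((continuous_expT z).comp (continuous_mul_right' _))
      ((continuous_mul_right' _).comp (continuous_expT z)) fun p x => h1 p x b
  exact LinearMap.congr_fun this a

theorem expT_one (z : ℂ) : expT z (1 : V.Completion) = 1 := by
  rw [one_eq]
  refine eq_of_coord_add (p := 0) (fun Δ h => coord_expT_single_lt z _ _ h)
    (fun Δ h => single_ne h.ne _) fun k => ?_
  rw [coord_expT_single, V.inc_prj V.va.vac_mem]
  cases k with
  | zero => rw [single_coord, V.inc_prj V.va.vac_mem]; simp
  | succ k =>
    rw [pow_succ V.va.T, Module.End.mul_apply, V.va.T_vac, single_ne (by lia)]; simp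

theorem expT_zero (a : V.Completion) : expT 0 a = a := by
  have : expTLin (V := V) 0 = LinearMap.id :=
    linearMap_ext (continuous_expT 0) continuous_id fun p x => by
      refine eq_of_coord_add (p := p) (fun Δ h => coord_expT_single_lt 0 _ _ h)
        (fun Δ h => single_ne h.ne _) fun k => ?_
      change (expT 0 (single V p x)).coord (p + k) = (single V p x).coord (p + k)
      rw [coord_expT_single, single_coord]
      cases k with
      | zero => simp
      | succ k =>
        rw [V.prj_ne (by lia : p ≠ p + ((k + 1 : ℕ) : ℤ)) ⟨x, rfl⟩]; simp
  exact LinearMap.congr_fun this a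

theorem expT_expT (z z' : ℂ) (a : V.Completion) : expT z (expT z' a) = expT (z + z') a := by
  have : expTLin z ∘ₗ expTLin z' = expTLin (V := V) (z + z') :=
    linearMap_ext ((continuous_expT z).comp (continuous_expT z')) (continuous_expT _) fun p x => by
      change expT z (expT z' (single V p x)) = expT (z + z') (single V p x)
      refine eq_of_coord_add (p := p) (fun Δ h => ?_)
        (fun Δ h => coord_expT_single_lt _ _ _ h) fun k => ?_
      · change (∑ᶠ n : ℕ, _) = _
        refine finsum_eq_zero_of_forall_eq_zero fun n => ?_
        rw [coord_expT_single_lt _ _ _ (by lia)]; simp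
      · change (∑ᶠ n : ℕ, _) = _
        rw [finsum_eq_sum_of_support_subset (s := Finset.range (k + 1)), coord_expT_single,
          add_pow, Finset.sum_div, Finset.sum_smul]
        · refine Finset.sum_congr rfl fun i hi => ?_
          have hik : i ≤ k := Nat.lt_succ_iff.1 (Finset.mem_range.1 hi)
          change _ • V.prj (p + k) ((V.va.T ^ i) (V.inc (p + k - i) _)) = _
          rw [inc_coord_expT_single z' p x (k - i) (by lia), map_smul, map_smul, smul_smul,
            ← Module.End.mul_apply, ← pow_add, Nat.add_sub_cancel' hik]
          congr 1
          have hc : ((k.choose i : ℕ) : ℂ) * i.factorial * (k - i).factorial = k.factorial := by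
            exact_mod_cast Nat.choose_mul_factorial_mul_factorial hik
          have h1 : (k.factorial : ℂ) ≠ 0 := by exact_mod_cast Nat.factorial_ne_zero _
          have h2 : (i.factorial : ℂ) ≠ 0 := by exact_mod_cast Nat.factorial_ne_zero _
          have h3 : ((k - i).factorial : ℂ) ≠ 0 := by exact_mod_cast Nat.factorial_ne_zero _
          rw [div_mul_div_comm, div_eq_div_iff (mul_ne_zero h2 h3) h1, ← hc]
          ring
        · intro i hi
          simp only [Finset.coe_range, Set.mem_Iio]
          by_contra hlt
          exact hi (by beta_reduce; rw [coord_expT_single_lt _ _ _ (by lia)]; simp)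
  exact LinearMap.congr_fun this a

/-- The operator `q ^ L_0` on the completion, acting on `V_Δ` as `q ^ Δ`. -/
noncomputable def rot (q : Circle) (a : V.Completion) : V.Completion :=
  mk fun Δ => ((q : ℂ) ^ Δ) • a.coord Δ

theorem coord_rot (q : Circle) (a : V.Completion) (Δ : ℤ) :
    (rot q a).coord Δ = ((q : ℂ) ^ Δ) • a.coord Δ := rfl

theorem continuous_rot (q : Circle) : Continuous (rot (V := V) q) :=
  continuous_of_coord fun Δ => (continuous_coord Δ).const_smul ((q : ℂ) ^ Δ)

theorem rot_mul (q : Circle) (a b : V.Completion) : rot q (a * b) = rot q a * rot q b := by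
  obtain ⟨N, hN⟩ := V.bdd
  refine ext fun Δ => ?_
  rw [coord_rot, coord_mul_sum hN, coord_mul_sum hN, Finset.smul_sum]
  refine Finset.sum_congr rfl fun p _ => ?_
  rw [coord_rot, coord_rot, map_smul, map_smul, LinearMap.smul_apply, smul_smul,
    ← zpow_add₀ q.coe_ne_zero]
  congr 2
  ring

theorem rot_one (q : Circle) : rot q (1 : V.Completion) = 1 := by
  refine ext fun Δ => ?_
  rw [coord_rot, one_eq]
  by_cases h : Δ = 0
  · subst h; simp
  · rw [single_ne h]; simp

theorem rot_rot (q q' : Circle) (a : V.Completion) : rot q (rot q' a) = rot (q * q') a := by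
  refine ext fun Δ => ?_
  simp [coord_rot, smul_smul, mul_zpow]

theorem one_rot (a : V.Completion) : rot 1 a = a := by
  refine ext fun Δ => ?_
  simp [coord_rot]

theorem rot_expT (q : Circle) (z : ℂ) (a : V.Completion) :
    rot q (expT z a) = expT (q * z) (rot q a) := by
  obtain ⟨N, hN⟩ := V.bdd
  refine ext fun Δ => ?_
  rw [coord_rot, coord_expT_sum hN, coord_expT_sum hN, Finset.smul_sum]
  refine Finset.sum_congr rfl fun n _ => ?_
  rw [coord_rot, map_smul, smul_smul, smul_smul]
  congr 1
  rw [mul_pow, zpow_sub₀ q.coe_ne_zero, zpow_natCast]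
  have := pow_ne_zero n q.coe_ne_zero
  field_simp

/-- The algebra automorphism `e ^ (zT) q ^ L_0` of the completion. -/
noncomputable def action (q : Circle) (z : ℂ) : V.Completion →ₐ[ℂ] V.Completion :=
  AlgHom.ofLinearMap
    { toFun := fun a => expT z (rot q a)
      map_add' := fun a b => by
        have : rot q (a + b) = rot q a + rot q b := ext fun Δ => smul_add _ _ _
        rw [this]; exact (expTLin z).map_add _ _
      map_smul' := fun c a => by
        have : rot q (c • a) = c • rot q a := ext fun Δ => smul_comm _ _ _
        rw [this]; exact (expTLin z).map_smul _ _ }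
    (by change expT z (rot q 1) = 1; rw [rot_one, expT_one])
    (fun a b => by
      change expT z (rot q (a * b)) = expT z (rot q a) * expT z (rot q b)
      rw [rot_mul, expT_mul])

theorem action_apply (q : Circle) (z : ℂ) (a : V.Completion) :
    action q z a = expT z (rot q a) := rfl

theorem continuous_action (q : Circle) (z : ℂ) : Continuous (action (V := V) q z) :=
  (continuous_expT z).comp (continuous_rot q)

theorem action_one : action (V := V) 1 0 = AlgHom.id ℂ _ := by
  ext a
  rw [action_apply, one_rot, expT_zero]; rfl

theorem action_mul (q q' : Circle) (z z' : ℂ) :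
    action (V := V) (q * q') (z + q * z') = (action q z).comp (action q' z') := by
  ext a
  rw [AlgHom.comp_apply, action_apply, action_apply, action_apply, rot_expT, expT_expT, rot_rot]

section Bar

variable {W : GrComVA.{u}}

/-- The componentwise map between completions induced by a graded linear map. -/
noncomputable def barLin (f : (⨁ Δ, V.wt Δ) →ₗ[ℂ] ⨁ Δ, W.wt Δ) :
    V.Completion →ₗ[ℂ] W.Completion where
  toFun a := mk fun Δ => W.prj Δ (f (V.inc Δ (a.coord Δ)))
  map_add' a b := ext fun Δ => by simp only [coord_mk, coord_add, map_add]
  map_smul' c a := ext fun Δ => by simp only [coord_mk, coord_smul, map_smul, RingHom.id_apply]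

theorem coord_barLin (f : (⨁ Δ, V.wt Δ) →ₗ[ℂ] ⨁ Δ, W.wt Δ) (a : V.Completion) (Δ : ℤ) :
    (barLin f a).coord Δ = W.prj Δ (f (V.inc Δ (a.coord Δ))) := rfl

theorem continuous_barLin (f : (⨁ Δ, V.wt Δ) →ₗ[ℂ] ⨁ Δ, W.wt Δ) : Continuous (barLin f) :=
  continuous_of_coord fun Δ =>
    (IsModuleTopology.continuous_of_linearMap (R := ℂ) (W.prj Δ ∘ₗ f ∘ₗ V.inc Δ)).comp
      (continuous_coord Δ)

theorem inc_prj_map {f : (⨁ Δ, V.wt Δ) →ₗ[ℂ] ⨁ Δ, W.wt Δ}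
    (hf : GradedVertexAlgebra.IsHom V.va W.va f) (p : ℤ) (x : V.wt p) :
    W.inc p (W.prj p (f (V.inc p x))) = f (V.inc p x) :=
  W.inc_prj (hf.map_weight p x)

theorem barLin_single (f : (⨁ Δ, V.wt Δ) →ₗ[ℂ] ⨁ Δ, W.wt Δ) (p : ℤ) (x : V.wt p) :
    barLin f (single V p x) = single W p (W.prj p (f (V.inc p x))) := by
  refine ext fun Δ => ?_
  rw [coord_barLin]
  by_cases h : Δ = p
  · subst h; rw [single_same, single_same]
  · rw [single_ne h, single_ne h]; simp

theorem barLin_mul {f : (⨁ Δ, V.wt Δ) →ₗ[ℂ] ⨁ Δ, W.wt Δ}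
    (hf : GradedVertexAlgebra.IsHom V.va W.va f) (a b : V.Completion) :
    barLin f (a * b) = barLin f a * barLin f b := by
  have h0 : ∀ p q x y, barLin f (single V p x * single V q y) =
      barLin f (single V p x) * barLin f (single V q y) := by
    intro p q x y
    rw [single_mul_single, barLin_single, barLin_single, barLin_single, single_mul_single]
    refine single_eq_of_inc_eq ?_
    rw [inc_prj_map hf, inc_prodComp, inc_prodComp, inc_prj_map hf, inc_prj_map hf]
    exact hf.map_nprod _ _ _
  have h1 : ∀ p x b, barLin f (single V p x * b) = barLin f (single V p x) * barLin f b := by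
    intro p x b
    have : barLin f ∘ₗ mulHom (single V p x) = mulHom (barLin f (single V p x)) ∘ₗ barLin f :=
      linearMap_ext ((continuous_barLin f).comp (continuous_mul_left' _))
        ((continuous_mul_left' _).comp (continuous_barLin f)) fun q y => h0 p q x y
    exact LinearMap.congr_fun this b
  have : barLin f ∘ₗ mulHom.flip b = mulHom.flip (barLin f b) ∘ₗ barLin f :=
    linearMap_ext ((continuous_barLin f).comp (continuous_mul_right' _))
      ((continuous_mul_right' _).comp (continuous_barLin f)) fun p x => h1 p x b
  exact LinearMap.congr_fun this a

theorem barLin_one {f : (⨁ Δ, V.wt Δ) →ₗ[ℂ] ⨁ Δ, W.wt Δ}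
    (hf : GradedVertexAlgebra.IsHom V.va W.va f) : barLin f 1 = 1 := by
  rw [one_eq, one_eq, barLin_single]
  refine single_eq_of_inc_eq ?_
  rw [inc_prj_map hf, V.inc_prj V.va.vac_mem, W.inc_prj W.va.vac_mem]
  exact hf.map_vac

/-- The morphism of algebras between completions induced by a morphism of graded vertex algebras. -/
noncomputable def bar {f : (⨁ Δ, V.wt Δ) →ₗ[ℂ] ⨁ Δ, W.wt Δ}
    (hf : GradedVertexAlgebra.IsHom V.va W.va f) : V.Completion →ₐ[ℂ] W.Completion :=
  AlgHom.ofLinearMap (barLin f) (barLin_one hf) (barLin_mul hf)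

theorem continuous_bar {f : (⨁ Δ, V.wt Δ) →ₗ[ℂ] ⨁ Δ, W.wt Δ}
    (hf : GradedVertexAlgebra.IsHom V.va W.va f) : Continuous (bar hf) := continuous_barLin f

theorem map_pow_T {f : (⨁ Δ, V.wt Δ) →ₗ[ℂ] ⨁ Δ, W.wt Δ}
    (hf : GradedVertexAlgebra.IsHom V.va W.va f) (n : ℕ) (a) :
    f ((V.va.T ^ n) a) = (W.va.T ^ n) (f a) := by
  induction n with
  | zero => simp
  | succ n ih =>
    rw [pow_succ', pow_succ', Module.End.mul_apply, Module.End.mul_apply, hf.map_T, ih]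

theorem inc_powT (n : ℕ) (p Δ : ℤ) (h : p = Δ - n) (x : V.wt p) :
    V.inc Δ (powT n p Δ x) = (V.va.T ^ n) (V.inc p x) := by
  obtain rfl : Δ = p + n := by lia
  exact V.inc_prj (pow_T_mem n p x)

theorem bar_action {f : (⨁ Δ, V.wt Δ) →ₗ[ℂ] ⨁ Δ, W.wt Δ}
    (hf : GradedVertexAlgebra.IsHom V.va W.va f) (q : Circle) (z : ℂ) :
    (bar hf).comp (action q z) = (action q z).comp (bar hf) := by
  obtain ⟨N, hN⟩ := V.bdd
  obtain ⟨N', hN'⟩ := W.bdd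
  ext a
  change barLin f (expT z (rot q a)) = expT z (rot q (barLin f a))
  have h1 : barLin f (rot q a) = rot q (barLin f a) := ext fun Δ => by
    rw [coord_barLin, coord_rot, coord_rot, coord_barLin]; simp only [map_smul]
  rw [← h1]
  generalize rot q a = b
  refine ext fun Δ => ?_
  have hM : ∀ Δ < min N N', Subsingleton (V.wt Δ) := fun Δ h => hN Δ (by lia)
  have hM' : ∀ Δ < min N N', Subsingleton (W.wt Δ) := fun Δ h => hN' Δ (by lia)
  rw [coord_barLin, coord_expT_sum hM, coord_expT_sum hM', map_sum, map_sum, map_sum]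
  refine Finset.sum_congr rfl fun n _ => ?_
  rw [map_smul, map_smul, map_smul, inc_powT n _ Δ rfl, map_pow_T hf]
  change _ = _ • W.prj Δ ((W.va.T ^ n) (W.inc _ _))
  rw [coord_barLin, inc_prj_map hf]

end Bar

end Completion

end GrComVA

/-- The group `S¹ ⋉ ℂ` of rotations and translations of the plane. -/
@[ext] structure RotTrans where
  /-- the rotation -/
  rot : Circle
  /-- the translation -/
  trans : ℂ

namespace RotTrans

noncomputable instance : One RotTrans := ⟨⟨1, 0⟩⟩

noncomputable instance : Mul RotTrans := ⟨fun g h => ⟨g.rot * h.rot, g.trans + g.rot * h.trans⟩⟩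

noncomputable instance : Inv RotTrans := ⟨fun g => ⟨g.rot⁻¹, -((g.rot⁻¹ : Circle) * g.trans)⟩⟩

noncomputable instance : Group RotTrans :=
  Group.ofLeftAxioms
    (fun a b c => RotTrans.ext (mul_assoc a.rot b.rot c.rot) (by
      change a.trans + a.rot * b.trans + ((a.rot * b.rot : Circle) : ℂ) * c.trans =
        a.trans + a.rot * (b.trans + b.rot * c.trans)
      rw [Circle.coe_mul]; ring))
    (fun a => RotTrans.ext (one_mul a.rot) (by
      change 0 + ((1 : Circle) : ℂ) * a.trans = a.trans
      simp))
    (fun a => RotTrans.ext (inv_mul_cancel a.rot) (by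
      change -((a.rot⁻¹ : Circle) * a.trans) + ((a.rot⁻¹ : Circle) : ℂ) * a.trans = 0
      ring))

/-- The action on the plane: `(q, z) • w = q w + z`. -/
noncomputable instance : MulAction RotTrans ℂ where
  smul g w := g.rot * w + g.trans
  one_smul w := by
    change ((1 : Circle) : ℂ) * w + 0 = w
    simp
  mul_smul g h w := by
    change ((g.rot * h.rot : Circle) : ℂ) * w + (g.trans + g.rot * h.trans) =
      g.rot * (h.rot * w + h.trans) + g.trans
    rw [Circle.coe_mul]; ring

theorem smul_def (g : RotTrans) (w : ℂ) : g • w = g.rot * w + g.trans := rfl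

theorem mul_rot (g h : RotTrans) : (g * h).rot = g.rot * h.rot := rfl

theorem mul_trans (g h : RotTrans) : (g * h).trans = g.trans + g.rot * h.trans := rfl

instance : ContinuousConstSMul RotTrans ℂ where
  continuous_const_smul g := by
    change Continuous fun w : ℂ => g.rot * w + g.trans
    fun_prop

/-- The rotation by `q`. -/
def ofRot (q : Circle) : RotTrans := ⟨q, 0⟩

/-- The translation by `z`. -/
noncomputable def ofTrans (z : ℂ) : RotTrans := ⟨1, z⟩

/-- The image `g • U` of an open set. -/
noncomputable instance : MulAction RotTrans (Opens ℂ) where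
  smul g U := ⟨g • (U : Set ℂ), U.2.smul g⟩
  one_smul U := Opens.ext (one_smul RotTrans (U : Set ℂ))
  mul_smul g h U := Opens.ext (mul_smul g h (U : Set ℂ))

theorem coe_smul (g : RotTrans) (U : Opens ℂ) : ((g • U : Opens ℂ) : Set ℂ) = g • (U : Set ℂ) := rfl

theorem smul_mono (g : RotTrans) {U V : Opens ℂ} (h : U ≤ V) : g • U ≤ g • V :=
  Set.smul_set_mono (a := g) (show (U : Set ℂ) ⊆ V from h)

theorem smul_disjoint (g : RotTrans) {U V : Opens ℂ} (h : Disjoint U V) :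
    Disjoint (g • U) (g • V) := by
  rw [← Opens.coe_disjoint] at h ⊢
  exact Set.disjoint_smul_set.2 h

end RotTrans

/-- The open disc `D_R(z)`. -/
noncomputable def disc (z : ℂ) (R : ℝ) : Opens ℂ := ⟨Metric.ball z R, Metric.isOpen_ball⟩

theorem rotTrans_smul_ball (g : RotTrans) (z : ℂ) (R : ℝ) :
    g • Metric.ball z R = Metric.ball (g • z) R := by
  ext w
  rw [Set.mem_smul_set_iff_inv_smul_mem, Metric.mem_ball, Metric.mem_ball]
  have h : dist (g • (g⁻¹ • w)) (g • z) = dist (g⁻¹ • w) z := by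
    simp only [RotTrans.smul_def, dist_eq_norm]
    rw [add_sub_add_right_eq_sub, ← mul_sub, norm_mul, Circle.norm_coe, one_mul]
  rw [← h, smul_inv_smul]

theorem rotTrans_smul_disc (g : RotTrans) (z : ℂ) (R : ℝ) : g • disc z R = disc (g • z) R :=
  Opens.ext (rotTrans_smul_ball g z R)

theorem disc_mono (z : ℂ) {r R : ℝ} (h : r ≤ R) : disc z r ≤ disc z R :=
  Metric.ball_subset_ball h

theorem rot_disc_le (q : Circle) (R : ℝ) : RotTrans.ofRot q • disc 0 R ≤ disc 0 R := by
  rw [rotTrans_smul_disc]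
  have : RotTrans.ofRot q • (0 : ℂ) = 0 := by simp [RotTrans.smul_def, RotTrans.ofRot]
  rw [this]

theorem trans_disc_le (z : ℂ) (R : ℝ) : RotTrans.ofTrans z • disc 0 R ≤ disc z R := by
  rw [rotTrans_smul_disc]
  have : RotTrans.ofTrans z • (0 : ℂ) = z := by simp [RotTrans.smul_def, RotTrans.ofTrans]
  rw [this]

/-- An `S¹ ⋉ ℂ`-equivariant prefactorization algebra on the plane with values in the symmetric
monoidal category of complex locally convex spaces and continuous linear maps. Morphisms out of
`X ⊗ Y` are separately continuous bilinear maps, i.e. `⊗` is the inductive tensor product. -/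
structure EquivariantPFA where
  /-- the value on an open set -/
  obj : Opens ℂ → Type u
  [addCommGroup : ∀ U, AddCommGroup (obj U)]
  [module : ∀ U, Module ℂ (obj U)]
  [topologicalSpace : ∀ U, TopologicalSpace (obj U)]
  [isTopologicalAddGroup : ∀ U, IsTopologicalAddGroup (obj U)]
  [continuousSMul : ∀ U, ContinuousSMul ℂ (obj U)]
  [locallyConvexSpace : ∀ U, LocallyConvexSpace ℝ (obj U)]
  /-- the extension maps of the precosheaf -/
  map {U V : Opens ℂ} (h : U ≤ V) : obj U →L[ℂ] obj V
  map_id (U : Opens ℂ) (x : obj U) : map (le_refl U) x = x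
  map_map {U V W : Opens ℂ} (h : U ≤ V) (h' : V ≤ W) (x : obj U) :
    map h' (map h x) = map (h.trans h') x
  /-- the multiplication -/
  mul {U V W : Opens ℂ} (d : Disjoint U V) (hU : U ≤ W) (hV : V ≤ W) :
    obj U →ₗ[ℂ] obj V →ₗ[ℂ] obj W
  continuous_mul_left {U V W : Opens ℂ} (d : Disjoint U V) (hU : U ≤ W) (hV : V ≤ W) (x : obj U) :
    Continuous fun y => mul d hU hV x y
  continuous_mul_right {U V W : Opens ℂ} (d : Disjoint U V) (hU : U ≤ W) (hV : V ≤ W) (y : obj V) :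
    Continuous fun x => mul d hU hV x y
  map_mul {U V W W' : Opens ℂ} (d : Disjoint U V) (hU : U ≤ W) (hV : V ≤ W) (hW : W ≤ W')
    (x : obj U) (y : obj V) :
    map hW (mul d hU hV x y) = mul d (hU.trans hW) (hV.trans hW) x y
  mul_map {U V U' V' W : Opens ℂ} (hU : U ≤ U') (hV : V ≤ V') (d : Disjoint U' V') (hU' : U' ≤ W)
    (hV' : V' ≤ W) (x : obj U) (y : obj V) :
    mul d hU' hV' (map hU x) (map hV y) =
      mul (d.mono hU hV) (hU.trans hU') (hV.trans hV') x y
  mul_comm {U V W : Opens ℂ} (d : Disjoint U V) (hU : U ≤ W) (hV : V ≤ W) (x : obj U) (y : obj V) :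
    mul d hU hV x y = mul d.symm hV hU y x
  mul_assoc {U₁ U₂ U₃ V₁ V₂ W : Opens ℂ} (d₁₂ : Disjoint U₁ U₂) (d₂₃ : Disjoint U₂ U₃)
    (d₁ : Disjoint U₁ V₂) (d₃ : Disjoint V₁ U₃) (h₁ : U₁ ≤ V₁) (h₂ : U₂ ≤ V₁) (h₂' : U₂ ≤ V₂)
    (h₃ : U₃ ≤ V₂) (k₁ : U₁ ≤ W) (k₂ : V₂ ≤ W) (k₃ : U₃ ≤ W) (k₁₂ : V₁ ≤ W)
    (x : obj U₁) (y : obj U₂) (z : obj U₃) :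
    mul d₃ k₁₂ k₃ (mul d₁₂ h₁ h₂ x y) z = mul d₁ k₁ k₂ x (mul d₂₃ h₂' h₃ y z)
  /-- the unit -/
  one : obj ⊥
  one_mul (U : Opens ℂ) (x : obj U) : mul disjoint_bot_left bot_le le_rfl one x = x
  /-- the equivariant structure -/
  act (g : RotTrans) (U : Opens ℂ) : obj U →L[ℂ] obj (g • U)
  act_map (g : RotTrans) {U V : Opens ℂ} (h : U ≤ V) (x : obj U) :
    act g V (map h x) = map (g.smul_mono h) (act g U x)
  /-- `σ_(gh) = σ_g σ_h`; the map on the left-hand side is along the equality `(gh)U = g(hU)` -/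
  act_mul (g h : RotTrans) (U : Opens ℂ) (x : obj U) :
    map (mul_smul g h U).le (act (g * h) U x) = act g (h • U) (act h U x)
  /-- `σ_1 = id`; the map on the left-hand side is along the equality `1U = U` -/
  act_one (U : Opens ℂ) (x : obj U) : map (one_smul RotTrans U).le (act 1 U x) = x
  act_mul_apply (g : RotTrans) {U V W : Opens ℂ} (d : Disjoint U V) (hU : U ≤ W) (hV : V ≤ W)
    (x : obj U) (y : obj V) : act g W (mul d hU hV x y) =
      mul (g.smul_disjoint d) (g.smul_mono hU) (g.smul_mono hV) (act g U x) (act g V y)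
  /-- the map on the right-hand side is along the equality `∅ = g∅` -/
  act_unit (g : RotTrans) : act g ⊥ one = map bot_le one

attribute [instance] EquivariantPFA.addCommGroup EquivariantPFA.module
  EquivariantPFA.topologicalSpace EquivariantPFA.isTopologicalAddGroup
  EquivariantPFA.continuousSMul EquivariantPFA.locallyConvexSpace

namespace EquivariantPFA

/-- Morphisms of equivariant prefactorization algebras. -/
structure Hom (F G : EquivariantPFA.{u}) where
  /-- the components -/
  app (U : Opens ℂ) : F.obj U →L[ℂ] G.obj U
  app_map {U V : Opens ℂ} (h : U ≤ V) (x : F.obj U) : app V (F.map h x) = G.map h (app U x)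
  app_mul {U V W : Opens ℂ} (d : Disjoint U V) (hU : U ≤ W) (hV : V ≤ W)
    (x : F.obj U) (y : F.obj V) : app W (F.mul d hU hV x y) = G.mul d hU hV (app U x) (app V y)
  app_one : app ⊥ F.one = G.one
  app_act (g : RotTrans) (U : Opens ℂ) (x : F.obj U) :
    app (g • U) (F.act g U x) = G.act g U (app U x)

variable (F : EquivariantPFA.{u})

/-- The multiplication `F(U_1) × ⋯ × F(U_n) → F(W)`, defined inductively as the composition of
`F(U_1) × ⋯ × F(U_(n-1)) → F(U_1 ⊔ ⋯ ⊔ U_(n-1))` with the binary multiplication. -/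
noncomputable def multi : (n : ℕ) → (U : Fin n → Opens ℂ) → (W : Opens ℂ) →
    (∀ i j, i ≠ j → Disjoint (U i) (U j)) → (∀ i, U i ≤ W) → (∀ i, F.obj (U i)) → F.obj W
  | 0, _, _, _, _, _ => F.map bot_le F.one
  | n + 1, U, _, d, h, x =>
    F.mul (U := ⨆ i : Fin n, U i.castSucc)
      (iSup_disjoint_iff.2 fun i => d _ _ (Fin.castSucc_lt_last i).ne)
      (iSup_le fun i => h i.castSucc) (h (Fin.last n))
      (multi n (fun i => U i.castSucc) _
        (fun _ _ hij => d _ _ fun e => hij (Fin.castSucc_injective n e))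
        (fun i => le_iSup (fun i : Fin n => U i.castSucc) i) fun i => x i.castSucc)
      (x (Fin.last n))

/-- The costalk at `0`: families `(a_R)` with `a_R ∈ F(D_R(0))` compatible with the extension
maps. -/
def costalk : Submodule ℂ (∀ R : Set.Ioi (0 : ℝ), F.obj (disc 0 R)) where
  carrier := {a | ∀ (r R : Set.Ioi (0 : ℝ)) (h : r ≤ R), F.map (disc_mono 0 h) (a r) = a R}
  zero_mem' := fun _ _ _ => map_zero _
  add_mem' := fun ha hb r R h => (map_add _ _ _).trans (congrArg₂ (· + ·) (ha r R h) (hb r R h))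
  smul_mem' := fun c _ ha r R h => (map_smul _ _ _).trans (congrArg (c • ·) (ha r R h))

/-- The action of a rotation on `F(D_R(0))`. -/
noncomputable def rotate (q : Circle) (R : ℝ) : F.obj (disc 0 R) →L[ℂ] F.obj (disc 0 R) :=
  (F.map (rot_disc_le q R)).comp (F.act (RotTrans.ofRot q) (disc 0 R))

/-- The weight space `F(D_R(0))_Δ`. -/
def weightSpace (R : ℝ) (Δ : ℤ) : Submodule ℂ (F.obj (disc 0 R)) where
  carrier := {a | ∀ q : Circle, F.rotate q R a = ((q : ℂ) ^ Δ) • a}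
  zero_mem' := fun q => by rw [map_zero, smul_zero]
  add_mem' := fun ha hb q => by rw [map_add, ha q, hb q, smul_add]
  smul_mem' := fun c _ ha q => by rw [map_smul, ha q, smul_comm]

/-- The weight space of the costalk at `0`. -/
def costalkWeight (Δ : ℤ) : Submodule ℂ F.costalk where
  carrier := {a | ∀ R : Set.Ioi (0 : ℝ), a.1 R ∈ F.weightSpace R Δ}
  zero_mem' := fun _ => zero_mem _
  add_mem' := fun ha hb R => add_mem (ha R) (hb R)
  smul_mem' := fun c _ ha R => Submodule.smul_mem _ c (ha R)

/-- The underlying vector space of `V(F)`. -/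
abbrev StateSpace : Type u := ⨁ Δ, F.costalkWeight Δ

/-- The map from the direct sum of the weight spaces to the costalk. -/
noncomputable def toCostalk : F.StateSpace →ₗ[ℂ] F.costalk :=
  DirectSum.toModule ℂ ℤ F.costalk fun Δ => (F.costalkWeight Δ).subtype

/-- The map from the state space to `F(D_R(0))`. -/
noncomputable def ev (R : Set.Ioi (0 : ℝ)) : F.StateSpace →ₗ[ℂ] F.obj (disc 0 R) :=
  LinearMap.proj R ∘ₗ F.costalk.subtype ∘ₗ F.toCostalk

/-- The element `σ_(1,z) a_r` of `F(D_r(z))`. -/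
noncomputable def translate (z : ℂ) (r : Set.Ioi (0 : ℝ)) (a : F.costalk) : F.obj (disc z r) :=
  F.map (trans_disc_le z r) (F.act (RotTrans.ofTrans z) (disc 0 r) (a.1 r))

/-- The positive reals `r` such that the discs `D_r(z_i)` are disjoint and contained in
`D_R(0)`. -/
def Admissible {l : ℕ} (R : ℝ) (z : Fin l → ℂ) (r : Set.Ioi (0 : ℝ)) : Prop :=
  (∀ i j, i ≠ j → Disjoint (disc (z i) r) (disc (z j) r)) ∧ ∀ i, disc (z i) r ≤ disc 0 R

/-- The element `F^(D_r(z_1), …, D_r(z_l))_(D_R(0)) (σ_(1,z_1) a_1 ⊗ ⋯ ⊗ σ_(1,z_l) a_l)`. -/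
noncomputable def muWith {l : ℕ} (R : ℝ) (z : Fin l → ℂ) (r : Set.Ioi (0 : ℝ))
    (h : Admissible R z r) (a : Fin l → F.costalk) : F.obj (disc 0 R) :=
  F.multi l (fun i => disc (z i) r) (disc 0 R) h.1 h.2 fun i => F.translate (z i) r (a i)

open Classical in
/-- The element `μ^R_(z_1, …, z_l)(a_1 ⊗ ⋯ ⊗ a_l)` of `F(D_R(0))`, for pairwise distinct points
`z_1, …, z_l` of `D_R(0)` (and `0` for other `z`). It does not depend on the choice of the radius,
see `mu_eq`. -/
noncomputable def mu {l : ℕ} (R : ℝ) (z : Fin l → ℂ) (a : Fin l → F.costalk) : F.obj (disc 0 R) :=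
  if h : ∃ r, Admissible R z r then F.muWith R z h.choose h.choose_spec a else 0

theorem multi_map (n : ℕ) (U U' : Fin n → Opens ℂ) (W W' : Opens ℂ)
    (d' : ∀ i j, i ≠ j → Disjoint (U' i) (U' j)) (h' : ∀ i, U' i ≤ W') (hU : ∀ i, U i ≤ U' i)
    (h : ∀ i, U i ≤ W) (hW : W ≤ W') (x : ∀ i, F.obj (U i)) :
    F.multi n U' W' d' h' (fun i => F.map (hU i) (x i)) =
      F.map hW (F.multi n U W (fun _ _ hij => (d' _ _ hij).mono (hU _) (hU _)) h x) := by
  induction n generalizing W W' with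
  | zero => exact (F.map_map _ _ _).symm
  | succ n ih =>
    simp only [multi]
    rw [F.map_mul, ih (fun i => U i.castSucc) (fun i => U' i.castSucc)
      (⨆ i : Fin n, U i.castSucc) (⨆ i : Fin n, U' i.castSucc) _ _ (fun i => hU i.castSucc)
      (fun i => le_iSup (fun i : Fin n => U i.castSucc) i)
      (iSup_mono fun i => hU i.castSucc), F.mul_map]

theorem translate_map (z : ℂ) {r r' : Set.Ioi (0 : ℝ)} (h : r ≤ r') (a : F.costalk) :
    F.map (disc_mono z h) (F.translate z r a) = F.translate z r' a := by
  rw [translate, translate, ← a.2 r r' h, F.act_map, F.map_map, F.map_map]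

theorem muWith_eq {l : ℕ} (R : ℝ) (z : Fin l → ℂ) {r r' : Set.Ioi (0 : ℝ)} (hr : r ≤ r')
    (h : Admissible R z r) (h' : Admissible R z r') (a : Fin l → F.costalk) :
    F.muWith R z r h a = F.muWith R z r' h' a := by
  have := F.multi_map l (fun i => disc (z i) r) (fun i => disc (z i) r') (disc 0 R) (disc 0 R)
    h'.1 h'.2 (fun i => disc_mono (z i) hr) h.2 le_rfl fun i => F.translate (z i) r (a i)
  rw [F.map_id] at this
  rw [muWith, muWith, ← this]
  congr 1
  funext i
  rw [F.translate_map (z i) hr]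

theorem mu_eq {l : ℕ} (R : ℝ) (z : Fin l → ℂ) (r : Set.Ioi (0 : ℝ))
    (h : Admissible R z r) (a : Fin l → F.costalk) : F.mu R z a = F.muWith R z r h a := by
  have hex : ∃ r, Admissible R z r := ⟨r, h⟩
  rw [mu, dif_pos hex]
  rcases le_total r hex.choose with hr | hr
  · exact (F.muWith_eq R z hr _ _ a).symm
  · exact F.muWith_eq R z hr _ _ a

/-- The configuration space of `l` distinct points in `D_R(0)`. -/
def conf (l : ℕ) (R : ℝ) : Set (Fin l → ℂ) :=
  {z | Function.Injective z ∧ ∀ i, z i ∈ Metric.ball (0 : ℂ) R}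

end EquivariantPFA

/-- Holomorphy of a function on an open set `U ⊆ ℂ ^ l` with values in a complex topological vector
space: at each `a ∈ U` there is `ξ` such that
`(f(z) - f(a) - ∑ i, (z_i - a_i) ξ_i) / |z - a|` tends to `0` as `z → a`. -/
def IsHolomorphicOn {l : ℕ} {E : Type*} [AddCommGroup E] [Module ℂ E] [TopologicalSpace E]
    (f : (Fin l → ℂ) → E) (U : Set (Fin l → ℂ)) : Prop :=
  ∀ a ∈ U, ∃ ξ : Fin l → E, Filter.Tendsto
    (fun z => (((‖z - a‖⁻¹ : ℝ)) : ℂ) • (f z - f a - ∑ i, (z i - a i) • ξ i))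
    (𝓝[U \ {a}] a) (𝓝 0)

namespace EquivariantPFA

variable (F : EquivariantPFA.{u})

/-- Holomorphic prefactorization algebras. -/
structure IsHolomorphic : Prop where
  bijOn : ∀ (r R : ℝ) (_ : 0 < r) (h : r < R) (Δ : ℤ),
    Set.BijOn (F.map (disc_mono 0 h.le)) (F.weightSpace r Δ) (F.weightSpace R Δ)
  bdd : ∀ R : ℝ, 0 < R → ∃ N : ℤ, ∀ Δ < N, F.weightSpace R Δ = ⊥
  t2 : ∀ R : ℝ, 0 < R → T2Space (F.obj (disc 0 R))
  quasiComplete : ∀ R : ℝ, 0 < R →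
    letI : UniformSpace (F.obj (disc 0 R)) := IsTopologicalAddGroup.rightUniformSpace _
    QuasiCompleteSpace ℂ (F.obj (disc 0 R))
  holomorphic : ∀ (R : ℝ) (_ : 0 < R) (l : ℕ) (Δ : Fin l → ℤ) (a : ∀ i, F.costalkWeight (Δ i)),
    IsHolomorphicOn (fun z => F.mu R z fun i => (a i : F.costalk)) (conf l R)

/-- The vertex algebra `V(F)` attached to `F`, as a property of a `ℤ`-graded vertex algebra `S` on
`⨁ Δ, F⁰_Δ`: the vacuum is the image of the unit, `T a = ∂_z μ_z(a)` at `z = 0`, and `Y(a, z) b` is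
the Laurent expansion of `μ_(z,0)(a ⊗ b)`. -/
structure IsVertexAlgebra (S : GradedVertexAlgebra fun Δ => F.costalkWeight Δ) : Prop where
  vac_eq : ∀ R : Set.Ioi (0 : ℝ), F.ev R S.vac = F.map bot_le F.one
  hasDeriv : ∀ (R : Set.Ioi (0 : ℝ)) (a : F.StateSpace), Filter.Tendsto
    (fun z : ℂ => z⁻¹ • (F.mu R ![z] ![F.toCostalk a] - F.mu R ![0] ![F.toCostalk a]))
    (𝓝[≠] 0) (𝓝 (F.ev R (S.T a)))
  hasSum : ∀ (R : Set.Ioi (0 : ℝ)) (a b : F.StateSpace) (z : ℂ), z ≠ 0 → ‖z‖ < R →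
    HasSum (fun n : ℤ => z ^ (-n - 1) • F.ev R (S.nprod n a b))
      (F.mu R ![z, 0] ![F.toCostalk a, F.toCostalk b])

variable {F} {G : EquivariantPFA.{u}}

theorem Hom.app_rotate (φ : Hom F G) (q : Circle) (R : ℝ) (x : F.obj (disc 0 R)) :
    φ.app _ (F.rotate q R x) = G.rotate q R (φ.app _ x) := by
  simp only [rotate, ContinuousLinearMap.comp_apply, φ.app_map, φ.app_act]

/-- The map between costalks induced by a morphism. -/
noncomputable def Hom.costalkMap (φ : Hom F G) : F.costalk →ₗ[ℂ] G.costalk where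
  toFun a := ⟨fun R => φ.app _ (a.1 R), fun r R h => by
    rw [← φ.app_map]; exact congrArg _ (a.2 r R h)⟩
  map_add' a b := Subtype.ext (funext fun R => map_add _ _ _)
  map_smul' c a := Subtype.ext (funext fun R => map_smul _ _ _)

/-- The map between weight spaces induced by a morphism. -/
noncomputable def Hom.weightMap (φ : Hom F G) (Δ : ℤ) : F.costalkWeight Δ →ₗ[ℂ] G.costalkWeight Δ :=
  φ.costalkMap.restrict fun a ha R q => by
    change G.rotate q R (φ.app _ (a.1 R)) = _ • φ.app _ (a.1 R)
    rw [← φ.app_rotate, ha R q, map_smul]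

/-- The map `V(F) → V(G)` induced by a morphism. -/
noncomputable def Hom.stateMap (φ : Hom F G) : F.StateSpace →ₗ[ℂ] G.StateSpace :=
  DirectSum.toModule ℂ ℤ _ fun Δ =>
    DirectSum.lof ℂ ℤ (fun Δ => G.costalkWeight Δ) Δ ∘ₗ φ.weightMap Δ

end EquivariantPFA

/-- The finest locally convex vector space topology on `E` for which the given maps to `E` are
continuous. -/
abbrev lcFinal {E : Type*} [AddCommGroup E] [Module ℂ E] {ι : Type*} {X : ι → Type*}
    [∀ i, TopologicalSpace (X i)] (f : ∀ i, X i → E) : TopologicalSpace E :=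
  sInf {t | @IsTopologicalAddGroup E t _ ∧ @ContinuousSMul ℂ E _ _ t ∧
    @LocallyConvexSpace ℝ E _ _ _ _ t ∧ ∀ i, Continuous[_, t] (f i)}

section lcFinal

variable {E : Type*} [AddCommGroup E] [Module ℂ E] {ι : Type*} {X : ι → Type*}
  [∀ i, TopologicalSpace (X i)] (f : ∀ i, X i → E)

theorem lcFinal_isTopologicalAddGroup : @IsTopologicalAddGroup E (lcFinal f) _ :=
  topologicalAddGroup_sInf fun _ ht => ht.1

theorem lcFinal_continuousSMul : @ContinuousSMul ℂ E _ _ (lcFinal f) :=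
  continuousSMul_sInf fun _ ht => ht.2.1

theorem lcFinal_locallyConvexSpace : @LocallyConvexSpace ℝ E _ _ _ _ (lcFinal f) :=
  LocallyConvexSpace.sInf fun _ ht => ht.2.2.1

theorem lcFinal_continuous (i : ι) : Continuous[_, lcFinal f] (f i) :=
  continuous_sInf_rng.2 fun _ ht => ht.2.2.2 i

theorem lcFinal_continuous_dom {E' : Type*} [AddCommGroup E'] [Module ℂ E'] [t' : TopologicalSpace E']
    [IsTopologicalAddGroup E'] [ContinuousSMul ℂ E'] [LocallyConvexSpace ℝ E']
    (g : E →ₗ[ℂ] E') (hg : ∀ i, Continuous fun x => g (f i x)) : Continuous[lcFinal f, _] g := by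
  rw [continuous_iff_le_induced]
  refine sInf_le ⟨topologicalAddGroup_induced g, continuousSMul_induced g,
    LocallyConvexSpace.induced (g.restrictScalars ℝ), fun i => continuous_induced_rng.2 (hg i)⟩

end lcFinal

/-- The tensor power of `A` indexed by a finite type. -/
abbrev TensorPow (ι : Type) (A : Type u) [CommRing A] [Algebra ℂ A] : Type u := ⨂[ℂ] _ : ι, A

section TensorPow

open PiTensorProduct

variable {ι κ ν : Type} {A B C : Type u} [CommRing A] [Algebra ℂ A] [CommRing B] [Algebra ℂ B]
  [CommRing C] [Algebra ℂ C]

/-- The projective tensor product topology. -/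
noncomputable instance tensorPowTopology [TopologicalSpace A] : TopologicalSpace (TensorPow ι A) :=
  lcFinal fun _ : Unit => (tprod ℂ : (ι → A) → TensorPow ι A)

instance [TopologicalSpace A] : IsTopologicalAddGroup (TensorPow ι A) :=
  lcFinal_isTopologicalAddGroup _

instance [TopologicalSpace A] : ContinuousSMul ℂ (TensorPow ι A) := lcFinal_continuousSMul _

instance [TopologicalSpace A] : LocallyConvexSpace ℝ (TensorPow ι A) :=
  lcFinal_locallyConvexSpace _

theorem continuous_tprod [TopologicalSpace A] :
    Continuous (tprod ℂ : (ι → A) → TensorPow ι A) :=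
  lcFinal_continuous (fun _ : Unit => (tprod ℂ : (ι → A) → TensorPow ι A)) ()

theorem continuous_of_tprod [TopologicalSpace A] {E' : Type*} [AddCommGroup E'] [Module ℂ E']
    [TopologicalSpace E'] [IsTopologicalAddGroup E'] [ContinuousSMul ℂ E'] [LocallyConvexSpace ℝ E']
    (g : TensorPow ι A →ₗ[ℂ] E') (hg : Continuous fun a : ι → A => g (tprod ℂ a)) : Continuous g :=
  lcFinal_continuous_dom _ g fun _ => hg

theorem continuous_tensorPow_mul [TopologicalSpace A] [ContinuousMul A] (x : TensorPow ι A) :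
    Continuous fun y => x * y := by
  induction x using PiTensorProduct.induction_on with
  | smul_tprod r a =>
    refine continuous_of_tprod (LinearMap.mulLeft ℂ (r • tprod ℂ a)) ?_
    have h : ∀ b : ι → A, LinearMap.mulLeft ℂ (r • tprod ℂ a) (tprod ℂ b) =
        r • tprod ℂ (a * b) := fun b => by
      rw [LinearMap.mulLeft_apply, smul_mul_assoc, tprod_mul_tprod]
    simp only [h]
    exact (continuous_tprod.comp (continuous_const.mul continuous_id)).const_smul r
  | add x y hx hy =>
    simp only [_root_.add_mul]
    exact hx.add hy

variable [Fintype ι] [Fintype κ] [Fintype ν] [DecidableEq ι] [DecidableEq κ] [DecidableEq ν]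

/-- The multilinear map `(a_i) ↦ ∏_i α(a_i)`, with `α(a_i)` in the tensor factor `f(i)`. -/
noncomputable def tensorMulti (f : ι → κ) (α : A →ₐ[ℂ] B) :
    MultilinearMap ℂ (fun _ : ι => A) (TensorPow κ B) :=
  (MultilinearMap.mkPiAlgebra ℂ ι (TensorPow κ B)).compLinearMap
    fun i => ((singleAlgHom (R := ℂ) (A := fun _ : κ => B) (f i)).comp α).toLinearMap

theorem tensorMulti_apply (f : ι → κ) (α : A →ₐ[ℂ] B) (a : ι → A) : tensorMulti f α a =
    ∏ i, singleAlgHom (R := ℂ) (A := fun _ : κ => B) (f i) (α (a i)) := rfl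

/-- The morphism of algebras `⊗_i a_i ↦ ⊗_j ∏_(f(i) = j) α(a_i)`, see `tensorMap_tprod`. -/
noncomputable def tensorMap (f : ι → κ) (α : A →ₐ[ℂ] B) : TensorPow ι A →ₐ[ℂ] TensorPow κ B :=
  liftAlgHom (tensorMulti f α)
    (by rw [tensorMulti_apply]; exact Finset.prod_eq_one fun i _ => by
          rw [Pi.one_apply, map_one, map_one])
    (fun x y => by
      rw [tensorMulti_apply, tensorMulti_apply, tensorMulti_apply, ← Finset.prod_mul_distrib]
      exact Finset.prod_congr rfl fun i _ => by rw [Pi.mul_apply, map_mul, map_mul])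

theorem tensorMap_eq_prod (f : ι → κ) (α : A →ₐ[ℂ] B) (a : ι → A) :
    tensorMap f α (tprod ℂ a) =
      ∏ i, singleAlgHom (R := ℂ) (A := fun _ : κ => B) (f i) (α (a i)) :=
  lift.tprod (φ := tensorMulti f α) a

theorem tensorMap_tprod (f : ι → κ) (α : A →ₐ[ℂ] B) (a : ι → A) :
    tensorMap f α (tprod ℂ a) = tprod ℂ fun j => ∏ i with f i = j, α (a i) := by
  rw [tensorMap_eq_prod]
  simp only [singleAlgHom_apply]
  rw [← tprod_prod]
  congr 1
  funext j
  rw [Finset.prod_apply, Finset.prod_filter]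
  refine Finset.prod_congr rfl fun i _ => ?_
  by_cases h : f i = j
  · subst h; simp
  · rw [if_neg h, MonoidHom.mulSingle_apply, Pi.mulSingle_eq_of_ne (Ne.symm h)]

theorem tensorMap_single (f : ι → κ) (α : A →ₐ[ℂ] B) (i : ι) (a : A) :
    tensorMap f α (singleAlgHom (R := ℂ) (A := fun _ : ι => A) i a) =
      singleAlgHom (R := ℂ) (A := fun _ : κ => B) (f i) (α a) := by
  rw [singleAlgHom_apply, tensorMap_eq_prod, Finset.prod_eq_single i]
  · rw [MonoidHom.mulSingle_apply, Pi.mulSingle_eq_same]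
  · intro k _ hk
    rw [MonoidHom.mulSingle_apply, Pi.mulSingle_eq_of_ne hk, map_one, map_one]
  · exact fun h => absurd (Finset.mem_univ i) h

theorem tensorMap_comp (f : ι → κ) (f' : κ → ν) (α : A →ₐ[ℂ] B) (β : B →ₐ[ℂ] C) :
    (tensorMap f' β).comp (tensorMap f α) = tensorMap (f' ∘ f) (β.comp α) := by
  refine algHom_ext fun i => AlgHom.ext fun a => ?_
  simp only [AlgHom.comp_apply, tensorMap_single, Function.comp]

theorem tensorMap_id : tensorMap (id : ι → ι) (AlgHom.id ℂ A) = AlgHom.id ℂ _ := by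
  refine algHom_ext fun i => AlgHom.ext fun a => ?_
  simp only [AlgHom.comp_apply, tensorMap_single, AlgHom.id_apply, id]

theorem continuous_tensorMap [TopologicalSpace A] [TopologicalSpace B] [ContinuousMul B]
    (f : ι → κ) (α : A →ₐ[ℂ] B) (hα : Continuous α) : Continuous (tensorMap f α) := by
  refine continuous_of_tprod (tensorMap f α).toLinearMap ?_
  change Continuous fun a : ι → A => tensorMap f α (tprod ℂ a)
  simp only [tensorMap_tprod]
  refine continuous_tprod.comp (continuous_pi fun j => ?_)
  exact continuous_finsetProd _ fun i _ => hα.comp (continuous_apply i)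

end TensorPow

/-- A finite family of pairwise disjoint open discs in the plane, each given by its centre and its
radius. -/
structure DiskConfig where
  /-- the set of pairs `(z, r)` of a centre and a radius -/
  discs : Finset (ℂ × ℝ)
  pos : ∀ d ∈ discs, 0 < d.2
  disj : ∀ d ∈ discs, ∀ e ∈ discs, d ≠ e → Disjoint (disc d.1 d.2) (disc e.1 e.2)

namespace DiskConfig

/-- The disjoint union of the discs. -/
noncomputable def toOpens (L : DiskConfig) : Opens ℂ := ⨆ d : L.discs, disc d.1.1 d.1.2

theorem disc_le (L : DiskConfig) (d : L.discs) : disc d.1.1 d.1.2 ≤ L.toOpens :=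
  le_iSup (fun d : L.discs => disc d.1.1 d.1.2) d

theorem center_mem (L : DiskConfig) (d : L.discs) : d.1.1 ∈ disc d.1.1 d.1.2 :=
  Metric.mem_ball_self (L.pos d.1 d.2)

theorem exists_parent {L M : DiskConfig} (h : L.toOpens ≤ M.toOpens) (d : L.discs) :
    ∃ e : M.discs, disc d.1.1 d.1.2 ≤ disc e.1.1 e.1.2 := by
  have hd : disc d.1.1 d.1.2 ≤ M.toOpens := (L.disc_le d).trans h
  obtain ⟨e, he⟩ := Opens.mem_iSup.1 (hd (L.center_mem d))
  refine ⟨e, ?_⟩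
  let V : Opens ℂ := ⨆ e' : {e' : M.discs // e' ≠ e}, disc e'.1.1.1 e'.1.1.2
  have hdis : Disjoint (disc e.1.1 e.1.2) V :=
    disjoint_iSup_iff.2 fun e' => M.disj _ e.2 _ e'.1.2 fun h => e'.2 (Subtype.ext h.symm)
  have hsub : (disc d.1.1 d.1.2 : Set ℂ) ⊆ (disc e.1.1 e.1.2 : Set ℂ) ∪ V := by
    intro x hx
    obtain ⟨e', he'⟩ := Opens.mem_iSup.1 (hd hx)
    by_cases h : e' = e
    · subst h; exact Or.inl he'
    · exact Or.inr (Opens.mem_iSup.2 ⟨⟨e', h⟩, he'⟩)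
  exact IsPreconnected.subset_left_of_subset_union (disc e.1.1 e.1.2).2 V.2
    (Opens.coe_disjoint.2 hdis) hsub ⟨_, L.center_mem d, he⟩
    (convex_ball (d.1.1) d.1.2).isPreconnected

/-- For `L ⊆ M`, the disc of `M` that contains a given disc of `L`. -/
noncomputable def parent {L M : DiskConfig} (h : L.toOpens ≤ M.toOpens) (d : L.discs) : M.discs :=
  (exists_parent h d).choose

theorem le_parent {L M : DiskConfig} (h : L.toOpens ≤ M.toOpens) (d : L.discs) :
    disc d.1.1 d.1.2 ≤ disc (parent h d).1.1 (parent h d).1.2 := (exists_parent h d).choose_spec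

theorem parent_eq {L M : DiskConfig} (h : L.toOpens ≤ M.toOpens) (d : L.discs) (e : M.discs)
    (he : disc d.1.1 d.1.2 ≤ disc e.1.1 e.1.2) : parent h d = e := by
  by_contra hne
  have := M.disj _ (parent h d).2 _ e.2 fun h' => hne (Subtype.ext h')
  exact (Opens.coe_disjoint.2 this).le_bot ⟨le_parent h d (L.center_mem d), he (L.center_mem d)⟩

theorem parent_refl (L : DiskConfig) : parent (le_refl L.toOpens) = id :=
  funext fun d => parent_eq _ d d le_rfl

theorem parent_parent {L M N : DiskConfig} (h : L.toOpens ≤ M.toOpens)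
    (h' : M.toOpens ≤ N.toOpens) : parent h' ∘ parent h = parent (h.trans h') :=
  funext fun d => (parent_eq _ d _ ((le_parent h d).trans (le_parent h' _))).symm

/-- The empty configuration. -/
def empty : DiskConfig where
  discs := ∅
  pos := fun d hd => absurd hd (Finset.notMem_empty d)
  disj := fun d hd => absurd hd (Finset.notMem_empty d)

theorem empty_le (U : Opens ℂ) : empty.toOpens ≤ U :=
  iSup_le fun d => absurd d.2 (Finset.notMem_empty d.1)

/-- A single disc. -/
def single (z : ℂ) (r : ℝ) (hr : 0 < r) : DiskConfig where
  discs := {(z, r)}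
  pos := fun d hd => by rw [Finset.mem_singleton.1 hd]; exact hr
  disj := fun d hd e he hne =>
    absurd ((Finset.mem_singleton.1 hd).trans (Finset.mem_singleton.1 he).symm) hne

theorem single_le (z : ℂ) (r : ℝ) (hr : 0 < r) : (single z r hr).toOpens ≤ disc z r :=
  iSup_le fun d => by
    have : d.1 = (z, r) := Finset.mem_singleton.1 d.2
    rw [this]

open Classical in
/-- The union of two disjoint configurations. -/
noncomputable def union (L M : DiskConfig) (h : Disjoint L.toOpens M.toOpens) : DiskConfig where
  discs := L.discs ∪ M.discs
  pos := fun d hd => (Finset.mem_union.1 hd).elim (L.pos d) (M.pos d)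
  disj := fun d hd e he hne => by
    rcases Finset.mem_union.1 hd with hd | hd <;> rcases Finset.mem_union.1 he with he | he
    · exact L.disj d hd e he hne
    · exact h.mono (L.disc_le ⟨d, hd⟩) (M.disc_le ⟨e, he⟩)
    · exact h.symm.mono (M.disc_le ⟨d, hd⟩) (L.disc_le ⟨e, he⟩)
    · exact M.disj d hd e he hne

theorem left_le_union (L M : DiskConfig) (h : Disjoint L.toOpens M.toOpens) :
    L.toOpens ≤ (union L M h).toOpens :=
  iSup_le fun d => (union L M h).disc_le ⟨d.1, by classical exact Finset.mem_union_left _ d.2⟩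

theorem right_le_union (L M : DiskConfig) (h : Disjoint L.toOpens M.toOpens) :
    M.toOpens ≤ (union L M h).toOpens :=
  iSup_le fun d => (union L M h).disc_le ⟨d.1, by classical exact Finset.mem_union_right _ d.2⟩

theorem union_le {L M : DiskConfig} {h : Disjoint L.toOpens M.toOpens} {U : Opens ℂ}
    (hL : L.toOpens ≤ U) (hM : M.toOpens ≤ U) : (union L M h).toOpens ≤ U :=
  iSup_le fun d => by
    classical
    rcases Finset.mem_union.1 d.2 with hd | hd
    · exact (L.disc_le ⟨d.1, hd⟩).trans hL
    · exact (M.disc_le ⟨d.1, hd⟩).trans hM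

open Classical in
/-- The image of a configuration under a rotation and translation. -/
noncomputable def move (g : RotTrans) (L : DiskConfig) : DiskConfig where
  discs := L.discs.image fun d => (g • d.1, d.2)
  pos := fun d hd => by
    obtain ⟨d', hd', rfl⟩ := Finset.mem_image.1 hd
    exact L.pos d' hd'
  disj := fun d hd e he hne => by
    obtain ⟨d', hd', rfl⟩ := Finset.mem_image.1 hd
    obtain ⟨e', he', rfl⟩ := Finset.mem_image.1 he
    rw [← rotTrans_smul_disc, ← rotTrans_smul_disc]
    exact g.smul_disjoint (L.disj d' hd' e' he' fun h => hne (by rw [h]))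

/-- The bijection between the discs of a configuration and those of its image. -/
noncomputable def moveDisc (g : RotTrans) (L : DiskConfig) (d : L.discs) : (move g L).discs :=
  ⟨(g • d.1.1, d.1.2), by classical exact Finset.mem_image_of_mem _ d.2⟩

theorem moveDisc_le (g : RotTrans) (L : DiskConfig) (d : L.discs) :
    disc (moveDisc g L d).1.1 (moveDisc g L d).1.2 = g • disc d.1.1 d.1.2 :=
  (rotTrans_smul_disc g d.1.1 d.1.2).symm

theorem move_le (g : RotTrans) {L : DiskConfig} {U : Opens ℂ} (h : L.toOpens ≤ U) :
    (move g L).toOpens ≤ g • U :=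
  iSup_le fun d => by
    classical
    obtain ⟨e, he, h'⟩ := Finset.mem_image.1 d.2
    rw [← h', ← rotTrans_smul_disc]
    exact g.smul_mono ((L.disc_le ⟨e, he⟩).trans h)

theorem smul_le_move (g : RotTrans) (L : DiskConfig) : g • L.toOpens ≤ (move g L).toOpens := by
  rintro _ ⟨x, hx, rfl⟩
  obtain ⟨d, hd⟩ := Opens.mem_iSup.1 hx
  refine (move g L).disc_le (moveDisc g L d) ?_
  rw [moveDisc_le]
  exact ⟨x, hd, rfl⟩

theorem move_mono (g : RotTrans) {L M : DiskConfig} (h : L.toOpens ≤ M.toOpens) :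
    (move g L).toOpens ≤ (move g M).toOpens := (move_le g h).trans (smul_le_move g M)

theorem parent_move (g : RotTrans) {L M : DiskConfig} (h : L.toOpens ≤ M.toOpens) :
    parent (move_mono g h) ∘ moveDisc g L = moveDisc g M ∘ parent h :=
  funext fun d => parent_eq _ _ _ (by
    rw [moveDisc_le, Function.comp, moveDisc_le]; exact g.smul_mono (le_parent h d))

theorem move_mul_le (g h : RotTrans) (L : DiskConfig) :
    (move (g * h) L).toOpens ≤ (move g (move h L)).toOpens :=
  (move_le (g * h) le_rfl).trans <| by
    rw [mul_smul]
    exact (g.smul_mono (smul_le_move h L)).trans (smul_le_move g _)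

theorem parent_move_mul (g h : RotTrans) (L : DiskConfig) :
    parent (move_mul_le g h L) ∘ moveDisc (g * h) L = moveDisc g (move h L) ∘ moveDisc h L :=
  funext fun d => parent_eq _ _ _ (by
    rw [moveDisc_le, Function.comp, moveDisc_le, moveDisc_le, mul_smul])

theorem move_one_le (L : DiskConfig) : (move 1 L).toOpens ≤ L.toOpens :=
  (move_le 1 le_rfl).trans (one_smul RotTrans L.toOpens).le

theorem parent_move_one (L : DiskConfig) : parent (move_one_le L) ∘ moveDisc 1 L = id :=
  funext fun d => parent_eq _ _ _ (by rw [moveDisc_le, one_smul]; exact le_rfl)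

end DiskConfig

noncomputable section FLoc

open DiskConfig

open scoped Classical in
noncomputable instance (L : DiskConfig) : DecidableEq L.discs := inferInstance

/-- The configurations contained in an open set, preordered by inclusion. -/
def Configs (U : Opens ℂ) : Type := {L : DiskConfig // L.toOpens ≤ U}

instance (U : Opens ℂ) : Preorder (Configs U) := Preorder.lift fun L => L.1.toOpens

noncomputable instance (U : Opens ℂ) : DecidableEq (Configs U) := Classical.decEq _

variable (A : Type u) [CommRing A] [Algebra ℂ A]

/-- The value of `F^loc_A` on a disjoint union of discs: one tensor factor `A` for each disc. -/
abbrev FDisk (L : DiskConfig) : Type u := TensorPow L.discs A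

variable {A}

/-- The extension map of `F^loc_A` for `L ⊆ M`: it multiplies the tensor factors of the discs of `L`
that lie in the same disc of `M`. -/
def extMap {L M : DiskConfig} (h : L.toOpens ≤ M.toOpens) : FDisk A L →ₐ[ℂ] FDisk A M :=
  tensorMap (parent h) (AlgHom.id ℂ A)

theorem extMap_refl (L : DiskConfig) (x : FDisk A L) : extMap (le_refl L.toOpens) x = x := by
  rw [extMap, parent_refl, tensorMap_id]; rfl

theorem extMap_extMap {L M N : DiskConfig} (h : L.toOpens ≤ M.toOpens) (h' : M.toOpens ≤ N.toOpens)
    (x : FDisk A L) : extMap h' (extMap h x) = extMap (h.trans h') x := by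
  have := AlgHom.congr_fun (tensorMap_comp (parent h) (parent h') (AlgHom.id ℂ A) (AlgHom.id ℂ A)) x
  rw [parent_parent] at this
  exact this

theorem continuous_extMap [TopologicalSpace A] [ContinuousMul A] {L M : DiskConfig}
    (h : L.toOpens ≤ M.toOpens) : Continuous (extMap (A := A) h) :=
  continuous_tensorMap _ _ continuous_id

variable (A)

/-- The inductive limit of the `F^loc_A(L)` over the configurations `L` contained in `U`. -/
def FLocObj (U : Opens ℂ) : Type u :=
  Module.DirectLimit (fun L : Configs U => FDisk A L.1)
    fun _ _ h => (extMap (A := A) h).toLinearMap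

instance (U : Opens ℂ) : AddCommGroup (FLocObj A U) :=
  inferInstanceAs (AddCommGroup (Module.DirectLimit (fun L : Configs U => FDisk A L.1) _))

instance (U : Opens ℂ) : Module ℂ (FLocObj A U) :=
  inferInstanceAs (Module ℂ (Module.DirectLimit (fun L : Configs U => FDisk A L.1) _))

namespace FLocObj

variable {A}

/-- The canonical map `F^loc_A(L) → 𝐅^loc_A(U)`. -/
def of {U : Opens ℂ} (L : DiskConfig) (h : L.toOpens ≤ U) : FDisk A L →ₗ[ℂ] FLocObj A U :=
  Module.DirectLimit.of ℂ (Configs U) (fun L => FDisk A L.1) _ ⟨L, h⟩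

theorem of_extMap {U : Opens ℂ} {L M : DiskConfig} (h : L.toOpens ≤ M.toOpens) (hM : M.toOpens ≤ U)
    (x : FDisk A L) : of M hM (extMap h x) = of L (h.trans hM) x :=
  Module.DirectLimit.of_f (R := ℂ) (ι := Configs U) (G := fun L => FDisk A L.1)
    (i := ⟨L, h.trans hM⟩) (j := ⟨M, hM⟩) (hij := h)

/-- The universal property of the inductive limit. -/
def lift {U : Opens ℂ} {P : Type*} [AddCommGroup P] [Module ℂ P]
    (g : ∀ L : DiskConfig, L.toOpens ≤ U → FDisk A L →ₗ[ℂ] P)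
    (hg : ∀ (L M : DiskConfig) (h : L.toOpens ≤ M.toOpens) (hM : M.toOpens ≤ U) (x : FDisk A L),
      g M hM (extMap h x) = g L (h.trans hM) x) : FLocObj A U →ₗ[ℂ] P :=
  Module.DirectLimit.lift ℂ (Configs U) (fun L => FDisk A L.1) _ (fun L => g L.1 L.2)
    fun L M h x => hg L.1 M.1 h M.2 x

theorem lift_of {U : Opens ℂ} {P : Type*} [AddCommGroup P] [Module ℂ P]
    (g : ∀ L : DiskConfig, L.toOpens ≤ U → FDisk A L →ₗ[ℂ] P) (hg) (L : DiskConfig)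
    (h : L.toOpens ≤ U) (x : FDisk A L) : lift g hg (of L h x) = g L h x :=
  Module.DirectLimit.lift_of (R := ℂ) (ι := Configs U) (G := fun L => FDisk A L.1) (i := ⟨L, h⟩)
    (fun L => g L.1 L.2) (fun L M h x => hg L.1 M.1 h M.2 x) x

theorem hom_ext {U : Opens ℂ} {P : Type*} [AddCommGroup P] [Module ℂ P]
    {f g : FLocObj A U →ₗ[ℂ] P} (h : ∀ L hL x, f (of L hL x) = g (of L hL x)) : f = g :=
  Module.DirectLimit.hom_ext fun L => LinearMap.ext fun x => h L.1 L.2 x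

instance [TopologicalSpace A] (U : Opens ℂ) : TopologicalSpace (FLocObj A U) :=
  lcFinal fun L : Configs U => (of L.1 L.2 : FDisk A L.1 → FLocObj A U)

instance [TopologicalSpace A] (U : Opens ℂ) : IsTopologicalAddGroup (FLocObj A U) :=
  lcFinal_isTopologicalAddGroup _

instance [TopologicalSpace A] (U : Opens ℂ) : ContinuousSMul ℂ (FLocObj A U) :=
  lcFinal_continuousSMul _

instance [TopologicalSpace A] (U : Opens ℂ) : LocallyConvexSpace ℝ (FLocObj A U) :=
  lcFinal_locallyConvexSpace _

theorem continuous_of [TopologicalSpace A] {U : Opens ℂ} (L : DiskConfig) (h : L.toOpens ≤ U) :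
    Continuous (of (A := A) L h) :=
  lcFinal_continuous (fun L : Configs U => (of L.1 L.2 : FDisk A L.1 → FLocObj A U)) ⟨L, h⟩

theorem continuous_dom [TopologicalSpace A] {U : Opens ℂ} {P : Type*} [AddCommGroup P] [Module ℂ P]
    [TopologicalSpace P] [IsTopologicalAddGroup P] [ContinuousSMul ℂ P] [LocallyConvexSpace ℝ P]
    (f : FLocObj A U →ₗ[ℂ] P) (hf : ∀ L h, Continuous fun x => f (of L h x)) : Continuous f :=
  lcFinal_continuous_dom _ f fun L => hf L.1 L.2

/-- The extension maps of `𝐅^loc_A`. -/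
def map {U V : Opens ℂ} (h : U ≤ V) : FLocObj A U →ₗ[ℂ] FLocObj A V :=
  lift (fun L hL => of L (hL.trans h)) fun _ _ hLM hM x => of_extMap hLM (hM.trans h) x

theorem map_of {U V : Opens ℂ} (h : U ≤ V) (L : DiskConfig) (hL : L.toOpens ≤ U) (x : FDisk A L) :
    map h (of L hL x) = of L (hL.trans h) x := lift_of _ _ L hL x

theorem continuous_map [TopologicalSpace A] {U V : Opens ℂ} (h : U ≤ V) :
    Continuous (map (A := A) h) :=
  continuous_dom _ fun L hL => by
    simp only [map_of]; exact continuous_of L _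

/-- The multiplication `F^loc_A(L) × F^loc_A(M) → 𝐅^loc_A(W)` for disjoint configurations `L` and
`M` contained in `W`: the element `x ⊗ y` of `F^loc_A(L ⊔ M) = F^loc_A(L) ⊗ F^loc_A(M)` is the
product of the images of `x` and `y`. -/
def mulAux {W : Opens ℂ} (L M : DiskConfig) (d : Disjoint L.toOpens M.toOpens)
    (hL : L.toOpens ≤ W) (hM : M.toOpens ≤ W) : FDisk A L →ₗ[ℂ] FDisk A M →ₗ[ℂ] FLocObj A W :=
  ((LinearMap.mul ℂ (FDisk A (union L M d))).compl₁₂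
    (extMap (left_le_union L M d)).toLinearMap
    (extMap (right_le_union L M d)).toLinearMap).compr₂ (of _ (union_le hL hM))

theorem mulAux_apply {W : Opens ℂ} (L M : DiskConfig) (d : Disjoint L.toOpens M.toOpens)
    (hL : L.toOpens ≤ W) (hM : M.toOpens ≤ W) (x : FDisk A L) (y : FDisk A M) :
    mulAux L M d hL hM x y = of _ (union_le hL hM)
      (extMap (left_le_union L M d) x * extMap (right_le_union L M d) y) := rfl

theorem mulAux_eq {W : Opens ℂ} (L M N : DiskConfig) (d : Disjoint L.toOpens M.toOpens)
    (hL : L.toOpens ≤ N.toOpens) (hM : M.toOpens ≤ N.toOpens) (hN : N.toOpens ≤ W)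
    (x : FDisk A L) (y : FDisk A M) :
    mulAux L M d (hL.trans hN) (hM.trans hN) x y = of N hN (extMap hL x * extMap hM y) := by
  rw [mulAux_apply, ← of_extMap (union_le hL hM) hN, map_mul, extMap_extMap, extMap_extMap]

/-- The multiplication of `𝐅^loc_A`. -/
def mul {U V W : Opens ℂ} (d : Disjoint U V) (hU : U ≤ W) (hV : V ≤ W) :
    FLocObj A U →ₗ[ℂ] FLocObj A V →ₗ[ℂ] FLocObj A W :=
  lift (fun L hL => LinearMap.flip (lift
      (fun M hM => (mulAux L M (d.mono hL hM) (hL.trans hU) (hM.trans hV)).flip)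
      fun M M' h hM' y => LinearMap.ext fun x => by
        rw [LinearMap.flip_apply, LinearMap.flip_apply, mulAux_apply,
          mulAux_eq L M (union L M' (d.mono hL hM')) (d.mono hL (h.trans hM'))
            (left_le_union _ _ _) (h.trans (right_le_union _ _ _))
            (union_le (hL.trans hU) (hM'.trans hV)), extMap_extMap]))
    fun L L' h hL' x => by
      refine hom_ext fun M hM y => ?_
      rw [LinearMap.flip_apply, LinearMap.flip_apply, lift_of, lift_of, LinearMap.flip_apply,
        LinearMap.flip_apply, mulAux_apply,
        mulAux_eq L M (union L' M (d.mono hL' hM)) (d.mono (h.trans hL') hM)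
          (h.trans (left_le_union _ _ _)) (right_le_union _ _ _)
          (union_le (hL'.trans hU) (hM.trans hV)), extMap_extMap]

theorem mul_of {U V W : Opens ℂ} (d : Disjoint U V) (hU : U ≤ W) (hV : V ≤ W) (L M N : DiskConfig)
    (hL : L.toOpens ≤ U) (hM : M.toOpens ≤ V) (hLN : L.toOpens ≤ N.toOpens)
    (hMN : M.toOpens ≤ N.toOpens) (hN : N.toOpens ≤ W) (x : FDisk A L) (y : FDisk A M) :
    mul d hU hV (of L hL x) (of M hM y) = of N hN (extMap hLN x * extMap hMN y) := by
  rw [mul, lift_of, LinearMap.flip_apply, lift_of, LinearMap.flip_apply,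
    mulAux_eq L M N (d.mono hL hM) hLN hMN hN]

theorem mul_of_union {U V W : Opens ℂ} (d : Disjoint U V) (hU : U ≤ W) (hV : V ≤ W)
    (L M : DiskConfig) (hL : L.toOpens ≤ U) (hM : M.toOpens ≤ V) (x : FDisk A L) (y : FDisk A M) :
    mul d hU hV (of L hL x) (of M hM y) =
      of (union L M (d.mono hL hM)) (union_le (hL.trans hU) (hM.trans hV))
        (extMap (left_le_union _ _ _) x * extMap (right_le_union _ _ _) y) :=
  mul_of d hU hV L M _ hL hM _ _ _ x y

/-- Two bilinear maps on `𝐅^loc_A(U) × 𝐅^loc_A(V)` agree if they do so on configurations. -/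
theorem hom_ext₂ {U V : Opens ℂ} {P : Type*} [AddCommGroup P] [Module ℂ P]
    {f g : FLocObj A U →ₗ[ℂ] FLocObj A V →ₗ[ℂ] P}
    (h : ∀ L hL x M hM y, f (of L hL x) (of M hM y) = g (of L hL x) (of M hM y)) : f = g :=
  hom_ext fun L hL x => hom_ext fun M hM y => h L hL x M hM y

theorem mul_comm {U V W : Opens ℂ} (d : Disjoint U V) (hU : U ≤ W) (hV : V ≤ W)
    (x : FLocObj A U) (y : FLocObj A V) : mul d hU hV x y = mul d.symm hV hU y x := by
  have : mul (A := A) d hU hV = (mul d.symm hV hU).flip :=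
    hom_ext₂ fun L hL x M hM y => by
      rw [LinearMap.flip_apply, mul_of_union,
        mul_of d.symm hV hU M L _ hM hL (right_le_union L M (d.mono hL hM)) (left_le_union _ _ _)
          (union_le (hL.trans hU) (hM.trans hV)), _root_.mul_comm]
  exact LinearMap.congr_fun₂ this x y

theorem mem_of_of {U : Opens ℂ} (S : Submodule ℂ (FLocObj A U)) (h : ∀ L hL x, of L hL x ∈ S)
    (x : FLocObj A U) : x ∈ S := by
  have : S.mkQ = 0 := hom_ext fun L hL x => by
    rw [LinearMap.zero_apply, Submodule.mkQ_apply, Submodule.Quotient.mk_eq_zero]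
    exact h L hL x
  rw [← Submodule.Quotient.mk_eq_zero, ← Submodule.mkQ_apply, this, LinearMap.zero_apply]

theorem continuous_mul_of [TopologicalSpace A] [ContinuousMul A] {U V W : Opens ℂ}
    (d : Disjoint U V) (hU : U ≤ W) (hV : V ≤ W) (x : FLocObj A U) :
    Continuous fun y => mul d hU hV x y := by
  let S : Submodule ℂ (FLocObj A U) :=
    { carrier := {x | Continuous fun y => mul d hU hV x y}
      zero_mem' := by
        change Continuous fun y => mul d hU hV 0 y
        simp only [map_zero, LinearMap.zero_apply]
        exact continuous_const
      add_mem' := fun {x x'} hx hx' => by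
        change Continuous fun y => mul d hU hV (x + x') y
        simp only [map_add, LinearMap.add_apply]
        exact Continuous.add hx hx'
      smul_mem' := fun c x hx => by
        change Continuous fun y => mul d hU hV (c • x) y
        simp only [map_smul, LinearMap.smul_apply]
        exact Continuous.const_smul hx c }
  refine mem_of_of S (fun L hL x => ?_) x
  refine continuous_dom (mul d hU hV (of L hL x)) fun M hM => ?_
  simp only [mul_of_union]
  exact (continuous_of _ _).comp ((continuous_tensorPow_mul _).comp (continuous_extMap _))

theorem mul_assoc {U₁ U₂ U₃ V₁ V₂ W : Opens ℂ} (d₁₂ : Disjoint U₁ U₂) (d₂₃ : Disjoint U₂ U₃)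
    (d₁ : Disjoint U₁ V₂) (d₃ : Disjoint V₁ U₃) (h₁ : U₁ ≤ V₁) (h₂ : U₂ ≤ V₁) (h₂' : U₂ ≤ V₂)
    (h₃ : U₃ ≤ V₂) (k₁ : U₁ ≤ W) (k₂ : V₂ ≤ W) (k₃ : U₃ ≤ W) (k₁₂ : V₁ ≤ W)
    (x : FLocObj A U₁) (y : FLocObj A U₂) (z : FLocObj A U₃) :
    mul d₃ k₁₂ k₃ (mul d₁₂ h₁ h₂ x y) z = mul d₁ k₁ k₂ x (mul d₂₃ h₂' h₃ y z) := by
  have h0 : ∀ L₁ hL₁ x L₂ hL₂ y L₃ hL₃ z,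
      mul (A := A) d₃ k₁₂ k₃ (mul d₁₂ h₁ h₂ (of L₁ hL₁ x) (of L₂ hL₂ y)) (of L₃ hL₃ z) =
        mul d₁ k₁ k₂ (of L₁ hL₁ x) (mul d₂₃ h₂' h₃ (of L₂ hL₂ y) (of L₃ hL₃ z)) := by
    intro L₁ hL₁ x L₂ hL₂ y L₃ hL₃ z
    rw [mul_of_union, mul_of_union d₂₃, mul_of_union,
      mul_of d₁ k₁ k₂ L₁ (union L₂ L₃ (d₂₃.mono hL₂ hL₃))
        (union (union L₁ L₂ (d₁₂.mono hL₁ hL₂)) L₃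
          (d₃.mono (union_le (hL₁.trans h₁) (hL₂.trans h₂)) hL₃)) _ _
        ((left_le_union _ _ _).trans (left_le_union _ _ _))
        (union_le ((right_le_union _ _ _).trans (left_le_union _ _ _)) (right_le_union _ _ _))
        (union_le (union_le (hL₁.trans k₁) ((hL₂.trans h₂).trans k₁₂)) (hL₃.trans k₃))]
    simp only [map_mul, extMap_extMap, _root_.mul_assoc]
  have h1 : ∀ L₁ hL₁ x L₂ hL₂ y z,
      mul (A := A) d₃ k₁₂ k₃ (mul d₁₂ h₁ h₂ (of L₁ hL₁ x) (of L₂ hL₂ y)) z =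
        mul d₁ k₁ k₂ (of L₁ hL₁ x) (mul d₂₃ h₂' h₃ (of L₂ hL₂ y) z) := by
    intro L₁ hL₁ x L₂ hL₂ y z
    have : mul (A := A) d₃ k₁₂ k₃ (mul d₁₂ h₁ h₂ (of L₁ hL₁ x) (of L₂ hL₂ y)) =
        mul d₁ k₁ k₂ (of L₁ hL₁ x) ∘ₗ mul d₂₃ h₂' h₃ (of L₂ hL₂ y) :=
      hom_ext fun L₃ hL₃ z => h0 L₁ hL₁ x L₂ hL₂ y L₃ hL₃ z
    exact LinearMap.congr_fun this z
  have h2 : ∀ L₁ hL₁ x y z, mul (A := A) d₃ k₁₂ k₃ (mul d₁₂ h₁ h₂ (of L₁ hL₁ x) y) z =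
        mul d₁ k₁ k₂ (of L₁ hL₁ x) (mul d₂₃ h₂' h₃ y z) := by
    intro L₁ hL₁ x y z
    have : (mul (A := A) d₃ k₁₂ k₃).flip z ∘ₗ mul d₁₂ h₁ h₂ (of L₁ hL₁ x) =
        mul d₁ k₁ k₂ (of L₁ hL₁ x) ∘ₗ (mul d₂₃ h₂' h₃).flip z :=
      hom_ext fun L₂ hL₂ y => h1 L₁ hL₁ x L₂ hL₂ y z
    exact LinearMap.congr_fun this y
  have : (mul (A := A) d₃ k₁₂ k₃).flip z ∘ₗ (mul d₁₂ h₁ h₂).flip y =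
      (mul d₁ k₁ k₂).flip (mul d₂₃ h₂' h₃ y z) :=
    hom_ext fun L₁ hL₁ x => h2 L₁ hL₁ x y z
  exact LinearMap.congr_fun this x

theorem map_map {U V W : Opens ℂ} (h : U ≤ V) (h' : V ≤ W) (x : FLocObj A U) :
    map h' (map h x) = map (h.trans h') x := by
  have : map (A := A) h' ∘ₗ map h = map (h.trans h') := hom_ext fun L hL x => by
    rw [LinearMap.comp_apply, map_of, map_of, map_of]
  exact LinearMap.congr_fun this x

theorem map_id (U : Opens ℂ) (x : FLocObj A U) : map (le_refl U) x = x := by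
  have : map (A := A) (le_refl U) = LinearMap.id := hom_ext fun L hL x => map_of _ L hL x
  exact LinearMap.congr_fun this x

theorem map_mul_of {U V W W' : Opens ℂ} (d : Disjoint U V) (hU : U ≤ W) (hV : V ≤ W) (hW : W ≤ W')
    (x : FLocObj A U) (y : FLocObj A V) :
    map hW (mul d hU hV x y) = mul d (hU.trans hW) (hV.trans hW) x y := by
  have : (mul (A := A) d hU hV).compr₂ (map hW) = mul d (hU.trans hW) (hV.trans hW) :=
    hom_ext₂ fun L hL x M hM y => by
      rw [LinearMap.compr₂_apply, mul_of_union, mul_of_union, map_of]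
  exact LinearMap.congr_fun₂ this x y

theorem mul_map {U V U' V' W : Opens ℂ} (hU : U ≤ U') (hV : V ≤ V') (d : Disjoint U' V')
    (hU' : U' ≤ W) (hV' : V' ≤ W) (x : FLocObj A U) (y : FLocObj A V) :
    mul d hU' hV' (map hU x) (map hV y) =
      mul (d.mono hU hV) (hU.trans hU') (hV.trans hV') x y := by
  have : (mul (A := A) d hU' hV').compl₁₂ (map hU) (map hV) =
      mul (d.mono hU hV) (hU.trans hU') (hV.trans hV') :=
    hom_ext₂ fun L hL x M hM y => by
      rw [LinearMap.compl₁₂_apply, map_of, map_of, mul_of_union, mul_of_union]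
  exact LinearMap.congr_fun₂ this x y

variable (A) in
/-- The unit of `𝐅^loc_A`, the image of `1` under `ℂ = F^loc_A(∅) → 𝐅^loc_A(∅)`. -/
def one : FLocObj A ⊥ := of empty (empty_le ⊥) 1

theorem one_mul (U : Opens ℂ) (x : FLocObj A U) :
    mul disjoint_bot_left bot_le le_rfl (one A) x = x := by
  have : mul (A := A) disjoint_bot_left bot_le (le_refl U) (one A) = LinearMap.id :=
    hom_ext fun L hL x => by
      rw [one, mul_of disjoint_bot_left bot_le (le_refl U) empty L L _ hL (empty_le _) le_rfl hL,
        map_one, _root_.one_mul, extMap_refl, LinearMap.id_apply]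
  exact LinearMap.congr_fun this x

/-- The map `F^loc_A(L) → F^loc_B(gL)` which applies `α` to each tensor factor. -/
def moveMap {A B : Type u} [CommRing A] [Algebra ℂ A] [CommRing B] [Algebra ℂ B]
    (g : RotTrans) (α : A →ₐ[ℂ] B) (L : DiskConfig) : FDisk A L →ₐ[ℂ] FDisk B (move g L) :=
  tensorMap (moveDisc g L) α

theorem extMap_moveMap (g : RotTrans) (α : A →ₐ[ℂ] A) {L M : DiskConfig}
    (h : L.toOpens ≤ M.toOpens) (x : FDisk A L) :
    extMap (move_mono g h) (moveMap g α L x) = moveMap g α M (extMap h x) := by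
  have h1 := AlgHom.congr_fun (tensorMap_comp (moveDisc g L) (parent (move_mono g h)) α
    (AlgHom.id ℂ A)) x
  have h2 := AlgHom.congr_fun (tensorMap_comp (parent h) (moveDisc g M) (AlgHom.id ℂ A) α) x
  rw [parent_move g h, AlgHom.id_comp] at h1
  rw [AlgHom.comp_id] at h2
  exact h1.trans h2.symm

/-- The map `𝐅^loc_A(U) → 𝐅^loc_A(gU)` which applies `α` to each tensor factor. -/
def act (g : RotTrans) (α : A →ₐ[ℂ] A) (U : Opens ℂ) : FLocObj A U →ₗ[ℂ] FLocObj A (g • U) :=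
  lift (fun L hL => of (move g L) (move_le g hL) ∘ₗ (moveMap g α L).toLinearMap)
    fun L M h hM x => by
      change of _ _ (moveMap g α M (extMap h x)) = of _ _ (moveMap g α L x)
      rw [← extMap_moveMap g α h, of_extMap]

theorem act_of (g : RotTrans) (α : A →ₐ[ℂ] A) (U : Opens ℂ) (L : DiskConfig) (hL : L.toOpens ≤ U)
    (x : FDisk A L) : act g α U (of L hL x) = of (move g L) (move_le g hL) (moveMap g α L x) :=
  lift_of _ _ L hL x

theorem continuous_act [TopologicalSpace A] [ContinuousMul A] (g : RotTrans) (α : A →ₐ[ℂ] A)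
    (hα : Continuous α) (U : Opens ℂ) : Continuous (act g α U) :=
  continuous_dom _ fun L hL => by
    simp only [act_of]
    exact (continuous_of _ _).comp (continuous_tensorMap _ _ hα)

theorem act_map (g : RotTrans) (α : A →ₐ[ℂ] A) {U V : Opens ℂ} (h : U ≤ V) (x : FLocObj A U) :
    act g α V (map h x) = map (g.smul_mono h) (act g α U x) := by
  have : act g α V ∘ₗ map h = map (g.smul_mono h) ∘ₗ act g α U := hom_ext fun L hL x => by
    rw [LinearMap.comp_apply, LinearMap.comp_apply, map_of, act_of, act_of, map_of]
  exact LinearMap.congr_fun this x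

theorem act_mul (g h : RotTrans) (α β : A →ₐ[ℂ] A) (U : Opens ℂ) (x : FLocObj A U) :
    map (mul_smul g h U).le (act (g * h) (α.comp β) U x) = act g α (h • U) (act h β U x) := by
  have : map (mul_smul g h U).le ∘ₗ act (g * h) (α.comp β) U = act g α (h • U) ∘ₗ act h β U :=
    hom_ext fun L hL x => by
      have h1 := AlgHom.congr_fun (tensorMap_comp (moveDisc (g * h) L)
        (parent (move_mul_le g h L)) (α.comp β) (AlgHom.id ℂ A)) x
      have h2 := AlgHom.congr_fun (tensorMap_comp (moveDisc h L) (moveDisc g (move h L)) β α) x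
      rw [parent_move_mul, AlgHom.id_comp] at h1
      have h3 : extMap (move_mul_le g h L) (moveMap (g * h) (α.comp β) L x) =
          moveMap g α (move h L) (moveMap h β L x) := h1.trans h2.symm
      rw [LinearMap.comp_apply, LinearMap.comp_apply, act_of, act_of, act_of, map_of, ← h3,
        of_extMap]
  exact LinearMap.congr_fun this x

theorem act_one (U : Opens ℂ) (x : FLocObj A U) :
    map (one_smul RotTrans U).le (act 1 (AlgHom.id ℂ A) U x) = x := by
  have : map (one_smul RotTrans U).le ∘ₗ act 1 (AlgHom.id ℂ A) U = LinearMap.id :=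
    hom_ext fun L hL x => by
      have h1 := AlgHom.congr_fun (tensorMap_comp (moveDisc 1 L)
        (parent (move_one_le L)) (AlgHom.id ℂ A) (AlgHom.id ℂ A)) x
      rw [parent_move_one, AlgHom.id_comp, tensorMap_id] at h1
      have h3 : extMap (move_one_le L) (moveMap 1 (AlgHom.id ℂ A) L x) = x := h1
      rw [LinearMap.comp_apply, act_of, map_of, LinearMap.id_apply, ← of_extMap (move_one_le L) hL,
        h3]
  exact LinearMap.congr_fun this x

theorem act_mul_apply (g : RotTrans) (α : A →ₐ[ℂ] A) {U V W : Opens ℂ} (d : Disjoint U V)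
    (hU : U ≤ W) (hV : V ≤ W) (x : FLocObj A U) (y : FLocObj A V) :
    act g α W (mul d hU hV x y) = mul (g.smul_disjoint d) (g.smul_mono hU) (g.smul_mono hV)
      (act g α U x) (act g α V y) := by
  have : (mul d hU hV).compr₂ (act g α W) =
      (mul (g.smul_disjoint d) (g.smul_mono hU) (g.smul_mono hV)).compl₁₂
        (act g α U) (act g α V) :=
    hom_ext₂ fun L hL x M hM y => by
      rw [LinearMap.compr₂_apply, LinearMap.compl₁₂_apply, mul_of_union, act_of, act_of, act_of,
        mul_of _ _ _ (move g L) (move g M) (move g (union L M (d.mono hL hM))) _ _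
          (move_mono g (left_le_union _ _ _)) (move_mono g (right_le_union _ _ _))
          (move_le g (union_le (hL.trans hU) (hM.trans hV))),
        extMap_moveMap, extMap_moveMap, map_mul]
  exact LinearMap.congr_fun₂ this x y

theorem act_unit (g : RotTrans) (α : A →ₐ[ℂ] A) : act g α ⊥ (one A) = map bot_le (one A) := by
  rw [one, act_of, map_of, map_one (moveMap g α empty),
    ← of_extMap (empty_le _) (move_le g (empty_le ⊥)), map_one (extMap _)]

theorem tensorMap_extMap {B : Type u} [CommRing B] [Algebra ℂ B] (α : A →ₐ[ℂ] B)
    {L M : DiskConfig} (h : L.toOpens ≤ M.toOpens) (x : FDisk A L) :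
    tensorMap id α (extMap h x) = extMap h (tensorMap id α x) := by
  have h1 := AlgHom.congr_fun (tensorMap_comp (parent h) id (AlgHom.id ℂ A) α) x
  have h2 := AlgHom.congr_fun (tensorMap_comp id (parent h) α (AlgHom.id ℂ B)) x
  rw [AlgHom.comp_id, Function.id_comp] at h1
  rw [AlgHom.id_comp, Function.comp_id] at h2
  exact h1.trans h2.symm

/-- The map `𝐅^loc_A(U) → 𝐅^loc_B(U)` which applies a morphism to each tensor factor. -/
def mapAlg {B : Type u} [CommRing B] [Algebra ℂ B] (α : A →ₐ[ℂ] B) (U : Opens ℂ) :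
    FLocObj A U →ₗ[ℂ] FLocObj B U :=
  lift (fun L hL => of L hL ∘ₗ (tensorMap (id : L.discs → L.discs) α).toLinearMap)
    fun L M h hM x => by
      change of _ _ (tensorMap id α (extMap h x)) = of _ _ (tensorMap id α x)
      rw [tensorMap_extMap, of_extMap]

theorem mapAlg_of {B : Type u} [CommRing B] [Algebra ℂ B] (α : A →ₐ[ℂ] B) (U : Opens ℂ)
    (L : DiskConfig) (hL : L.toOpens ≤ U) (x : FDisk A L) :
    mapAlg α U (of L hL x) = of L hL (tensorMap (id : L.discs → L.discs) α x) :=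
  lift_of _ _ L hL x

theorem continuous_mapAlg {B : Type u} [CommRing B] [Algebra ℂ B] [TopologicalSpace A]
    [TopologicalSpace B] [ContinuousMul B] (α : A →ₐ[ℂ] B) (hα : Continuous α) (U : Opens ℂ) :
    Continuous (mapAlg α U) :=
  continuous_dom _ fun L hL => by
    simp only [mapAlg_of]
    exact (continuous_of _ _).comp (continuous_tensorMap _ _ hα)

end FLocObj

open FLocObj

/-- The equivariant prefactorization algebra `𝐅^loc_A` of a topological commutative algebra `A` with
a continuous action `ρ` of `S¹ ⋉ ℂ` by algebra automorphisms. -/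
def FLoc (A : Type u) [CommRing A] [Algebra ℂ A] [TopologicalSpace A] [ContinuousMul A]
    (ρ : RotTrans → A →ₐ[ℂ] A) (hρ : ∀ g, Continuous (ρ g)) (hone : ρ 1 = AlgHom.id ℂ A)
    (hmul : ∀ g h, ρ (g * h) = (ρ g).comp (ρ h)) : EquivariantPFA.{u} where
  obj := FLocObj A
  map h := ⟨FLocObj.map h, continuous_map h⟩
  map_id := FLocObj.map_id
  map_map := FLocObj.map_map
  mul := FLocObj.mul
  continuous_mul_left d hU hV x := continuous_mul_of d hU hV x
  continuous_mul_right d hU hV y := by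
    simp only [FLocObj.mul_comm d]
    exact continuous_mul_of d.symm hV hU y
  map_mul := FLocObj.map_mul_of
  mul_map := FLocObj.mul_map
  mul_comm := FLocObj.mul_comm
  mul_assoc := FLocObj.mul_assoc
  one := FLocObj.one A
  one_mul := FLocObj.one_mul
  act g U := ⟨FLocObj.act g (ρ g) U, continuous_act g (ρ g) (hρ g) U⟩
  act_map g := FLocObj.act_map g (ρ g)
  act_mul g h U x := by
    change FLocObj.map (mul_smul g h U).le (FLocObj.act (g * h) (ρ (g * h)) U x) =
      FLocObj.act g (ρ g) (h • U) (FLocObj.act h (ρ h) U x)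
    rw [hmul]
    exact FLocObj.act_mul g h (ρ g) (ρ h) U x
  act_one U x := by
    change FLocObj.map (one_smul RotTrans U).le (FLocObj.act 1 (ρ 1) U x) = x
    rw [hone]
    exact FLocObj.act_one U x
  act_mul_apply g := FLocObj.act_mul_apply g (ρ g)
  act_unit g := FLocObj.act_unit g (ρ g)

/-- The morphism of equivariant prefactorization algebras induced by an equivariant continuous
morphism of algebras. -/
def FLocHom {A B : Type u} [CommRing A] [Algebra ℂ A] [TopologicalSpace A] [ContinuousMul A]
    [CommRing B] [Algebra ℂ B] [TopologicalSpace B] [ContinuousMul B]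
    {ρ : RotTrans → A →ₐ[ℂ] A} {hρ : ∀ g, Continuous (ρ g)} {hone : ρ 1 = AlgHom.id ℂ A}
    {hmul : ∀ g h, ρ (g * h) = (ρ g).comp (ρ h)}
    {τ : RotTrans → B →ₐ[ℂ] B} {hτ : ∀ g, Continuous (τ g)} {hone' : τ 1 = AlgHom.id ℂ B}
    {hmul' : ∀ g h, τ (g * h) = (τ g).comp (τ h)}
    (α : A →ₐ[ℂ] B) (hα : Continuous α) (hαρ : ∀ g, α.comp (ρ g) = (τ g).comp α) :
    EquivariantPFA.Hom (FLoc A ρ hρ hone hmul) (FLoc B τ hτ hone' hmul') where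
  app U := ⟨mapAlg α U, continuous_mapAlg α hα U⟩
  app_map {U V} h x := by
    have : mapAlg α V ∘ₗ FLocObj.map h = FLocObj.map h ∘ₗ mapAlg α U := hom_ext fun L hL x => by
      rw [LinearMap.comp_apply, LinearMap.comp_apply, map_of, mapAlg_of, mapAlg_of, map_of]
    exact LinearMap.congr_fun this x
  app_mul {U V W} d hU hV x y := by
    have : (FLocObj.mul d hU hV).compr₂ (mapAlg α W) =
        (FLocObj.mul d hU hV).compl₁₂ (mapAlg α U) (mapAlg α V) :=
      hom_ext₂ fun L hL x M hM y => by
        rw [LinearMap.compr₂_apply, LinearMap.compl₁₂_apply, mul_of_union, mapAlg_of, mapAlg_of,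
          mapAlg_of, mul_of_union, map_mul, tensorMap_extMap, tensorMap_extMap]
    exact LinearMap.congr_fun₂ this x y
  app_one := by
    change mapAlg α ⊥ (FLocObj.one A) = FLocObj.one B
    rw [FLocObj.one, mapAlg_of, map_one (tensorMap _ α)]
    rfl
  app_act g U x := by
    have : mapAlg α (g • U) ∘ₗ FLocObj.act g (ρ g) U = FLocObj.act g (τ g) U ∘ₗ mapAlg α U :=
      hom_ext fun L hL x => by
        rw [LinearMap.comp_apply, LinearMap.comp_apply, act_of, mapAlg_of, mapAlg_of, act_of]
        have h1 := AlgHom.congr_fun (tensorMap_comp (moveDisc g L) id (ρ g) α) x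
        have h2 := AlgHom.congr_fun (tensorMap_comp id (moveDisc g L) α (τ g)) x
        rw [Function.id_comp, hαρ] at h1
        rw [Function.comp_id] at h2
        exact congrArg _ (h1.trans h2.symm)
    exact LinearMap.congr_fun this x

/-- The canonical map `A = F^loc_A(D_r(z)) → 𝐅^loc_A(D_r(z))`. -/
def discMap (A : Type u) [CommRing A] [Algebra ℂ A] (z : ℂ) (r : ℝ) (hr : 0 < r) :
    A →ₗ[ℂ] FLocObj A (disc z r) :=
  FLocObj.of (single z r hr) (single_le z r hr) ∘ₗ
    (PiTensorProduct.singleAlgHom (R := ℂ) (A := fun _ : (single z r hr).discs => A)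
      ⟨(z, r), Finset.mem_singleton_self (z, r)⟩).toLinearMap

end FLoc

section DiscMap

open DiskConfig FLocObj

variable {A : Type u} [CommRing A] [Algebra ℂ A]

theorem le_single (z : ℂ) (r : ℝ) (hr : 0 < r) : disc z r ≤ (single z r hr).toOpens :=
  (single z r hr).disc_le ⟨(z, r), Finset.mem_singleton_self (z, r)⟩

theorem of_singleAlgHom (z : ℂ) (r : ℝ) (hr : 0 < r) (L : DiskConfig) (h : L.toOpens ≤ disc z r)
    (d : L.discs) (a : A) :
    FLocObj.of L h (PiTensorProduct.singleAlgHom (R := ℂ) (A := fun _ : L.discs => A) d a) =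
      discMap A z r hr a := by
  have hL : L.toOpens ≤ (single z r hr).toOpens := h.trans (le_single z r hr)
  rw [← of_extMap hL (single_le z r hr), extMap, tensorMap_single]
  have : parent hL d = ⟨(z, r), Finset.mem_singleton_self (z, r)⟩ :=
    Subtype.ext (Finset.mem_singleton.1 (parent hL d).2)
  rw [this]
  rfl

theorem map_discMap (z : ℂ) {r R : ℝ} (hr : 0 < r) (hR : 0 < R) (h : disc z r ≤ disc z R) (a : A) :
    FLocObj.map h (discMap A z r hr a) = discMap A z R hR a := by
  rw [← of_singleAlgHom z R hR (single z r hr) ((single_le z r hr).trans h)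
    ⟨(z, r), Finset.mem_singleton_self (z, r)⟩, discMap, LinearMap.comp_apply, map_of]
  rfl

theorem act_discMap (g : RotTrans) (α : A →ₐ[ℂ] A) (z w : ℂ) {r : ℝ} (hr : 0 < r)
    (h : g • disc z r ≤ disc w r) (a : A) :
    FLocObj.map h (FLocObj.act g α (disc z r) (discMap A z r hr a)) = discMap A w r hr (α a) := by
  rw [discMap, LinearMap.comp_apply, act_of, map_of, moveMap]
  change FLocObj.of _ _ (tensorMap (moveDisc g (single z r hr)) α
    (PiTensorProduct.singleAlgHom (R := ℂ) (A := fun _ : (single z r hr).discs => A) _ a)) = _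
  rw [tensorMap_single]
  exact of_singleAlgHom w r hr _ _ _ _

end DiscMap

namespace GrComVA

variable (V : GrComVA.{u})

/-- The equivariant prefactorization algebra `𝐅^loc` of the completion of `V`, on which
`(q, z) ∈ S¹ ⋉ ℂ` acts by `e ^ (zT) q ^ L_0`. -/
noncomputable def pfa : EquivariantPFA.{u} :=
  FLoc V.Completion (fun g => Completion.action g.rot g.trans)
    (fun g => Completion.continuous_action g.rot g.trans) Completion.action_one
    fun g h => Completion.action_mul g.rot h.rot g.trans h.trans

variable {V} in
/-- The morphism `V.pfa → W.pfa` induced by a morphism of graded vertex algebras. -/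
noncomputable def pfaHom {W : GrComVA.{u}} {f : (⨁ Δ, V.wt Δ) →ₗ[ℂ] ⨁ Δ, W.wt Δ}
    (hf : GradedVertexAlgebra.IsHom V.va W.va f) : EquivariantPFA.Hom V.pfa W.pfa :=
  FLocHom (Completion.bar hf) (Completion.continuous_bar hf)
    fun g => Completion.bar_action hf g.rot g.trans

theorem rotate_discMap (q : Circle) {R : ℝ} (hR : 0 < R) (a : V.Completion) :
    V.pfa.rotate q R (discMap V.Completion 0 R hR a) =
      discMap V.Completion 0 R hR (Completion.rot q a) := by
  have := act_discMap (RotTrans.ofRot q) (Completion.action q 0) 0 0 hR (rot_disc_le q R) a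
  rw [Completion.action_apply, Completion.expT_zero] at this
  exact this

/-- The canonical map from `V_Δ` to the weight space of the costalk at `0`: the component at `R` is
the canonical map from the completion of `V` to `V.pfa.obj (disc 0 R)`. -/
noncomputable def etaWeight (Δ : ℤ) : V.wt Δ →ₗ[ℂ] V.pfa.costalkWeight Δ where
  toFun x := ⟨⟨fun R => discMap V.Completion 0 R R.2 (Completion.single V Δ x),
      fun r R h => map_discMap 0 r.2 R.2 (disc_mono 0 h) _⟩, fun R q => by
      refine (V.rotate_discMap q R.2 (Completion.single V Δ x)).trans ?_
      refine Eq.trans ?_ (map_smul (discMap V.Completion 0 R R.2) ((q : ℂ) ^ Δ) _)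
      refine congrArg _ (Completion.ext fun Δ' => ?_)
      rw [Completion.coord_rot, Completion.coord_smul]
      by_cases h : Δ' = Δ
      · rw [h]
      · rw [Completion.single_ne h, smul_zero, smul_zero]⟩
  map_add' x y := Subtype.ext (Subtype.ext (funext fun R =>
    map_add (discMap V.Completion 0 R R.2 ∘ₗ Completion.single V Δ) x y))
  map_smul' c x := Subtype.ext (Subtype.ext (funext fun R =>
    map_smul (discMap V.Completion 0 R R.2 ∘ₗ Completion.single V Δ) c x))

/-- The canonical map `η_V : V → V(𝐅^loc)`. -/
noncomputable def eta : (⨁ Δ, V.wt Δ) →ₗ[ℂ] V.pfa.StateSpace :=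
  DirectSum.toModule ℂ ℤ _ fun Δ =>
    DirectSum.lof ℂ ℤ (fun Δ => V.pfa.costalkWeight Δ) Δ ∘ₗ V.etaWeight Δ

end GrComVA

/-! Among the disc configurations inside a disc, the disc itself is the greatest, so the inductive
limit defining `𝐅^loc` is attained there: on every disc it is the completion `V̄`, also as a
topological vector space (`discEquiv`). The inverse of the canonical map multiplies all tensor
factors. This map, `counit`, exists on every open set, does not change under extension maps, sends
prefactorization products and the unit to those of `V̄`, and turns `σ_(q,z)` into `e^(zT) q^(L_0)`
(`counit_map`, `counit_mul`, `counit_one`, `counit_act`). Every question about discs thereby becomes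
a computation in the commutative algebra `V̄`.

Since `V̄` is a product of finite-dimensional spaces, the values on discs are Hausdorff and
complete. The characters `q^Δ` of the circle are distinct, so the weight spaces are copies of the
`V_Δ`, for every radius (`mem_weightSpace_iff`). Multiplying translated elements gives
`μ_(z_1,…,z_l)(a_1 ⊗ ⋯ ⊗ a_l) = ∏ e^(z_i T) a_i` (`mu_pfa`). As the weights are bounded below, each
component of `e^(zT) a` is a polynomial in `z`, and each component of a product is a finite sum; so
`μ` is holomorphic and even extends over the diagonals.

In a commutative vertex algebra, `a_(n) b = 0` for `n ≥ 0` and `a_(-k-1) b = (T^k a) b / k!`, whence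
`Y(a,z) b = (e^(zT) a) b` (`hasSum_expT_mul`). This is the two-point `μ`, so the structure of `V`,
transported along `η`, satisfies the required formulas. No other structure does: `|0⟩` and `T` are
determined because evaluation at one radius is injective and limits are unique, and the grading
isolates each `a_(n) b` as the only term of its weight (`stateValue_nprod`). Naturality holds
because, read in the completions, `η` is the inclusion of the direct sum in the product and the
induced morphism is `f̄`. -/

/-! ### The value of `𝐅^loc` on a disc. -/

section Counit

open DiskConfig FLocObj PiTensorProduct

variable {A : Type u} [CommRing A] [Algebra ℂ A]

/-- The multiplication map from a tensor power of `A` to `A`. -/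
noncomputable def tensorProd (ι : Type) [Fintype ι] (A : Type u) [CommRing A] [Algebra ℂ A] :
    TensorPow ι A →ₐ[ℂ] A :=
  liftAlgHom (MultilinearMap.mkPiAlgebra ℂ ι A) (by simp)
    (fun x y => by simp [Finset.prod_mul_distrib])

theorem tensorProd_tprod {ι : Type} [Fintype ι] (a : ι → A) :
    tensorProd ι A (tprod ℂ a) = ∏ i, a i :=
  lift.tprod (φ := MultilinearMap.mkPiAlgebra ℂ ι A) a

theorem tensorProd_single {ι : Type} [Fintype ι] [DecidableEq ι] (i : ι) (a : A) :
    tensorProd ι A (singleAlgHom (R := ℂ) (A := fun _ : ι => A) i a) = a := by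
  rw [singleAlgHom_apply, tensorProd_tprod, Finset.prod_eq_single i]
  · rw [MonoidHom.mulSingle_apply, Pi.mulSingle_eq_same]
  · intro k _ hk
    rw [MonoidHom.mulSingle_apply, Pi.mulSingle_eq_of_ne hk]
  · exact fun h => absurd (Finset.mem_univ i) h

/-- Both sides are algebra morphisms, so one tensor factor at a time suffices. With `α = id` this
makes the multiplication maps a cocone over the extension maps; general `α` covers motions and
induced morphisms. -/
theorem tensorProd_tensorMap {B : Type u} [CommRing B] [Algebra ℂ B] {ι κ : Type} [Fintype ι]
    [Fintype κ] [DecidableEq ι] [DecidableEq κ] (f : ι → κ) (α : A →ₐ[ℂ] B)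
    (x : TensorPow ι A) :
    tensorProd κ B (tensorMap f α x) = α (tensorProd ι A x) := by
  have : (tensorProd κ B).comp (tensorMap f α) = α.comp (tensorProd ι A) :=
    algHom_ext fun i => AlgHom.ext fun a => by
      simp only [AlgHom.comp_apply, tensorMap_single, tensorProd_single]
  exact AlgHom.congr_fun this x

/-- Local convexity of `A` is essential: the projective topology is universal only for locally
convex targets. -/
theorem continuous_tensorProd {ι : Type} [Fintype ι] [TopologicalSpace A] [ContinuousMul A]
    [IsTopologicalAddGroup A] [ContinuousSMul ℂ A] [LocallyConvexSpace ℝ A] :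
    Continuous (tensorProd ι A) := by
  refine continuous_of_tprod (tensorProd ι A).toLinearMap ?_
  change Continuous fun a : ι → A => tensorProd ι A (tprod ℂ a)
  simp only [tensorProd_tprod]
  exact continuous_finsetProd _ fun i _ => continuous_apply i

namespace FLocObj

/-- The map `𝐅^loc_A(U) → A` that multiplies all tensor factors. -/
noncomputable def counit (U : Opens ℂ) : FLocObj A U →ₗ[ℂ] A :=
  lift (fun L _ => (tensorProd L.discs A).toLinearMap)
    fun _ _ _ _ x => tensorProd_tensorMap _ _ x

theorem counit_of {U : Opens ℂ} (L : DiskConfig) (h : L.toOpens ≤ U) (x : FDisk A L) :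
    counit U (of L h x) = tensorProd L.discs A x := lift_of _ _ L h x

theorem continuous_counit [TopologicalSpace A] [ContinuousMul A]
    [IsTopologicalAddGroup A] [ContinuousSMul ℂ A] [LocallyConvexSpace ℝ A] (U : Opens ℂ) :
    Continuous (counit (A := A) U) :=
  continuous_dom _ fun L h => by
    simp only [counit_of]
    exact continuous_tensorProd

theorem counit_map {U W : Opens ℂ} (h : U ≤ W) (x : FLocObj A U) :
    counit W (map h x) = counit U x := by
  have : counit (A := A) W ∘ₗ map h = counit U := hom_ext fun L hL x => by
    rw [LinearMap.comp_apply, map_of, counit_of, counit_of]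
  exact LinearMap.congr_fun this x

/-- On configurations, both sides multiply all factors of `L` and `M` together: passing to the union
first does not affect the total product. -/
theorem counit_mul {U V W : Opens ℂ} (d : Disjoint U V) (hU : U ≤ W) (hV : V ≤ W)
    (x : FLocObj A U) (y : FLocObj A V) :
    counit W (mul d hU hV x y) = counit U x * counit V y := by
  have : (mul (A := A) d hU hV).compr₂ (counit W) =
      (LinearMap.mul ℂ A).compl₁₂ (counit U) (counit V) :=
    hom_ext₂ fun L hL x M hM y => by
      rw [LinearMap.compr₂_apply, LinearMap.compl₁₂_apply, mul_of_union, counit_of, counit_of,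
        counit_of, map_mul, LinearMap.mul_apply', extMap, extMap, tensorProd_tensorMap,
        tensorProd_tensorMap]
      rfl
  exact LinearMap.congr_fun₂ this x y

theorem counit_one : counit ⊥ (one A) = 1 := by rw [one, counit_of, _root_.map_one]

theorem counit_act (g : RotTrans) (α : A →ₐ[ℂ] A) (U : Opens ℂ) (x : FLocObj A U) :
    counit (g • U) (act g α U x) = α (counit U x) := by
  have : counit (g • U) ∘ₗ act g α U = α.toLinearMap ∘ₗ counit U := hom_ext fun L hL x => by
    rw [LinearMap.comp_apply, LinearMap.comp_apply, act_of, counit_of, counit_of]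
    exact tensorProd_tensorMap _ _ x
  exact LinearMap.congr_fun this x

theorem counit_mapAlg {B : Type u} [CommRing B] [Algebra ℂ B]
    (α : A →ₐ[ℂ] B) (U : Opens ℂ) (x : FLocObj A U) :
    counit U (mapAlg α U x) = α (counit U x) := by
  have : counit U ∘ₗ mapAlg α U = α.toLinearMap ∘ₗ counit U :=
    hom_ext fun L hL x => by
      rw [LinearMap.comp_apply, LinearMap.comp_apply, mapAlg_of, counit_of,
        counit_of]
      exact tensorProd_tensorMap _ _ x
  exact LinearMap.congr_fun this x

end FLocObj

theorem counit_discMap (z : ℂ) {r : ℝ} (hr : 0 < r) (a : A) :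
    counit (disc z r) (discMap A z r hr a) = a := by
  rw [discMap, LinearMap.comp_apply, counit_of]
  exact tensorProd_single _ a

/-- The configuration consisting of the whole disc is terminal among those inside it. Hence every
element of the limit comes from there, and the extension map to it is multiplication of all factors.
-/
theorem discMap_counit (z : ℂ) {r : ℝ} (hr : 0 < r) (x : FLocObj A (disc z r)) :
    discMap A z r hr (counit (disc z r) x) = x := by
  have : discMap A z r hr ∘ₗ counit (disc z r) = LinearMap.id := hom_ext fun L hL x => by
    have hL' : L.toOpens ≤ (single z r hr).toOpens := hL.trans (le_single z r hr)
    rw [LinearMap.comp_apply, counit_of, LinearMap.id_apply, ← of_extMap hL' (single_le z r hr),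
      discMap, LinearMap.comp_apply]
    congr 1
    -- An equality of algebra morphisms, tested on each single factor; the parent of every disc is
    -- forced, since only one disc is available.
    have h2 : (singleAlgHom (R := ℂ) (A := fun _ : (single z r hr).discs => A)
        ⟨(z, r), Finset.mem_singleton_self (z, r)⟩).comp (tensorProd L.discs A) =
          extMap hL' :=
      algHom_ext fun d => AlgHom.ext fun a => by
        rw [AlgHom.comp_apply, AlgHom.comp_apply, AlgHom.comp_apply, tensorProd_single, extMap,
          tensorMap_single, parent_eq hL' d ⟨(z, r), Finset.mem_singleton_self (z, r)⟩ ((L.disc_le d).trans hL),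
          AlgHom.id_apply]
    exact AlgHom.congr_fun h2 x
  exact LinearMap.congr_fun this x

theorem continuous_discMap [TopologicalSpace A] (z : ℂ) {r : ℝ} (hr : 0 < r) :
    Continuous (discMap A z r hr) := by
  refine (continuous_of (single z r hr) (single_le z r hr)).comp ?_
  refine continuous_tprod.comp (continuous_pi fun j => ?_)
  -- With only one index, the family supported there is the constant family `a`, and continuity of
  -- `tprod` applies.
  have : ∀ a : A, MonoidHom.mulSingle (fun _ : (single z r hr).discs => A)
      ⟨(z, r), Finset.mem_singleton_self (z, r)⟩ a j = a := fun a => by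
    have h : j = ⟨(z, r), Finset.mem_singleton_self (z, r)⟩ :=
      Subtype.ext (Finset.mem_singleton.1 j.2)
    rw [h, MonoidHom.mulSingle_apply, Pi.mulSingle_eq_same]
  simp only [this]
  exact continuous_id

/-- The value of `𝐅^loc_A` on a disc is `A`. -/
noncomputable def discEquiv [TopologicalSpace A] [ContinuousMul A]
    [IsTopologicalAddGroup A] [ContinuousSMul ℂ A] [LocallyConvexSpace ℝ A]
    (z : ℂ) {r : ℝ} (hr : 0 < r) : A ≃L[ℂ] FLocObj A (disc z r) where
  __ := discMap A z r hr
  invFun := counit (disc z r)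
  left_inv := counit_discMap z hr
  right_inv := discMap_counit z hr
  continuous_toFun := continuous_discMap z hr
  continuous_invFun := continuous_counit _

end Counit

/-! ### Topology of the completion and of the values on discs. -/

namespace GrComVA

variable (V : GrComVA.{u})

/-- Coordinates on a weight space. -/
noncomputable def wtEquiv (Δ : ℤ) : V.wt Δ ≃L[ℂ] (Fin (Module.finrank ℂ (V.wt Δ)) → ℂ) where
  __ := (Module.finBasis ℂ (V.wt Δ)).equivFun
  continuous_toFun := IsModuleTopology.continuous_of_linearMap
    (Module.finBasis ℂ (V.wt Δ)).equivFun.toLinearMap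
  continuous_invFun := LinearMap.continuous_of_finiteDimensional
    (Module.finBasis ℂ (V.wt Δ)).equivFun.symm.toLinearMap

/-- Coordinates on the completion. -/
noncomputable def completionEquiv :
    V.Completion ≃L[ℂ] ∀ Δ, Fin (Module.finrank ℂ (V.wt Δ)) → ℂ :=
  ContinuousLinearEquiv.piCongrRight (M := V.wt) fun Δ => V.wtEquiv Δ

/-- The topology is pulled back from a product of spaces `ℂ^n` along a linear map. This makes the
completion an admissible target for `counit`, hence supplies `discEquiv` for it. -/
instance : LocallyConvexSpace ℝ V.Completion := by
  rw [V.completionEquiv.toHomeomorph.isInducing.eq_induced]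
  exact LocallyConvexSpace.induced (V.completionEquiv.toLinearMap.restrictScalars ℝ)

/-- The value of `V.pfa` on a disc is the completion of `V`. -/
noncomputable def pfaEquiv (z : ℂ) {R : ℝ} (hR : 0 < R) :
    V.Completion ≃L[ℂ] V.pfa.obj (disc z R) :=
  discEquiv z hR

theorem t2Space_pfa {R : ℝ} (hR : 0 < R) : T2Space (V.pfa.obj (disc 0 R)) :=
  (V.pfaEquiv 0 hR).toHomeomorph.t2Space

/-- For commutative groups a continuous linear equivalence is automatically uniform in both
directions, so completeness passes from `F` to `E`. -/
theorem completeSpace_of_continuousLinearEquiv {E F : Type*} [AddCommGroup E] [Module ℂ E]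
    [TopologicalSpace E] [IsTopologicalAddGroup E] [AddCommGroup F] [Module ℂ F] [UniformSpace F]
    [IsUniformAddGroup F] [CompleteSpace F] (e : E ≃L[ℂ] F) :
    letI : UniformSpace E := IsTopologicalAddGroup.rightUniformSpace E
    CompleteSpace E := by
  let _ : UniformSpace E := IsTopologicalAddGroup.rightUniformSpace E
  have : IsUniformAddGroup E := isUniformAddGroup_of_addCommGroup
  exact (completeSpace_congr (e := e.toEquiv) e.isUniformEmbedding).2 inferInstance

theorem quasiComplete_pfa {R : ℝ} (hR : 0 < R) :
    letI : UniformSpace (V.pfa.obj (disc 0 R)) := IsTopologicalAddGroup.rightUniformSpace _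
    QuasiCompleteSpace ℂ (V.pfa.obj (disc 0 R)) := by
  let _ : UniformSpace (V.pfa.obj (disc 0 R)) := IsTopologicalAddGroup.rightUniformSpace _
  -- The comparison goes all the way to a product of spaces `ℂ^n`, which carries a uniform structure
  -- of its own and is complete.
  have := completeSpace_of_continuousLinearEquiv ((V.pfaEquiv 0 hR).symm.trans V.completionEquiv)
  infer_instance

end GrComVA

/-! ### Products of insertions and weight spaces, computed in the completion. -/

namespace EquivariantPFA

/-- Containment and disjointness amount to finitely many inequalities in `r`, each valid for all
small positive `r`. -/
theorem exists_admissible {l : ℕ} {R : ℝ} {z : Fin l → ℂ} (hz : z ∈ conf l R) :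
    ∃ r, Admissible R z r := by
  have h1 : ∀ᶠ r : ℝ in 𝓝[>] 0, ∀ i, r + dist (z i) 0 ≤ R :=
    Filter.eventually_all.2 fun i => by
      have : (0 : ℝ) < R - dist (z i) 0 := sub_pos.2 (hz.2 i)
      filter_upwards [Ioo_mem_nhdsGT this] with r hr
      linarith [hr.2]
  have h2 : ∀ᶠ r : ℝ in 𝓝[>] 0, ∀ i j, i ≠ j → r + r ≤ dist (z i) (z j) :=
    Filter.eventually_all.2 fun i => Filter.eventually_all.2 fun j => by
      by_cases hij : i = j
      · exact Filter.Eventually.of_forall fun r h => absurd hij h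
      have : (0 : ℝ) < dist (z i) (z j) / 2 := half_pos (dist_pos.2 fun h => hij (hz.1 h))
      filter_upwards [Ioo_mem_nhdsGT this] with r hr _
      linarith [hr.2]
  obtain ⟨r, h1, h2, h3⟩ := (h1.and (h2.and self_mem_nhdsWithin)).exists
  exact ⟨⟨r, h3⟩, fun i j hij => Opens.coe_disjoint.1 (Metric.ball_disjoint_ball (h2 i j hij)),
    fun i => Metric.ball_subset_ball' (h1 i)⟩

end EquivariantPFA

namespace GrComVA

open EquivariantPFA

variable (V : GrComVA.{u})

/-- The map `V.pfa.obj U → V.Completion` that multiplies all tensor factors. -/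
noncomputable def pfaCounit (U : Opens ℂ) : V.pfa.obj U →ₗ[ℂ] V.Completion := FLocObj.counit U

theorem pfaEquiv_symm_apply (z : ℂ) {R : ℝ} (hR : 0 < R) (x : V.pfa.obj (disc z R)) :
    (V.pfaEquiv z hR).symm x = V.pfaCounit (disc z R) x := rfl

theorem pfaCounit_map {U W : Opens ℂ} (h : U ≤ W) (x : V.pfa.obj U) :
    V.pfaCounit W (V.pfa.map h x) = V.pfaCounit U x := FLocObj.counit_map h x

theorem pfaCounit_mul {U U' W : Opens ℂ} (d : Disjoint U U') (hU : U ≤ W) (hU' : U' ≤ W)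
    (x : V.pfa.obj U) (y : V.pfa.obj U') :
    V.pfaCounit W (V.pfa.mul d hU hU' x y) = V.pfaCounit U x * V.pfaCounit U' y :=
  FLocObj.counit_mul d hU hU' x y

theorem pfaCounit_one : V.pfaCounit ⊥ V.pfa.one = 1 := FLocObj.counit_one

theorem pfaCounit_act (g : RotTrans) (U : Opens ℂ) (x : V.pfa.obj U) :
    V.pfaCounit (g • U) (V.pfa.act g U x) =
      Completion.expT g.trans (Completion.rot g.rot (V.pfaCounit U x)) :=
  FLocObj.counit_act g (Completion.action g.rot g.trans) U x

theorem pfaCounit_multi (n : ℕ) (U : Fin n → Opens ℂ) (W : Opens ℂ)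
    (d : ∀ i j, i ≠ j → Disjoint (U i) (U j)) (h : ∀ i, U i ≤ W) (x : ∀ i, V.pfa.obj (U i)) :
    V.pfaCounit W (V.pfa.multi n U W d h x) = ∏ i, V.pfaCounit (U i) (x i) := by
  induction n generalizing W with
  | zero => rw [multi, pfaCounit_map, pfaCounit_one, Fin.prod_univ_zero]
  | succ n ih => rw [multi, pfaCounit_mul, ih, Fin.prod_univ_castSucc]

/-- The element of the completion that corresponds to an element of the costalk. -/
noncomputable def costalkValue : V.pfa.costalk →ₗ[ℂ] V.Completion :=
  V.pfaCounit (disc 0 1) ∘ₗ LinearMap.proj (⟨1, Set.mem_Ioi.2 one_pos⟩ : Set.Ioi (0 : ℝ)) ∘ₗ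
    V.pfa.costalk.subtype

/-- Extension maps do not change the total product, so the radius `1` in `costalkValue` is an
arbitrary choice. -/
theorem pfaCounit_costalk (a : V.pfa.costalk) (R : Set.Ioi (0 : ℝ)) :
    V.pfaCounit (disc 0 R) (a.1 R) = V.costalkValue a := by
  change _ = V.pfaCounit (disc 0 1) (a.1 ⟨1, Set.mem_Ioi.2 one_pos⟩)
  rcases le_total R ⟨1, Set.mem_Ioi.2 one_pos⟩ with h | h
  · rw [← a.2 _ _ h, pfaCounit_map]
  · rw [← a.2 _ _ h, pfaCounit_map]

theorem costalk_apply (a : V.pfa.costalk) (R : Set.Ioi (0 : ℝ)) :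
    a.1 R = V.pfaEquiv 0 R.2 (V.costalkValue a) := by
  rw [← pfaCounit_costalk _ a R, ← V.pfaEquiv_symm_apply 0 R.2,
    ContinuousLinearEquiv.apply_symm_apply]

theorem costalkValue_injective : Function.Injective V.costalkValue := fun a b h =>
  Subtype.ext (funext fun R => by rw [costalk_apply, costalk_apply, h])

theorem pfaCounit_translate (z : ℂ) (r : Set.Ioi (0 : ℝ)) (a : V.pfa.costalk) :
    V.pfaCounit (disc z r) (V.pfa.translate z r a) = Completion.expT z (V.costalkValue a) := by
  rw [EquivariantPFA.translate, pfaCounit_map, pfaCounit_act, pfaCounit_costalk]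
  exact congrArg _ (Completion.one_rot _)

/-- The counit turns insertion into disjoint discs into multiplication in the completion, and
translation by `z_i` into `e^(z_i T)`. The right-hand side makes sense for all `z`, coincident
points included, which gives holomorphy and the absence of poles. -/
theorem mu_pfa {l : ℕ} {R : ℝ} (hR : 0 < R) {z : Fin l → ℂ} (hz : z ∈ conf l R)
    (a : Fin l → V.pfa.costalk) :
    V.pfa.mu R z a =
      V.pfaEquiv 0 hR (∏ i, Completion.expT (z i) (V.costalkValue (a i))) := by
  obtain ⟨r, hr⟩ := exists_admissible hz
  rw [← ContinuousLinearEquiv.symm_apply_eq, pfaEquiv_symm_apply, V.pfa.mu_eq R z r hr, muWith,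
    pfaCounit_multi]
  exact Finset.prod_congr rfl fun i _ => V.pfaCounit_translate _ _ _

theorem pfaEquiv_symm_rotate (q : Circle) {R : ℝ} (hR : 0 < R) (x : V.pfa.obj (disc 0 R)) :
    (V.pfaEquiv 0 hR).symm (V.pfa.rotate q R x) =
      Completion.rot q ((V.pfaEquiv 0 hR).symm x) := by
  rw [pfaEquiv_symm_apply, pfaEquiv_symm_apply, rotate, ContinuousLinearMap.comp_apply,
    pfaCounit_map, pfaCounit_act]
  exact Completion.expT_zero _

/-- The number `e^i` is not a root of unity: `m = n + 2πk` with `m ≠ n` would force `k ≠ 0` and `π =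
(m - n) / (2k)`, contradicting irrationality. -/
theorem exists_circle_zpow_ne {m n : ℤ} (h : m ≠ n) : ∃ q : Circle, (q : ℂ) ^ m ≠ (q : ℂ) ^ n := by
  refine ⟨Circle.exp 1, fun he => h ?_⟩
  rw [← Circle.coe_zpow, ← Circle.coe_zpow, ← Circle.exp_zsmul, ← Circle.exp_zsmul] at he
  obtain ⟨k, hk⟩ := Circle.exp_eq_exp.1 (Circle.ext he)
  simp only [zsmul_eq_mul, mul_one] at hk
  by_contra hmn
  have hk0 : k ≠ 0 := by
    rintro rfl
    simp at hk
    exact h hk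
  refine irrational_pi ⟨((m - n : ℤ) : ℚ) / (2 * k : ℤ), ?_⟩
  have : (k : ℝ) ≠ 0 := Int.cast_ne_zero.2 hk0
  push_cast
  rw [hk]
  field_simp
  ring

/-- The component at `Δ'` is scaled both by `q^Δ'` and by `q^Δ`; for `Δ' ≠ Δ` some `q` separates the
two characters, and the component vanishes. -/
theorem Completion.eq_single_iff {Δ : ℤ} {a : V.Completion} :
    (∀ q : Circle, rot q a = ((q : ℂ) ^ Δ) • a) ↔ single V Δ (a.coord Δ) = a := by
  constructor
  · intro h
    refine ext fun Δ' => ?_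
    by_cases hΔ : Δ' = Δ
    · subst hΔ; exact single_same _ _
    · rw [single_ne hΔ]
      obtain ⟨q, hq⟩ := exists_circle_zpow_ne hΔ
      have h1 := congrArg (fun b => b.coord Δ') (h q)
      simp only [coord_rot, coord_smul] at h1
      rw [← sub_eq_zero, ← sub_smul, smul_eq_zero] at h1
      exact (h1.resolve_left (sub_ne_zero.2 hq)).symm
  · intro h q
    rw [← h]
    refine ext fun Δ' => ?_
    rw [coord_rot, coord_smul]
    by_cases hΔ : Δ' = Δ
    · rw [hΔ]
    · rw [single_ne hΔ, smul_zero, smul_zero]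

/-- Identifies `F(D_R(0))_Δ` with `V_Δ` by a condition in which `R` does not occur. Axioms (i) and
(ii) both rest on this. -/
theorem mem_weightSpace_iff {R : ℝ} (hR : 0 < R) {Δ : ℤ} {a : V.Completion} :
    V.pfaEquiv 0 hR a ∈ V.pfa.weightSpace R Δ ↔
      Completion.single V Δ (a.coord Δ) = a := by
  rw [← Completion.eq_single_iff]
  refine forall_congr' fun q => ?_
  rw [← (V.pfaEquiv 0 hR).symm.injective.eq_iff, pfaEquiv_symm_rotate, map_smul,
    ContinuousLinearEquiv.symm_apply_apply]

theorem map_pfaEquiv {r R : ℝ} (hr : 0 < r) (hR : 0 < R) (h : disc 0 r ≤ disc 0 R)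
    (a : V.Completion) : V.pfa.map h (V.pfaEquiv 0 hr a) = V.pfaEquiv 0 hR a :=
  map_discMap 0 hr hR h a

/-- Under `pfaEquiv` the extension map between concentric discs is the identity of the completion,
so it is bijective even before weights are imposed. -/
theorem bijOn_weightSpace {r R : ℝ} (hr : 0 < r) (h : r < R) (Δ : ℤ) :
    Set.BijOn (V.pfa.map (disc_mono 0 h.le)) (V.pfa.weightSpace r Δ) (V.pfa.weightSpace R Δ) := by
  have hR := hr.trans h
  have hs := (V.pfaEquiv 0 hr).surjective
  refine ⟨fun x hx => ?_, fun x _ y _ hxy => ?_, fun y hy => ?_⟩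
  · obtain ⟨a, rfl⟩ := hs x
    rw [map_pfaEquiv V hr hR]
    exact (V.mem_weightSpace_iff hR).2 ((V.mem_weightSpace_iff hr).1 hx)
  · obtain ⟨a, rfl⟩ := hs x
    obtain ⟨b, rfl⟩ := hs y
    rw [map_pfaEquiv V hr hR, map_pfaEquiv V hr hR] at hxy
    rw [(V.pfaEquiv 0 hR).injective hxy]
  · obtain ⟨b, rfl⟩ := (V.pfaEquiv 0 hR).surjective y
    exact ⟨V.pfaEquiv 0 hr b, (V.mem_weightSpace_iff hr).2 ((V.mem_weightSpace_iff hR).1 hy),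
      V.map_pfaEquiv hr hR _ b⟩

theorem weightSpace_eq_bot {R : ℝ} (hR : 0 < R) {Δ : ℤ} (h : Subsingleton (V.wt Δ)) :
    V.pfa.weightSpace R Δ = ⊥ := by
  refine (Submodule.eq_bot_iff _).2 fun x hx => ?_
  obtain ⟨a, rfl⟩ := (V.pfaEquiv 0 hR).surjective x
  rw [← (V.mem_weightSpace_iff hR).1 hx, Subsingleton.elim (a.coord Δ) 0, map_zero, map_zero]

/-! ### Holomorphy of the products. -/

namespace Completion

variable {V} {E : Type*} [NormedAddCommGroup E] [NormedSpace ℂ E]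

/-- A function with values in the completion is holomorphic if its components are. -/
def Holomorphic (f : E → V.Completion) : Prop :=
  ∀ Δ, Differentiable ℂ fun z => V.wtEquiv Δ ((f z).coord Δ)

/-- Read in coordinates, the product is a bilinear map between spaces `ℂ^n`, hence continuous, and
the product rule applies. The coordinates provide the norms that differentiability requires. -/
theorem differentiable_prodComp (p q Δ : ℤ) {f : E → V.wt p} {g : E → V.wt q}
    (hf : Differentiable ℂ fun z => V.wtEquiv p (f z))
    (hg : Differentiable ℂ fun z => V.wtEquiv q (g z)) :
    Differentiable ℂ fun z => V.wtEquiv Δ (V.prodComp p q Δ (f z) (g z)) := by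
  let B := ((V.prodComp p q Δ).compl₁₂ (V.wtEquiv p).symm.toLinearMap
    (V.wtEquiv q).symm.toLinearMap).compr₂ (V.wtEquiv Δ).toLinearMap
  -- Finite dimensionality is used twice: for continuity in the second argument, and then in the
  -- first.
  let C := LinearMap.toContinuousLinearMap
    ((LinearMap.toContinuousLinearMap : _ ≃ₗ[ℂ] _).toLinearMap ∘ₗ B)
  have h : ∀ z, V.wtEquiv Δ (V.prodComp p q Δ (f z) (g z)) =
      C (V.wtEquiv p (f z)) (V.wtEquiv q (g z)) := fun z => by
    change _ = V.wtEquiv Δ (V.prodComp p q Δ ((V.wtEquiv p).symm (V.wtEquiv p (f z)))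
      ((V.wtEquiv q).symm (V.wtEquiv q (g z))))
    rw [ContinuousLinearEquiv.symm_apply_apply, ContinuousLinearEquiv.symm_apply_apply]
  simp only [h]
  exact (C.differentiable.comp hf).clm_apply hg

/-- The lower bound on the weights leaves finitely many summands in each component, with a range
independent of `z`. -/
theorem Holomorphic.mul {f g : E → V.Completion} (hf : Holomorphic f) (hg : Holomorphic g) :
    Holomorphic fun z => f z * g z := by
  obtain ⟨N, hN⟩ := V.bdd
  intro Δ
  simp only [coord_mul_sum hN, map_sum]
  exact Differentiable.fun_sum fun p _ => differentiable_prodComp p _ Δ (hf p) (hg _)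

theorem holomorphic_const (a : V.Completion) : Holomorphic fun _ : E => a :=
  fun _ => differentiable_const _

theorem Holomorphic.prod {ι : Type*} (s : Finset ι) {f : ι → E → V.Completion}
    (hf : ∀ i, Holomorphic (f i)) : Holomorphic fun z => ∏ i ∈ s, f i z := by
  classical
  induction s using Finset.induction_on with
  | empty => simpa using holomorphic_const 1
  | insert i s hi ih =>
    simp only [Finset.prod_insert hi]
    exact (hf i).mul ih

theorem holomorphic_expT {φ : E → ℂ} (hφ : Differentiable ℂ φ) (a : V.Completion) :
    Holomorphic fun z => expT (φ z) a := by
  obtain ⟨N, hN⟩ := V.bdd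
  intro Δ
  simp only [coord_expT_sum hN, map_sum, map_smul]
  refine Differentiable.fun_sum fun n _ => ?_
  fun_prop

/-- Convergence in a product is componentwise, so the Fréchet derivatives of the components assemble
to a derivative; no uniformity in `Δ` is needed. -/
theorem Holomorphic.isHolomorphicOn {l : ℕ} {f : (Fin l → ℂ) → V.Completion} (hf : Holomorphic f)
    {F : Type*} [AddCommGroup F] [Module ℂ F] [TopologicalSpace F] (e : V.Completion ≃L[ℂ] F)
    (U : Set (Fin l → ℂ)) : IsHolomorphicOn (fun z => e (f z)) U := by
  intro a _
  let D := fun Δ => fderiv ℂ (fun z => V.wtEquiv Δ ((f z).coord Δ)) a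
  let Θ := e.symm.trans V.completionEquiv
  -- The vector `ξ_i` has as components the `i`-th partial derivatives. The limit holds along the
  -- full neighbourhood filter and is then restricted.
  refine ⟨fun i => Θ.symm fun Δ => D Δ (Pi.single i 1), Filter.Tendsto.mono_left ?_ nhdsWithin_le_nhds⟩
  rw [Θ.toHomeomorph.isInducing.tendsto_nhds_iff, tendsto_pi_nhds]
  intro Δ
  have hd : HasFDerivAt (fun z => V.wtEquiv Δ ((f z).coord Δ)) (D Δ) a :=
    (hf Δ a).hasFDerivAt
  rw [hasFDerivAt_iff_tendsto] at hd
  have h0 : Θ.toHomeomorph 0 Δ = 0 := by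
    change Θ 0 Δ = 0
    rw [map_zero]; rfl
  rw [h0, tendsto_zero_iff_norm_tendsto_zero]
  refine hd.congr fun z => ?_
  change _ = ‖Θ (((‖z - a‖⁻¹ : ℝ) : ℂ) • (e (f z) - e (f a) - ∑ i, (z i - a i) •
    Θ.symm fun Δ => D Δ (Pi.single i 1))) Δ‖
  have h1 : ∀ x, Θ (e x) Δ = V.wtEquiv Δ (x.coord Δ) := fun x => by
    rw [ContinuousLinearEquiv.trans_apply, ContinuousLinearEquiv.symm_apply_apply]
    rfl
  -- Expanding `z - a` in the standard basis matches the Fréchet remainder with the sum over partial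
  -- derivatives.
  have h2 : D Δ (z - a) = ∑ i, (z i - a i) • D Δ (Pi.single i 1) := by
    conv_lhs => rw [← ContinuousLinearMap.coe_coe, LinearMap.pi_apply_eq_sum_univ]
    refine Finset.sum_congr rfl fun i _ => congrArg (fun v => (z i - a i) • D Δ v) ?_
    funext j
    rw [Pi.single_apply]
    exact if_congr eq_comm rfl rfl
  simp only [map_smul, map_sub, map_sum, Pi.smul_apply, Pi.sub_apply, Finset.sum_apply,
    ContinuousLinearEquiv.apply_symm_apply, h1]
  rw [norm_smul, Complex.norm_real, norm_inv, norm_norm, ← h2, map_sub]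

end Completion

theorem isHolomorphicOn_mu {R : ℝ} (hR : 0 < R) {l : ℕ} (a : Fin l → V.pfa.costalk) :
    IsHolomorphicOn (fun z => V.pfa.mu R z a) (conf l R) := by
  intro z hz
  have hf : Completion.Holomorphic fun z : Fin l → ℂ =>
      ∏ i, Completion.expT (z i) (V.costalkValue (a i)) :=
    Completion.Holomorphic.prod _ fun i =>
      Completion.holomorphic_expT (differentiable_apply (𝕜 := ℂ) i) _
  obtain ⟨ξ, hξ⟩ := hf.isHolomorphicOn (V.pfaEquiv 0 hR) (conf l R) z hz
  refine ⟨ξ, hξ.congr' ?_⟩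
  -- The filter stays inside the configuration space, so the default value `0` of `mu` never enters
  -- and the entire function may replace it.
  filter_upwards [self_mem_nhdsWithin] with w hw
  rw [V.mu_pfa hR hw.1, V.mu_pfa hR hz]

theorem isHolomorphic_pfa : V.pfa.IsHolomorphic where
  bijOn _ _ hr h Δ := V.bijOn_weightSpace hr h Δ
  bdd _ hR := V.bdd.imp fun _ hN Δ hΔ => V.weightSpace_eq_bot hR (hN Δ hΔ)
  t2 _ hR := V.t2Space_pfa hR
  quasiComplete _ hR := V.quasiComplete_pfa hR
  holomorphic _ hR _ _ a := V.isHolomorphicOn_mu hR fun i => a i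

end GrComVA

/-! ### Extensionality and transport of graded vertex algebras. -/

theorem VertexOperator.ext_ncoeff {V : Type u} [AddCommGroup V] [Module ℂ V]
    {A B : VertexOperator ℂ V} (h : ∀ n, VertexOperator.ncoeff A n = VertexOperator.ncoeff B n) :
    A = B := by
  refine HVertexOperator.coeff_inj (funext fun n => ?_)
  -- The coefficient of `z^n` is the mode with index `-n - 1`.
  have := h (-n - 1)
  rwa [← VertexOperator.coeff_eq_ncoeff, ← VertexOperator.coeff_eq_ncoeff] at this

theorem VertexAlgebra.ext_nprod {V : Type u} [AddCommGroup V] [Module ℂ V]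
    {S S' : VertexAlgebra V} (hv : S.vac = S'.vac) (hT : S.T = S'.T)
    (h : ∀ n a b, S.nprod n a b = S'.nprod n a b) : S = S' := by
  have hY : S.Y = S'.Y := LinearMap.ext fun a =>
    VertexOperator.ext_ncoeff fun n => LinearMap.ext fun b => h n a b
  cases S
  cases S'
  subst hv hT hY
  rfl

namespace GradedVertexAlgebra

variable {V W : ℤ → Type u} [∀ Δ, AddCommGroup (V Δ)] [∀ Δ, Module ℂ (V Δ)]
  [∀ Δ, AddCommGroup (W Δ)] [∀ Δ, Module ℂ (W Δ)]

theorem ext_nprod {S S' : GradedVertexAlgebra V} (hv : S.vac = S'.vac) (hT : S.T = S'.T)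
    (h : ∀ n a b, S.nprod n a b = S'.nprod n a b) : S = S' := by
  have := VertexAlgebra.ext_nprod hv hT h
  cases S
  cases S'
  subst this
  rfl

/-- The bound is the order of the Laurent series that `A` assigns to `E.symm x`. It lets the
conjugated coefficients form a vertex operator again. -/
theorem bddBelow_support_conj {X X' : Type u} [AddCommGroup X] [Module ℂ X] [AddCommGroup X']
    [Module ℂ X'] (E : X ≃ₗ[ℂ] X') (A : VertexOperator ℂ X) (x : X') :
    BddBelow (Function.support fun n => E.conj (HVertexOperator.coeff A n) x) :=
  ⟨_, fun n hn => not_lt.1 fun hlt => hn <| by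
    beta_reduce
    rw [LinearEquiv.conj_apply_apply, VertexOperator.coeff_eq_zero_of_lt_order A n _ hlt,
      map_zero]⟩

/-- Transport of vertex operators along a linear equivalence of state spaces. -/
noncomputable def conjVertexOperator {X X' : Type u} [AddCommGroup X] [Module ℂ X]
    [AddCommGroup X'] [Module ℂ X'] (E : X ≃ₗ[ℂ] X') (A : VertexOperator ℂ X) :
    VertexOperator ℂ X' :=
  VertexOperator.of_coeff (fun n => E.conj (HVertexOperator.coeff A n)) (bddBelow_support_conj E A)

theorem ncoeff_conjVertexOperator {X X' : Type u} [AddCommGroup X] [Module ℂ X]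
    [AddCommGroup X'] [Module ℂ X'] (E : X ≃ₗ[ℂ] X') (A : VertexOperator ℂ X) (n : ℤ) (x : X') :
    VertexOperator.ncoeff (conjVertexOperator E A) n x =
      E (VertexOperator.ncoeff A n (E.symm x)) := by
  rw [conjVertexOperator, VertexOperator.ncoeff_of_coeff, LinearEquiv.conj_apply_apply]
  rfl

/-- Transport of a graded vertex algebra along linear equivalences of the weight spaces. -/
noncomputable def transport (S : GradedVertexAlgebra V) (e : ∀ Δ, V Δ ≃ₗ[ℂ] W Δ)
    (E : (⨁ Δ, V Δ) ≃ₗ[ℂ] ⨁ Δ, W Δ)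
    (hE : ∀ Δ x, E (DirectSum.lof ℂ ℤ V Δ x) = DirectSum.lof ℂ ℤ W Δ (e Δ x)) :
    GradedVertexAlgebra W where
  vac := E S.vac
  T := E.conj S.T
  Y :=
    { toFun := fun a => conjVertexOperator E (S.Y (E.symm a))
      map_add' := fun a b => VertexOperator.ext_ncoeff fun n => LinearMap.ext fun x => by
        simp only [map_add, Pi.add_apply, LinearMap.add_apply, ncoeff_conjVertexOperator]
      map_smul' := fun c a => VertexOperator.ext_ncoeff fun n => LinearMap.ext fun x => by
        simp only [map_smul, Pi.smul_apply, LinearMap.smul_apply, ncoeff_conjVertexOperator,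
          RingHom.id_apply] }
  vac_left n a := by
    simp only [LinearMap.coe_mk, AddHom.coe_mk, ncoeff_conjVertexOperator,
      LinearEquiv.symm_apply_apply, S.vac_left]
    split_ifs <;> simp
  vac_right a n := by
    simp only [LinearMap.coe_mk, AddHom.coe_mk, ncoeff_conjVertexOperator,
      LinearEquiv.symm_apply_apply, S.vac_right, map_zero]
  vac_right_neg_one a := by
    simp only [LinearMap.coe_mk, AddHom.coe_mk, ncoeff_conjVertexOperator,
      LinearEquiv.symm_apply_apply, S.vac_right_neg_one, LinearEquiv.apply_symm_apply]
  T_vac := by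
    rw [LinearEquiv.conj_apply_apply, LinearEquiv.symm_apply_apply, S.T_vac, map_zero]
  translation a b n := by
    simp only [LinearMap.coe_mk, AddHom.coe_mk, ncoeff_conjVertexOperator,
      LinearEquiv.conj_apply_apply, LinearEquiv.symm_apply_apply]
    rw [← map_sub, S.translation, map_smul]
  locality a b := by
    -- The same order of locality works, because the new expression is the image under `E` of the
    -- old one.
    obtain ⟨N, hN⟩ := S.locality (E.symm a) (E.symm b)
    refine ⟨N, fun m n c => ?_⟩
    simp only [LinearMap.coe_mk, AddHom.coe_mk, ncoeff_conjVertexOperator,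
      LinearEquiv.symm_apply_apply]
    simp only [← map_sub, ← map_smul, ← map_sum, hN, map_zero]
  vac_mem := by
    obtain ⟨x, hx⟩ := S.vac_mem
    exact ⟨e 0 x, by rw [← hE, hx]⟩
  nprod_mem Δ Δ' n a b := by
    have h : ∀ Δ x, E.symm (DirectSum.lof ℂ ℤ W Δ x) = DirectSum.lof ℂ ℤ V Δ ((e Δ).symm x) :=
      fun Δ x => by rw [LinearEquiv.symm_apply_eq, hE, LinearEquiv.apply_symm_apply]
    simp only [LinearMap.coe_mk, AddHom.coe_mk, ncoeff_conjVertexOperator, h]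
    obtain ⟨x, hx⟩ := S.nprod_mem Δ Δ' n ((e Δ).symm a) ((e Δ').symm b)
    exact ⟨e _ x, by rw [← hE, hx]⟩

variable (S : GradedVertexAlgebra V) (e : ∀ Δ, V Δ ≃ₗ[ℂ] W Δ) (E : (⨁ Δ, V Δ) ≃ₗ[ℂ] ⨁ Δ, W Δ)
  (hE : ∀ Δ x, E (DirectSum.lof ℂ ℤ V Δ x) = DirectSum.lof ℂ ℤ W Δ (e Δ x))

theorem nprod_transport (n : ℤ) (a b : ⨁ Δ, W Δ) :
    (S.transport e E hE).nprod n a b = E (S.nprod n (E.symm a) (E.symm b)) :=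
  ncoeff_conjVertexOperator E (S.Y (E.symm a)) n b

theorem T_transport (a : ⨁ Δ, W Δ) : (S.transport e E hE).T a = E (S.T (E.symm a)) := rfl

theorem isCommutative_transport (h : S.IsCommutative) : (S.transport e E hE).IsCommutative := by
  intro a b m n c
  simp only [nprod_transport, LinearEquiv.symm_apply_apply]
  rw [h]

theorem isIso_transport : IsIso S (S.transport e E hE) E.toLinearMap := by
  refine ⟨⟨rfl, fun a => ?_, fun n a b => ?_, fun Δ a => ⟨e Δ a, (hE Δ a).symm⟩⟩, E.symm.toLinearMap,
    ⟨E.symm_apply_apply _, fun a => E.symm_apply_apply _, fun n a b => ?_,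
      fun Δ a => ⟨(e Δ).symm a, ?_⟩⟩, E.symm_comp, E.comp_symm⟩
  · change E (S.T a) = E (S.T (E.symm (E a)))
    rw [E.symm_apply_apply]
  · change E (S.nprod n a b) = (S.transport e E hE).nprod n (E a) (E b)
    rw [nprod_transport, E.symm_apply_apply, E.symm_apply_apply]
  · change E.symm ((S.transport e E hE).nprod n a b) = S.nprod n (E.symm a) (E.symm b)
    rw [nprod_transport, E.symm_apply_apply]
  · change _ = E.symm _
    rw [LinearEquiv.eq_symm_apply, hE, LinearEquiv.apply_symm_apply]

end GradedVertexAlgebra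

/-! ### Modes of a commutative vertex algebra and the exponential series. -/

namespace GrComVA

variable (V : GrComVA.{u})

/-- Applied to the vacuum, the translation axiom becomes the recursion `T (a_(n)|0⟩) = -n
a_(n-1)|0⟩`, starting from `a_(-1)|0⟩ = a`; the factors `-n` accumulate to `k!`. -/
theorem nprod_vac_of_neg (a) (k : ℕ) : V.va.nprod (-(k : ℤ) - 1) a V.va.vac =
    (1 / (k.factorial : ℂ)) • (V.va.T ^ k) a := by
  induction k with
  | zero => simpa using V.mulV_vac a
  | succ k ih =>
    have h := V.va.translation a V.va.vac (-(k : ℤ) - 1)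
    rw [V.va.T_vac, map_zero, sub_zero, ← V.va.nprod_apply, ← V.va.nprod_apply, ih, map_smul,
      ← Module.End.mul_apply, ← pow_succ'] at h
    have hk : ((k + 1 : ℕ) : ℂ) ≠ 0 := Nat.cast_ne_zero.2 k.succ_ne_zero
    have e : (-((-(k : ℤ) - 1 : ℤ) : ℂ)) = ((k + 1 : ℕ) : ℂ) := by push_cast; ring
    rw [show -((k + 1 : ℕ) : ℤ) - 1 = -(k : ℤ) - 1 - 1 by push_cast; ring,
      Nat.factorial_succ, Nat.cast_mul, one_div, mul_inv, mul_smul,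
      ← one_div (k.factorial : ℂ), h, e, inv_smul_smul₀ hk]

/-- Write `b = b_(-1)|0⟩` and move `b_(-1)` past `a_(n)` by commutativity. All modes of `a` are thus
determined by their values on the vacuum. -/
theorem nprod_eq_mulV (n : ℤ) (a b) :
    V.va.nprod n a b = V.mulV (V.va.nprod n a V.va.vac) b := by
  rw [V.mulV_comm, ← V.comm, V.mulV_vac]

theorem nprod_of_neg (a b) (k : ℕ) : V.va.nprod (-(k : ℤ) - 1) a b =
    (1 / (k.factorial : ℂ)) • V.mulV ((V.va.T ^ k) a) b := by
  rw [nprod_eq_mulV, nprod_vac_of_neg, map_smul, LinearMap.smul_apply]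

/-- Nonnegative modes kill the vacuum, hence everything: `Y(a,z) b` has no pole. -/
theorem nprod_of_nonneg (a b) (k : ℕ) : V.va.nprod k a b = 0 := by
  rw [nprod_eq_mulV, V.va.nprod_apply k, V.va.vac_right, map_zero, LinearMap.zero_apply]

namespace Completion

variable {V}

theorem coord_incl (v : ⨁ Δ, V.wt Δ) (Δ : ℤ) : (incl v).coord Δ = V.prj Δ v := rfl

variable (V) in
/-- The embedding of the state space in the completion as a linear map. -/
noncomputable def inclLin : (⨁ Δ, V.wt Δ) →ₗ[ℂ] V.Completion where
  toFun := incl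
  map_add' a b := ext fun Δ => by simp only [coord_incl, coord_add, map_add]
  map_smul' c a := ext fun Δ => by simp only [coord_incl, coord_smul, map_smul, RingHom.id_apply]

theorem inclLin_apply (v : ⨁ Δ, V.wt Δ) : inclLin V v = incl v := rfl

theorem inclLin_injective : Function.Injective (inclLin V) := fun _ _ h =>
  DirectSum.ext_component ℂ fun Δ => congrArg (fun a => a.coord Δ) h

theorem incl_inc (p : ℤ) (x : V.wt p) : incl (V.inc p x) = single V p x :=
  ext fun Δ => (single_coord p Δ x).symm

theorem incl_vac : incl V.va.vac = 1 := rfl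

theorem incl_mulV (a b : ⨁ Δ, V.wt Δ) : incl (V.mulV a b) = incl a * incl b := by
  have : V.mulV.compr₂ (inclLin V) = mulHom.compl₁₂ (inclLin V) (inclLin V) := by
    refine DirectSum.linearMap_ext ℂ fun p => LinearMap.ext fun x =>
      DirectSum.linearMap_ext ℂ fun q => LinearMap.ext fun y => ?_
    change incl (V.mulV (V.inc p x) (V.inc q y)) = incl (V.inc p x) * incl (V.inc q y)
    rw [incl_inc, incl_inc, single_mul_single, ← inc_prodComp, incl_inc]
  exact LinearMap.congr_fun₂ this a b

/-- As `T` has degree one, the component of `T^k v` at `Δ` sees only the component of `v` at `Δ -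
k`. This recognizes the summands of `expT` as multiples of `T^k v`. -/
theorem coord_incl_pow_T (k : ℕ) (v : ⨁ Δ, V.wt Δ) (Δ : ℤ) :
    (incl ((V.va.T ^ k) v)).coord Δ = powT k (Δ - k) Δ ((incl v).coord (Δ - k)) := by
  have : V.prj Δ ∘ₗ (V.va.T ^ k) = powT k (Δ - k) Δ ∘ₗ V.prj (Δ - k) := by
    refine DirectSum.linearMap_ext ℂ fun p => LinearMap.ext fun x => ?_
    change V.prj Δ ((V.va.T ^ k) (V.inc p x)) = powT k (Δ - k) Δ (V.prj (Δ - k) (V.inc p x))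
    by_cases h : p = Δ - k
    · subst h
      rw [DirectSum.component.lof_self]; rfl
    · rw [V.prj_ne h ⟨x, rfl⟩, V.prj_ne (fun h' => h (by lia)) (pow_T_mem k p x), map_zero]
  exact LinearMap.congr_fun this v

theorem hasSum_of_coord {ι : Type*} {f : ι → V.Completion} {a : V.Completion}
    (h : ∀ Δ, HasSum (fun i => (f i).coord Δ) (a.coord Δ)) : HasSum f a :=
  (Pi.hasSum (X := V.wt)).2 h

/-- In each component only finitely many terms are nonzero, because `Δ - k` eventually falls below
the lowest weight; convergence involves no estimates. -/
theorem hasSum_expT (z : ℂ) (v : ⨁ Δ, V.wt Δ) :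
    HasSum (fun k : ℕ => (z ^ k / (k.factorial : ℂ)) • incl ((V.va.T ^ k) v))
      (expT z (incl v)) := by
  obtain ⟨N, hN⟩ := V.bdd
  refine hasSum_of_coord fun Δ => ?_
  simp only [coord_expT_sum hN, coord_smul, coord_incl_pow_T]
  refine hasSum_sum_of_ne_finset_zero fun k hk => ?_
  rw [Finset.mem_range] at hk
  have := hN (Δ - k) (by lia)
  rw [Subsingleton.elim ((incl v).coord (Δ - k)) 0, map_zero, smul_zero]

/-- The identity `Y(a,z) b = (e^(zT) a) b`, which links the vertex algebra to the two-point product.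
-/
theorem hasSum_expT_mul (z : ℂ) (a b : ⨁ Δ, V.wt Δ) :
    HasSum (fun n : ℤ => z ^ (-n - 1) • incl (V.va.nprod n a b)) (expT z (incl a) * incl b) := by
  -- Modes with `n ≥ 0` vanish, so the sum over `ℤ` reduces to the indices `n = -k - 1`.
  have hi : Function.Injective fun k : ℕ => -(k : ℤ) - 1 := fun k k' h => by
    simpa using h
  refine (hi.hasSum_iff fun n hn => ?_).1 ?_
  · have h0 : 0 ≤ n := by
      by_contra hlt
      exact hn ⟨(-n - 1).toNat, by beta_reduce; lia⟩
    lift n to ℕ using h0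
    rw [nprod_of_nonneg, ← inclLin_apply, map_zero, smul_zero]
  · have h := (hasSum_expT z a).map (mulHom.flip (incl b)) (continuous_mul_right' (incl b))
    refine h.congr_fun fun k => ?_
    change z ^ (-(-(k : ℤ) - 1) - 1) • incl (V.va.nprod (-(k : ℤ) - 1) a b) =
      ((z ^ k / (k.factorial : ℂ)) • incl ((V.va.T ^ k) a)) * incl b
    rw [nprod_of_neg, ← inclLin_apply, map_smul, inclLin_apply, incl_mulV, smul_smul,
      smul_mul_assoc, mul_one_div, show -(-(k : ℤ) - 1) - 1 = k by ring, zpow_natCast]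

theorem tendsto_of_coord {X : Type*} {l : Filter X} {f : X → V.Completion} {a : V.Completion}
    (h : ∀ Δ, Filter.Tendsto (fun x => (f x).coord Δ) l (𝓝 (a.coord Δ))) :
    Filter.Tendsto f l (𝓝 a) := (tendsto_pi_nhds (A := V.wt)).2 h

/-- In each component `e^(zT) v` is a polynomial in `z` whose linear coefficient is `T v`. -/
theorem tendsto_expT (v : ⨁ Δ, V.wt Δ) :
    Filter.Tendsto (fun z : ℂ => z⁻¹ • (expT z (incl v) - incl v)) (𝓝[≠] 0)
      (𝓝 (incl (V.va.T v))) := by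
  obtain ⟨N, hN⟩ := V.bdd
  refine tendsto_of_coord fun Δ => ?_
  -- Lowering the bound to at most `Δ - 1` guarantees at least two terms in the truncated series, so
  -- that both the constant and the linear term can be split off.
  obtain ⟨m, hm⟩ : ∃ m, (Δ - min N (Δ - 1) + 1).toNat = m + 2 :=
    ⟨(Δ - min N (Δ - 1) + 1).toNat - 2, by lia⟩
  have hN' : ∀ Δ' < min N (Δ - 1), Subsingleton (V.wt Δ') := fun Δ' h => hN Δ' (by lia)
  have hc : ∀ z, (expT z (incl v)).coord Δ = ∑ k ∈ Finset.range (m + 2),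
      (z ^ k / (k.factorial : ℂ)) • (incl ((V.va.T ^ k) v)).coord Δ := fun z => by
    simp only [coord_expT_sum hN', hm, coord_incl_pow_T]
  -- The difference quotient with `z` cancelled: a polynomial, hence continuous at `0`.
  let g : ℂ → V.wt Δ := fun z => ∑ k ∈ Finset.range (m + 1),
    (z ^ k / ((k + 1).factorial : ℂ)) • (incl ((V.va.T ^ (k + 1)) v)).coord Δ
  have hg : Continuous g := continuous_finsetSum _ fun k _ =>
    ((continuous_pow k).div_const _).smul continuous_const
  have hg0 : g 0 = (incl (V.va.T v)).coord Δ := by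
    change ∑ k ∈ Finset.range (m + 1), _ = _
    rw [Finset.sum_range_succ', Finset.sum_eq_zero fun k _ => by
      rw [zero_pow k.succ_ne_zero, zero_div, zero_smul]]
    simp
  rw [← hg0]
  refine (hg.tendsto 0 |>.mono_left nhdsWithin_le_nhds).congr' ?_
  filter_upwards [self_mem_nhdsWithin] with z hz
  have hz : z ≠ 0 := hz
  rw [sub_eq_add_neg, ← neg_one_smul ℂ (incl v), coord_smul, coord_add, coord_smul, hc,
    Finset.sum_range_succ', pow_zero, pow_zero, Nat.factorial_zero, Nat.cast_one, div_one, one_smul,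
    Module.End.one_apply, neg_one_smul, add_neg_cancel_right, Finset.smul_sum]
  refine Finset.sum_congr rfl fun k _ => ?_
  rw [smul_smul]
  congr 1
  rw [pow_succ]
  field_simp

end Completion

end GrComVA

/-! ### The vertex algebra on the state space: existence and uniqueness. -/

namespace GrComVA

open EquivariantPFA Completion

variable (V : GrComVA.{u})

/-- Radius `1` already detects the weight. This makes taking the component at `Δ` a right inverse of
`etaWeight`. -/
theorem costalkValue_weight {Δ : ℤ} (a : V.pfa.costalkWeight Δ) :
    single V Δ ((V.costalkValue a).coord Δ) = V.costalkValue a := by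
  have h : V.pfaEquiv 0 one_pos (V.costalkValue a) ∈ V.pfa.weightSpace 1 Δ := by
    have := a.2 ⟨1, Set.mem_Ioi.2 one_pos⟩
    rwa [costalk_apply] at this
  exact (V.mem_weightSpace_iff one_pos).1 h

theorem costalkValue_etaWeight (Δ : ℤ) (x : V.wt Δ) :
    V.costalkValue (V.etaWeight Δ x) = single V Δ x :=
  counit_discMap 0 one_pos (single V Δ x)

/-- The weight spaces of `V` and of `V(𝐅^loc)` agree. -/
noncomputable def etaWeightEquiv (Δ : ℤ) : V.wt Δ ≃ₗ[ℂ] V.pfa.costalkWeight Δ where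
  __ := V.etaWeight Δ
  invFun a := (V.costalkValue a).coord Δ
  left_inv x := by
    change (V.costalkValue (V.etaWeight Δ x)).coord Δ = x
    rw [costalkValue_etaWeight, single_same]
  right_inv a := Subtype.ext (V.costalkValue_injective
    ((V.costalkValue_etaWeight Δ _).trans (V.costalkValue_weight a)))

/-- The isomorphism `η_V`. -/
noncomputable def etaEquiv : (⨁ Δ, V.wt Δ) ≃ₗ[ℂ] V.pfa.StateSpace :=
  DFinsupp.mapRange.linearEquiv V.etaWeightEquiv

theorem etaEquiv_lof (Δ : ℤ) (x : V.wt Δ) : V.etaEquiv (DirectSum.lof ℂ ℤ V.wt Δ x) =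
    DirectSum.lof ℂ ℤ (fun Δ => V.pfa.costalkWeight Δ) Δ (V.etaWeightEquiv Δ x) :=
  DFinsupp.mapRange_single (hf := fun Δ => map_zero (V.etaWeightEquiv Δ))

theorem etaEquiv_toLinearMap : V.etaEquiv.toLinearMap = V.eta :=
  DirectSum.linearMap_ext ℂ fun Δ => LinearMap.ext fun x => by
    rw [eta, LinearMap.comp_apply, LinearMap.comp_apply, DirectSum.toModule_lof]
    exact V.etaEquiv_lof Δ x

/-- The element of the completion that corresponds to an element of the state space. -/
noncomputable def stateValue : V.pfa.StateSpace →ₗ[ℂ] V.Completion :=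
  V.costalkValue ∘ₗ V.pfa.toCostalk

theorem stateValue_apply (a : V.pfa.StateSpace) :
    V.costalkValue (V.pfa.toCostalk a) = V.stateValue a := rfl

theorem stateValue_lof (Δ : ℤ) (a : V.pfa.costalkWeight Δ) :
    V.stateValue (DirectSum.lof ℂ ℤ (fun Δ => V.pfa.costalkWeight Δ) Δ a) = V.costalkValue a := by
  rw [stateValue, LinearMap.comp_apply, toCostalk, DirectSum.toModule_lof]
  rfl

/-- Read in the completion, `η` is the inclusion of the direct sum in the product. As `stateValue`
is injective, identities in the state space can be checked there. -/
theorem stateValue_etaEquiv (v : ⨁ Δ, V.wt Δ) : V.stateValue (V.etaEquiv v) = incl v := by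
  have : V.stateValue ∘ₗ V.etaEquiv.toLinearMap = inclLin V :=
    DirectSum.linearMap_ext ℂ fun Δ => LinearMap.ext fun x => by
      change V.stateValue (V.etaEquiv (DirectSum.lof ℂ ℤ V.wt Δ x)) = incl (V.inc Δ x)
      rw [etaEquiv_lof, stateValue_lof, incl_inc]
      exact V.costalkValue_etaWeight Δ x
  exact LinearMap.congr_fun this v

theorem stateValue_injective : Function.Injective V.stateValue := fun a b h => by
  obtain ⟨v, rfl⟩ := V.etaEquiv.surjective a
  obtain ⟨w, rfl⟩ := V.etaEquiv.surjective b
  rw [stateValue_etaEquiv, stateValue_etaEquiv] at h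
  rw [inclLin_injective h]

theorem ev_pfa (R : Set.Ioi (0 : ℝ)) (a : V.pfa.StateSpace) :
    V.pfa.ev R a = V.pfaEquiv 0 (Set.mem_Ioi.1 R.2) (V.stateValue a) := V.costalk_apply (V.pfa.toCostalk a) R

theorem ev_injective (R : Set.Ioi (0 : ℝ)) : Function.Injective (V.pfa.ev R) := fun a b h => by
  rw [ev_pfa, ev_pfa] at h
  exact V.stateValue_injective ((V.pfaEquiv 0 (Set.mem_Ioi.1 R.2)).injective h)

theorem mu_pfa_one {R : ℝ} (hR : 0 < R) {z : ℂ} (hz : ‖z‖ < R) (a : V.pfa.costalk) :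
    V.pfa.mu R ![z] ![a] = V.pfaEquiv 0 hR (expT z (V.costalkValue a)) := by
  rw [V.mu_pfa hR, Fin.prod_univ_one]
  · rfl
  · exact ⟨Function.injective_of_subsingleton _, fun i => by
      rw [Subsingleton.elim i 0]; simpa using hz⟩

theorem mu_pfa_two {R : ℝ} (hR : 0 < R) {z : ℂ} (hz0 : z ≠ 0) (hz : ‖z‖ < R)
    (a b : V.pfa.costalk) :
    V.pfa.mu R ![z, 0] ![a, b] =
      V.pfaEquiv 0 hR (expT z (V.costalkValue a) * V.costalkValue b) := by
  rw [V.mu_pfa hR, Fin.prod_univ_two]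
  · change V.pfaEquiv 0 hR (expT z (V.costalkValue a) * expT 0 (V.costalkValue b)) = _
    rw [expT_zero]
  · refine ⟨fun i j h => ?_, fun i => ?_⟩
    · fin_cases i <;> fin_cases j <;> simp_all
    · fin_cases i
      · simpa using hz
      · simpa using hR

/-- The vertex algebra structure on `V(𝐅^loc)`. -/
noncomputable def stateVA : GradedVertexAlgebra fun Δ => V.pfa.costalkWeight Δ :=
  V.va.transport V.etaWeightEquiv V.etaEquiv V.etaEquiv_lof

/-- Each formula is its counterpart in the completion (`incl_vac`, `tendsto_expT`,
`hasSum_expT_mul`), carried to `F(D_R(0))` by the continuous linear map `pfaEquiv`. -/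
theorem isVertexAlgebra_stateVA : V.pfa.IsVertexAlgebra V.stateVA where
  vac_eq R := by
    change V.pfa.ev R (V.etaEquiv V.va.vac) = _
    rw [ev_pfa, stateValue_etaEquiv, incl_vac, ← ContinuousLinearEquiv.eq_symm_apply,
      pfaEquiv_symm_apply, pfaCounit_map, pfaCounit_one]
  hasDeriv R a := by
    obtain ⟨v, rfl⟩ := V.etaEquiv.surjective a
    have hT : V.stateVA.T (V.etaEquiv v) = V.etaEquiv (V.va.T v) := by
      rw [stateVA, GradedVertexAlgebra.T_transport, LinearEquiv.symm_apply_apply]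
    rw [hT, ev_pfa, stateValue_etaEquiv]
    refine (((V.pfaEquiv 0 (Set.mem_Ioi.1 R.2)).continuous.tendsto _).comp (tendsto_expT v)).congr' ?_
    -- Only for `z` inside the disc is `mu` given by the formula in the completion; near `0` this is
    -- automatic.
    have hR : ∀ᶠ z : ℂ in 𝓝[≠] 0, ‖z‖ < R := nhdsWithin_le_nhds <| by
      filter_upwards [Metric.ball_mem_nhds (0 : ℂ) R.2] with z hz
      simpa using hz
    filter_upwards [hR] with z hz
    have h0 : ‖(0 : ℂ)‖ < R := by rw [norm_zero]; exact R.2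
    rw [V.mu_pfa_one R.2 hz, V.mu_pfa_one R.2 h0, stateValue_apply,
      stateValue_etaEquiv, expT_zero, Function.comp_apply, map_smul, map_sub]
  hasSum R a b z hz0 hz := by
    obtain ⟨v, rfl⟩ := V.etaEquiv.surjective a
    obtain ⟨w, rfl⟩ := V.etaEquiv.surjective b
    rw [V.mu_pfa_two R.2 hz0 hz, stateValue_apply, stateValue_apply, stateValue_etaEquiv,
      stateValue_etaEquiv]
    refine ((hasSum_expT_mul z v w).map (V.pfaEquiv 0 (Set.mem_Ioi.1 R.2))
      (V.pfaEquiv 0 (Set.mem_Ioi.1 R.2)).continuous).congr_fun fun n => ?_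
    rw [Function.comp_apply, map_smul, ev_pfa, stateVA, GradedVertexAlgebra.nprod_transport,
      stateValue_etaEquiv, LinearEquiv.symm_apply_apply, LinearEquiv.symm_apply_apply]

/-- The reason for uniqueness. For homogeneous `a` and `b` the products `a_(m) b` have pairwise
different weights, so one component of the expansion of `μ` at a single point `z` isolates the
`n`-th product. The right-hand side does not involve `S`. -/
theorem stateValue_nprod {S : GradedVertexAlgebra fun Δ => V.pfa.costalkWeight Δ}
    (hS : V.pfa.IsVertexAlgebra S) {p q : ℤ} (a : V.pfa.costalkWeight p)
    (b : V.pfa.costalkWeight q) (n : ℤ) {z : ℂ} (hz0 : z ≠ 0) (hz : ‖z‖ < 1) :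
    V.stateValue (S.nprod n (DirectSum.lof ℂ ℤ (fun Δ => V.pfa.costalkWeight Δ) p a)
      (DirectSum.lof ℂ ℤ (fun Δ => V.pfa.costalkWeight Δ) q b)) =
    single V (p + q - n - 1) (z ^ (n + 1) •
      (expT z (V.costalkValue a) * V.costalkValue b).coord (p + q - n - 1)) := by
  have hw : ∀ m, ∃ x, V.stateValue (S.nprod m
      (DirectSum.lof ℂ ℤ (fun Δ => V.pfa.costalkWeight Δ) p a)
      (DirectSum.lof ℂ ℤ (fun Δ => V.pfa.costalkWeight Δ) q b)) = single V (p + q - m - 1) x := by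
    intro m
    obtain ⟨c, hc⟩ := S.nprod_mem p q m a b
    exact ⟨(V.costalkValue c).coord _, by
      rw [S.nprod_apply, ← hc, stateValue_lof, costalkValue_weight]⟩
  choose x hx using hw
  have h := hS.hasSum ⟨1, Set.mem_Ioi.2 one_pos⟩
    (DirectSum.lof ℂ ℤ (fun Δ => V.pfa.costalkWeight Δ) p a)
    (DirectSum.lof ℂ ℤ (fun Δ => V.pfa.costalkWeight Δ) q b) z hz0 hz
  rw [V.mu_pfa_two one_pos hz0 hz, stateValue_apply, stateValue_apply, stateValue_lof,
    stateValue_lof] at h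
  have h1 : HasSum (fun m : ℤ => z ^ (-m - 1) • single V (p + q - m - 1) (x m))
      (expT z (V.costalkValue a) * V.costalkValue b) := by
    have h' := h.map (V.pfaEquiv 0 one_pos).symm (V.pfaEquiv 0 one_pos).symm.continuous
    rw [ContinuousLinearEquiv.symm_apply_apply] at h'
    refine h'.congr_fun fun m => ?_
    rw [Function.comp_apply, map_smul, ev_pfa, hx, ContinuousLinearEquiv.symm_apply_apply]
  have h2 : HasSum (fun m : ℤ => (z ^ (-m - 1) • single V (p + q - m - 1) (x m)).coord
      (p + q - n - 1)) ((expT z (V.costalkValue a) * V.costalkValue b).coord (p + q - n - 1)) :=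
    (Pi.hasSum (X := V.wt)).1 h1 _
  -- Only `m = n` contributes in weight `p + q - n - 1`.
  have h3 := h2.unique (hasSum_single n fun m hm => by
    rw [coord_smul, single_ne (by lia), smul_zero])
  -- The prefactor `z^(n+1)` cancels the power `z^(-n-1)` of the expansion.
  rw [hx, h3, coord_smul, single_same, smul_smul, ← zpow_add₀ hz0]
  simp

theorem eq_of_isVertexAlgebra {S S' : GradedVertexAlgebra fun Δ => V.pfa.costalkWeight Δ}
    (hS : V.pfa.IsVertexAlgebra S) (hS' : V.pfa.IsVertexAlgebra S') : S = S' := by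
  let R : Set.Ioi (0 : ℝ) := ⟨1, Set.mem_Ioi.2 one_pos⟩
  have : T2Space (V.pfa.obj (disc 0 R)) := V.t2Space_pfa R.2
  refine GradedVertexAlgebra.ext_nprod (V.ev_injective R ?_) (LinearMap.ext fun a =>
    V.ev_injective R (tendsto_nhds_unique (hS.hasDeriv R a) (hS'.hasDeriv R a))) fun n a b => ?_
  · rw [hS.vac_eq, hS'.vac_eq]
  · have h : S.nprod n = S'.nprod n := by
      refine DirectSum.linearMap_ext ℂ fun p => LinearMap.ext fun x =>
        DirectSum.linearMap_ext ℂ fun q => LinearMap.ext fun y => V.stateValue_injective ?_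
      -- Any point with `0 < ‖z‖ < 1` would do, since a single value of `z` determines all products.
      have h0 : (1 / 2 : ℂ) ≠ 0 := by norm_num
      have h1 : ‖(1 / 2 : ℂ)‖ < 1 := by norm_num
      exact (V.stateValue_nprod hS x y n h0 h1).trans (V.stateValue_nprod hS' x y n h0 h1).symm
    rw [h]

/-! ### Naturality of `η`. -/

section Naturality

variable {V} {W : GrComVA.{u}} {f : (⨁ Δ, V.wt Δ) →ₗ[ℂ] ⨁ Δ, W.wt Δ}
  (hf : GradedVertexAlgebra.IsHom V.va W.va f)

theorem costalkValue_pfaHom (a : V.pfa.costalk) :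
    W.costalkValue ((pfaHom hf).costalkMap a) = barLin f (V.costalkValue a) :=
  FLocObj.counit_mapAlg (bar hf) (disc 0 1) _

theorem stateValue_pfaHom (a : V.pfa.StateSpace) :
    W.stateValue ((pfaHom hf).stateMap a) = barLin f (V.stateValue a) := by
  have : W.stateValue ∘ₗ (pfaHom hf).stateMap = barLin f ∘ₗ V.stateValue :=
    DirectSum.linearMap_ext ℂ fun Δ => LinearMap.ext fun x => by
      simp only [LinearMap.comp_apply]
      rw [Hom.stateMap, DirectSum.toModule_lof, LinearMap.comp_apply, stateValue_lof,
        stateValue_lof]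
      exact costalkValue_pfaHom hf x
  exact LinearMap.congr_fun this a

/-- On `V_Δ`, `barLin f` keeps only the component of `f` at `Δ`; nothing is lost because `f`
preserves weights. -/
theorem barLin_incl (hf : GradedVertexAlgebra.IsHom V.va W.va f) (v : ⨁ Δ, V.wt Δ) : barLin f (incl v) = incl (f v) := by
  have : barLin f ∘ₗ inclLin V = inclLin W ∘ₗ f :=
    DirectSum.linearMap_ext ℂ fun p => LinearMap.ext fun x => by
      change barLin f (incl (V.inc p x)) = incl (f (V.inc p x))
      rw [incl_inc, barLin_single, ← incl_inc, inc_prj_map hf]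
  exact LinearMap.congr_fun this v

/-- After `stateValue`, both composites send `v` to the image of `f v` in the completion of `W`. -/
theorem stateMap_comp_eta : (pfaHom hf).stateMap ∘ₗ V.eta = W.eta ∘ₗ f := by
  refine LinearMap.ext fun v => W.stateValue_injective ?_
  rw [← etaEquiv_toLinearMap, ← etaEquiv_toLinearMap]
  change W.stateValue ((pfaHom hf).stateMap (V.etaEquiv v)) = W.stateValue (W.etaEquiv (f v))
  rw [stateValue_pfaHom, stateValue_etaEquiv, stateValue_etaEquiv, barLin_incl hf]

end Naturality

end GrComVA

/-! ### Assembly of the proposition. -/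

theorem mainTheorem4 (V : GrComVA.{u}) :
    V.pfa.IsHolomorphic ∧
    (∃ S : GradedVertexAlgebra fun Δ => V.pfa.costalkWeight Δ,
      V.pfa.IsVertexAlgebra S ∧ (∀ S', V.pfa.IsVertexAlgebra S' → S' = S) ∧
      S.IsCommutative ∧
      (∃ N : ℤ, ∀ Δ < N, Subsingleton (V.pfa.costalkWeight Δ)) ∧
      (∀ Δ : ℤ, FiniteDimensional ℂ (V.pfa.costalkWeight Δ)) ∧
      GradedVertexAlgebra.IsIso V.va S V.eta) ∧
    ∀ (W : GrComVA.{u}) (f : (⨁ Δ, V.wt Δ) →ₗ[ℂ] ⨁ Δ, W.wt Δ)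
      (hf : GradedVertexAlgebra.IsHom V.va W.va f),
      (GrComVA.pfaHom hf).stateMap ∘ₗ V.eta = W.eta ∘ₗ f := by
  refine ⟨V.isHolomorphic_pfa, ⟨V.stateVA, V.isVertexAlgebra_stateVA,
    fun S' hS' => V.eq_of_isVertexAlgebra hS' V.isVertexAlgebra_stateVA,
    GradedVertexAlgebra.isCommutative_transport _ _ _ _ V.comm,
    V.bdd.imp fun N hN Δ hΔ => ?_, fun Δ => Module.Finite.equiv (V.etaWeightEquiv Δ), ?_⟩,
    fun W f hf => GrComVA.stateMap_comp_eta hf⟩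
  · have := hN Δ hΔ
    exact (V.etaWeightEquiv Δ).symm.toEquiv.subsingleton
  · rw [← V.etaEquiv_toLinearMap]
    exact GradedVertexAlgebra.isIso_transport _ _ _ _
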